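/- **Setting.** Let $p_1,p_2\in\mathbb N$ and $p=p_1p_2$. A weighted graph on $p_i$ vertices without self-loops is given by a vector $w_i\ge 0$ of $p_i(p_i-1)/2$ edge weights; $W_i$ is its symmetric weighted adjacency matrix and $D_i$ its diagonal matrix of weighted degrees. The Laplacian of the Kronecker product graph is $L(w_1,w_2)=D_1\otimes D_2-W_1\otimes W_2\in\mathbb R^{p\times p}$. Let $w_1^*,w_2^*\ge 0$ be the true factor graphs, $L^*=L(w_1^*,w_2^*)$, and assume, with constants $s_1,s_2>0$, $d>1$, $z>1$: * (A1) $w_1^*$ and $w_2^*$ have at most $s_1p_1$ and $s_2p_2$ nonzero entries, respectively; * (A2) all weighted degrees of both factor graphs lie in $[1/d,d]$; * (A3) the eigenvalues of $L^*$, with multiplicity, are $0,\lambda_2,\dots,\lambda_p$ with $1/z\le\lambda_k\le z$ for $2\le k\le p$. Let $x_1,\dots,x_n$ be i.i.d. $N(0,(L^*)^\dagger)$ vectors in $\mathbb R^{p}$, where $\dagger$ is the Moore–Penrose inverse, and $S=\frac1n\sum_k x_kx_k^T$. For penalties $\alpha_1,\alpha_2>0$, a penalized maximum likelihood estimator is a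 global minimizer $(\hat w_1,\hat w_2)$ of $$\operatorname{Tr}\bigl(L(w_1,w_2)S\bigr)-\log{\det}^\dagger L(w_1,w_2)+\alpha_1\|w_1\|_1+\alpha_2\|w_2\|_1$$ over all $w_1,w_2\ge0$ whose product graph is connected, i.e. $L(w_1,w_2)+\frac1p\mathbf 1\mathbf 1^T\succ0$; here ${\det}^\dagger$ is the product of the nonzero eigenvalues. Put $\hat L=L(\hat w_1,\hat w_2)$. **Theorem (high-dimensional consistency).** Fix $s_1,s_2,d,z$ and a constant $a>0$. 1. For every $\tau>0$ there are constants $c,C>0$ depending only on $s_1,s_2,d,z,a,\tau$ such that, for all $p_1,p_2,n$ and all true graphs satisfying (A1)–(A3), if $n\ge C\bigl(\frac{p_1}{p_2}+\frac{p_2}{p_1}\bigr)\log p$ and $0<\alpha_1\le a\sqrt{p_2\log p/n}$, $0<\alpha_2\le a\sqrt{p_1\log p/n}$, then with probability at least $1-p^{-\tau}$ a penalized maximum likelihood estimator exists and every such estimator satisfies $$\|\hat L-L^*\|_F\le c\sqrt{\frac{(p_1+p_2)\log p}{n}}.$$ 2. Consequently the estimator is asymptotically consistent: for all $\varepsilon,\delta>0$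 there is $\rho>0$, depending only on $\varepsilon,\delta,s_1,s_2,d,z,a$, such that whenever (A1)–(A3) hold, $(p_1+p_2)\log p\le\rho n$ and the penalties are in the above range, then with probability at least $1-\delta$ a penalized maximum likelihood estimator exists and every such estimator satisfies $\|\hat L-L^*\|_F\le\varepsilon$. -/

import Mathlib

open MeasureTheory ProbabilityTheory Matrix
open scoped Kronecker

universe u

namespace KSGL

noncomputable section

/-- Unordered pairs of distinct vertices, listed as `(i, j)` with `j < i`; there are
`p (p - 1) / 2` of them. -/
abbrev Edge (p : ℕ) : Type := {e : Fin p × Fin p // e.2 < e.1}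

/-- Weighted adjacency matrix (symmetric, zero diagonal) of a weight vector. -/
def adj {p : ℕ} (w : Edge p → ℝ) : Matrix (Fin p) (Fin p) ℝ :=
  Matrix.of fun i j =>
    if h : j < i then w ⟨(i, j), h⟩ else if h : i < j then w ⟨(j, i), h⟩ else 0

/-- Weighted degree of a vertex. -/
def degree {p : ℕ} (w : Edge p → ℝ) (i : Fin p) : ℝ := ∑ j, adj w i j

/-- Laplacian `D₁ ⊗ D₂ - W₁ ⊗ W₂` of the Kronecker product of two weighted graphs. -/
def kronLaplacian {p₁ p₂ : ℕ} (w₁ : Edge p₁ → ℝ) (w₂ : Edge p₂ → ℝ) :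
    Matrix (Fin p₁ × Fin p₂) (Fin p₁ × Fin p₂) ℝ :=
  Matrix.diagonal (degree w₁) ⊗ₖ Matrix.diagonal (degree w₂) - adj w₁ ⊗ₖ adj w₂

/-- The averaging matrix `J = (1/p) 1 1ᵀ`. -/
def avgMatrix (ι : Type*) [Fintype ι] : Matrix ι ι ℝ :=
  Matrix.of fun _ _ => (Fintype.card ι : ℝ)⁻¹

/-- Pseudo-determinant: the product, with multiplicity, of the nonzero (real) eigenvalues. -/
def pseudoDet {ι : Type*} [Fintype ι] [DecidableEq ι] (A : Matrix ι ι ℝ) : ℝ :=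
  (A.charpoly.roots.filter (fun x => x ≠ 0)).prod

/-- `B` is the Moore–Penrose pseudo-inverse of the real matrix `A`. -/
structure IsMoorePenroseInverse {ι : Type*} [Fintype ι] (A B : Matrix ι ι ℝ) : Prop where
  mul_mul_left : A * B * A = A
  mul_mul_right : B * A * B = B
  symm_left : (A * B)ᵀ = A * B
  symm_right : (B * A)ᵀ = B * A

/-- Frobenius norm. -/
def frobNorm {ι : Type*} [Fintype ι] (A : Matrix ι ι ℝ) : ℝ :=
  Real.sqrt (∑ i, ∑ j, A i j ^ 2)

/-- Sample covariance matrix `S = (1/n) ∑ₖ xₖ xₖᵀ` (no centering). -/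
def sampleCov {ι : Type*} {n : ℕ} (x : Fin n → EuclideanSpace ℝ ι) : Matrix ι ι ℝ :=
  Matrix.of fun i j => (n : ℝ)⁻¹ * ∑ k, x k i * x k j

/-- Penalized negative log-likelihood
`⟨L, S⟩ - log det† L + α₁ ‖w₁‖₁ + α₂ ‖w₂‖₁` with `L = D₁ ⊗ D₂ - W₁ ⊗ W₂`
(the weights are nonnegative on the feasible set). -/
def penNegLogLik {p₁ p₂ : ℕ} (α₁ α₂ : ℝ)
    (S : Matrix (Fin p₁ × Fin p₂) (Fin p₁ × Fin p₂) ℝ)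
    (w₁ : Edge p₁ → ℝ) (w₂ : Edge p₂ → ℝ) : ℝ :=
  (kronLaplacian w₁ w₂ * S).trace - Real.log (pseudoDet (kronLaplacian w₁ w₂))
    + α₁ * ∑ e, w₁ e + α₂ * ∑ e, w₂ e

/-- Feasible weights: nonnegative, with connected product graph, i.e. `L + J` positive definite
(this forces both factor graphs to be connected). -/
def Feasible {p₁ p₂ : ℕ} (w₁ : Edge p₁ → ℝ) (w₂ : Edge p₂ → ℝ) : Prop :=
  (∀ e, 0 ≤ w₁ e) ∧ (∀ e, 0 ≤ w₂ e) ∧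
    (kronLaplacian w₁ w₂ + avgMatrix (Fin p₁ × Fin p₂)).PosDef

/-- `(v₁, v₂)` is a global minimizer of the penalized negative log-likelihood. -/
def IsPenalizedMLE {p₁ p₂ : ℕ} (α₁ α₂ : ℝ)
    (S : Matrix (Fin p₁ × Fin p₂) (Fin p₁ × Fin p₂) ℝ)
    (v₁ : Edge p₁ → ℝ) (v₂ : Edge p₂ → ℝ) : Prop :=
  Feasible v₁ v₂ ∧
    ∀ u₁ u₂, Feasible u₁ u₂ → penNegLogLik α₁ α₂ S v₁ v₂ ≤ penNegLogLik α₁ α₂ S u₁ u₂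

/-- Assumptions on the true factor graphs: nonnegative weights, at most `sᵢ pᵢ` edges, weighted
degrees in `[1/d, d]`, and product-Laplacian spectrum `0, λ₂, …, λₚ` (with multiplicity) with
`λ₂, …, λₚ` in `[1/z, z]`. -/
structure TrueGraphs (s₁ s₂ d z : ℝ) {p₁ p₂ : ℕ} (w₁ : Edge p₁ → ℝ) (w₂ : Edge p₂ → ℝ) :
    Prop where
  nonneg₁ : ∀ e, 0 ≤ w₁ e
  nonneg₂ : ∀ e, 0 ≤ w₂ e
  sparse₁ : ((Finset.univ.filter fun e => w₁ e ≠ 0).card : ℝ) ≤ s₁ * p₁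
  sparse₂ : ((Finset.univ.filter fun e => w₂ e ≠ 0).card : ℝ) ≤ s₂ * p₂
  degree₁ : ∀ i, 1 / d ≤ degree w₁ i ∧ degree w₁ i ≤ d
  degree₂ : ∀ i, 1 / d ≤ degree w₂ i ∧ degree w₂ i ≤ d
  spectrum : ∃ l : Multiset ℝ, (kronLaplacian w₁ w₂).charpoly.roots = 0 ::ₘ l ∧
    ∀ x ∈ l, 1 / z ≤ x ∧ x ≤ z

/-- `X₁, …, Xₙ` are i.i.d. `N(0, L†)`: a sample of the improper Gaussian Markov random field
with precision matrix `L`. -/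
def IsIGMRFSample {ι : Type*} [Fintype ι] [DecidableEq ι] {n : ℕ} {Ω : Type*}
    [MeasurableSpace Ω] (μ : Measure Ω) (L : Matrix ι ι ℝ)
    (X : Fin n → Ω → EuclideanSpace ℝ ι) : Prop :=
  iIndepFun X μ ∧
    ∃ C : Matrix ι ι ℝ, IsMoorePenroseInverse L C ∧
      ∀ k, HasLaw (X k) (multivariateGaussian 0 C) μ

/-- The event that the penalized MLE does not exist, or that some penalized MLE has
product-Laplacian Frobenius error larger than `r`. -/
def failureEvent {p₁ p₂ n : ℕ} {Ω : Type*} (α₁ α₂ : ℝ)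
    (X : Fin n → Ω → EuclideanSpace ℝ (Fin p₁ × Fin p₂))
    (w₁ : Edge p₁ → ℝ) (w₂ : Edge p₂ → ℝ) (r : ℝ) : Set Ω :=
  {ω | ¬ ((∃ v₁ v₂, IsPenalizedMLE α₁ α₂ (sampleCov fun k => X k ω) v₁ v₂) ∧
    ∀ v₁ v₂, IsPenalizedMLE α₁ α₂ (sampleCov fun k => X k ω) v₁ v₂ →
      frobNorm (kronLaplacian v₁ v₂ - kronLaplacian w₁ w₂) ≤ r)}

/-- Order of magnitude of the penalties, up to the constant `a`:
`0 < α₁ ≤ a √(p₂ log p / n)` and `0 < α₂ ≤ a √(p₁ log p / n)` with `p = p₁ p₂`. -/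
def ProperPenalty (a : ℝ) (p₁ p₂ n : ℕ) (α₁ α₂ : ℝ) : Prop :=
  (0 < α₁ ∧ α₁ ≤ a * Real.sqrt (p₂ * Real.log (p₁ * p₂) / n)) ∧
    (0 < α₂ ∧ α₂ ≤ a * Real.sqrt (p₁ * Real.log (p₁ * p₂) / n))

end

end KSGL

/-!
Write `M` for the true and `N` for the estimated product Laplacian, both with the averaging matrix
`J` added, and measure the error by the divergence `D = tr (M⁻¹ (N - M)) - log det N + log det M`.
For symmetric `V` with `|⟨ξ, V ξ⟩| ≤ |ξ|² / (2 z)`, duality for `-log det` gives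
`tr (V (N - M)) ≤ D + z² tr V²`. Testing it with multiples of the identity and with Kronecker
products of diagonal or adjacency matrices turns `D` into control of the total weights, the degrees
and the edge weights of the estimated factors.

Comparing a minimiser with the truth, rescaled between the factors so that the two penalties
balance, bounds `D` by the noise `⟨L* - L̂, S - C⟩` plus a penalty term, where `C` is the
pseudo-inverse of `L*`. Chernoff bounds for Gaussian quadratic forms at edge indicators and a union
bound control the noise uniformly in the estimate, since it is linear in the products of edge
weights of the two factors. A crude bound first localises the minimiser. Then the positive part of
`true weight - estimated weight` lives on the sparse true edge set, so that `ℓ¹` errors are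
dominated by `ℓ²` errors, and noise and penalty become at most `ε D + const · rate²`. Hence `√D` is
at most a multiple of the rate, and closeness of the rank-one tensors of degrees and of weights
converts this into the Frobenius bound. A minimiser exists because the penalised likelihood is
coercive and `-log det` is a barrier at the boundary of the feasible set.
-/

namespace KSGL

section QuadraticForm

variable {ι : Type*} [Fintype ι]

lemma dotProduct_mulVec_eq_sum (A : Matrix ι ι ℝ) (ξ : ι → ℝ) :
    ξ ⬝ᵥ A *ᵥ ξ = ∑ x, ∑ y, A x y * ξ x * ξ y := by
  simp only [dotProduct, mulVec, Finset.mul_sum]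
  exact Finset.sum_congr rfl fun x _ => Finset.sum_congr rfl fun y _ => by ring

lemma dotProduct_self_nonneg (ξ : ι → ℝ) : 0 ≤ ξ ⬝ᵥ ξ := by
  simpa using dotProduct_star_self_nonneg ξ

lemma dotProduct_sq_le (ξ η : ι → ℝ) : (ξ ⬝ᵥ η) ^ 2 ≤ (ξ ⬝ᵥ ξ) * (η ⬝ᵥ η) := by
  simpa [dotProduct, sq] using Finset.sum_mul_sq_le_sq_mul_sq Finset.univ ξ η

lemma dotProduct_conj_mulVec (Q V : Matrix ι ι ℝ) (ξ : ι → ℝ) :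
    ξ ⬝ᵥ (Q * V * Qᵀ) *ᵥ ξ = (Qᵀ *ᵥ ξ) ⬝ᵥ V *ᵥ (Qᵀ *ᵥ ξ) := by
  rw [← mulVec_mulVec, ← mulVec_mulVec, dotProduct_mulVec ξ Q, mulVec_transpose]

lemma trace_transpose_mul_mul_le {M : Matrix ι ι ℝ} {z : ℝ}
    (h : ∀ ξ : ι → ℝ, ξ ⬝ᵥ M *ᵥ ξ ≤ z * (ξ ⬝ᵥ ξ)) (B : Matrix ι ι ℝ) :
    (Bᵀ * M * B).trace ≤ z * (Bᵀ * B).trace := by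
  have hdiag (i : ι) : (Bᵀ * M * B) i i = B.col i ⬝ᵥ M *ᵥ B.col i := by
    rw [mul_assoc]
    rfl
  simp only [trace, diag, Finset.mul_sum, hdiag]
  exact Finset.sum_le_sum fun i _ => h _

lemma transpose_mulVec_dotProduct_self_le {Q : Matrix ι ι ℝ} {z : ℝ} (hz : 0 ≤ z)
    (h : ∀ ξ : ι → ℝ, ξ ⬝ᵥ (Qᵀ * Q) *ᵥ ξ ≤ z * (ξ ⬝ᵥ ξ)) (ξ : ι → ℝ) :
    (Qᵀ *ᵥ ξ) ⬝ᵥ (Qᵀ *ᵥ ξ) ≤ z * (ξ ⬝ᵥ ξ) := by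
  set η := Qᵀ *ᵥ ξ with hη
  have hself : η ⬝ᵥ η = ξ ⬝ᵥ (Q *ᵥ η) := by rw [dotProduct_mulVec ξ Q, hη, mulVec_transpose]
  have hQη : (Q *ᵥ η) ⬝ᵥ (Q *ᵥ η) ≤ z * (η ⬝ᵥ η) := by
    have := h η
    rwa [← mulVec_mulVec, dotProduct_mulVec, ← mulVec_transpose, transpose_transpose] at this
  have hξ := dotProduct_self_nonneg ξ
  have hsq : (η ⬝ᵥ η) * (η ⬝ᵥ η) ≤ (z * (ξ ⬝ᵥ ξ)) * (η ⬝ᵥ η) := by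
    have := dotProduct_sq_le ξ (Q *ᵥ η)
    rw [← hself] at this
    linarith [mul_le_mul_of_nonneg_left hQη hξ]
  rcases (dotProduct_self_nonneg η).eq_or_lt with hη₀ | hη₀
  · rw [← hη₀]
    positivity
  · exact le_of_mul_le_mul_right hsq hη₀

lemma abs_dotProduct_conj_mulVec_le {Q V : Matrix ι ι ℝ} {z : ℝ} (hz : 0 < z)
    (hQ : ∀ ξ : ι → ℝ, ξ ⬝ᵥ (Qᵀ * Q) *ᵥ ξ ≤ z * (ξ ⬝ᵥ ξ))
    (hV : ∀ ξ : ι → ℝ, |ξ ⬝ᵥ V *ᵥ ξ| ≤ 1 / (2 * z) * (ξ ⬝ᵥ ξ)) (ξ : ι → ℝ) :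
    |ξ ⬝ᵥ (Q * V * Qᵀ) *ᵥ ξ| ≤ 1 / 2 * (ξ ⬝ᵥ ξ) := by
  rw [dotProduct_conj_mulVec]
  calc |(Qᵀ *ᵥ ξ) ⬝ᵥ V *ᵥ (Qᵀ *ᵥ ξ)| ≤ 1 / (2 * z) * ((Qᵀ *ᵥ ξ) ⬝ᵥ (Qᵀ *ᵥ ξ)) := hV _
    _ ≤ 1 / (2 * z) * (z * (ξ ⬝ᵥ ξ)) := by
        gcongr
        exact transpose_mulVec_dotProduct_self_le hz.le hQ ξ
    _ = 1 / 2 * (ξ ⬝ᵥ ξ) := by field_simp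

lemma trace_conj_mul_conj_le {Q V : Matrix ι ι ℝ} {z : ℝ} (hz : 0 ≤ z) (hV : Vᵀ = V)
    (hQ : ∀ ξ : ι → ℝ, ξ ⬝ᵥ (Qᵀ * Q) *ᵥ ξ ≤ z * (ξ ⬝ᵥ ξ)) :
    (Q * V * Qᵀ * (Q * V * Qᵀ)).trace ≤ z ^ 2 * (V * V).trace :=
  calc (Q * V * Qᵀ * (Q * V * Qᵀ)).trace
      = ((V * Qᵀ)ᵀ * (Qᵀ * Q) * (V * Qᵀ)).trace := by
        simp only [transpose_mul, transpose_transpose, hV, mul_assoc]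
    _ ≤ z * ((V * Qᵀ)ᵀ * (V * Qᵀ)).trace := trace_transpose_mul_mul_le hQ _
    _ = z * (Vᵀ * (Qᵀ * Q) * V).trace := by
        rw [transpose_mul, transpose_transpose, hV, trace_mul_comm (Q * V)]
        simp only [mul_assoc]
    _ ≤ z * (z * (Vᵀ * V).trace) :=
        mul_le_mul_of_nonneg_left (trace_transpose_mul_mul_le hQ V) hz
    _ = z ^ 2 * (V * V).trace := by rw [hV]; ring

end QuadraticForm

section Graph

variable {p : ℕ}

lemma adj_symm (w : Edge p → ℝ) (i j : Fin p) : adj w i j = adj w j i := by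
  rcases lt_trichotomy i j with h | h | h
  · simp [adj, h, h.not_gt]
  · simp [h]
  · simp [adj, h, h.not_gt]

lemma adj_transpose (w : Edge p → ℝ) : (adj w)ᵀ = adj w := by
  ext i j
  exact adj_symm w j i

lemma adj_self (w : Edge p → ℝ) (i : Fin p) : adj w i i = 0 := by simp [adj]

lemma adj_edge (w : Edge p → ℝ) (e : Edge p) : adj w e.1.1 e.1.2 = w e := by
  simp [adj, e.2]

lemma adj_nonneg {w : Edge p → ℝ} (hw : ∀ e, 0 ≤ w e) (i j : Fin p) : 0 ≤ adj w i j := by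
  unfold adj
  simp only [of_apply]
  split_ifs <;> first | exact hw _ | exact le_rfl

lemma adj_add (w w' : Edge p → ℝ) : adj (w + w') = adj w + adj w' := by
  ext i j
  simp only [adj, of_apply, Pi.add_apply, Matrix.add_apply]
  split_ifs <;> simp

lemma adj_smul (c : ℝ) (w : Edge p → ℝ) : adj (c • w) = c • adj w := by
  ext i j
  simp only [adj, of_apply, Pi.smul_apply, Matrix.smul_apply]
  split_ifs <;> simp

lemma abs_adj (w : Edge p → ℝ) (i j : Fin p) : |adj w i j| = adj (fun e => |w e|) i j := by
  simp only [adj, of_apply]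
  split_ifs <;> simp

lemma adj_mono {w w' : Edge p → ℝ} (h : ∀ e, w e ≤ w' e) (i j : Fin p) :
    adj w i j ≤ adj w' i j := by
  simp only [adj, of_apply]
  split_ifs <;> first | exact h _ | exact le_rfl

lemma degree_add (w w' : Edge p → ℝ) : degree (w + w') = degree w + degree w' := by
  ext i; simp [degree, adj_add, Finset.sum_add_distrib]

lemma diagonal_degree_add (w w' : Edge p → ℝ) :
    diagonal (degree (w + w')) = diagonal (degree w) + diagonal (degree w') := by
  rw [degree_add]
  exact (diagonal_add _ _).symm

lemma degree_smul (c : ℝ) (w : Edge p → ℝ) : degree (c • w) = c • degree w := by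
  ext i; simp [degree, adj_smul, Finset.mul_sum]

lemma degree_nonneg {w : Edge p → ℝ} (hw : ∀ e, 0 ≤ w e) (i : Fin p) : 0 ≤ degree w i :=
  Finset.sum_nonneg fun j _ => adj_nonneg hw i j

lemma sum_edge_eq_sum_dite (f : Edge p → ℝ) :
    ∑ x : Fin p × Fin p, (if h : x.2 < x.1 then f ⟨x, h⟩ else 0) = ∑ e, f e := by
  classical
  rw [Finset.sum_dite, Finset.sum_const_zero, add_zero]
  refine Finset.sum_bij (fun x _ => ⟨x.1, (Finset.mem_filter.1 x.2).2⟩) (by simp) ?_ ?_ (by simp)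
  · rintro ⟨a, ha⟩ _ ⟨b, hb⟩ _ h
    simpa using h
  · rintro ⟨b, hb⟩ _
    exact ⟨⟨b, by simpa using hb⟩, by simp, rfl⟩

lemma sum_adj_mul (w : Edge p → ℝ) (g : Fin p → Fin p → ℝ) (hg : ∀ i j, g i j = g j i) :
    ∑ i, ∑ j, adj w i j * g i j = 2 * ∑ e, w e * g e.1.1 e.1.2 := by
  have h_split : ∑ i, ∑ j, adj w i j * g i j =
      ∑ x : Fin p × Fin p, ((if h : x.2 < x.1 then w ⟨x, h⟩ * g x.1 x.2 else 0) +
        (if h : x.1 < x.2 then w ⟨(x.2, x.1), h⟩ * g x.1 x.2 else 0)) := by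
    rw [← Fintype.sum_prod_type']
    refine Finset.sum_congr rfl fun x _ => ?_
    rcases lt_trichotomy x.1 x.2 with h | h | h
    · simp [adj, h, h.not_gt]
    · simp [adj, h]
    · simp [adj, h, h.not_gt]
  rw [h_split, Finset.sum_add_distrib, two_mul]
  congr 1
  · exact sum_edge_eq_sum_dite fun e => w e * g e.1.1 e.1.2
  · rw [← sum_edge_eq_sum_dite fun e => w e * g e.1.1 e.1.2]
    refine Fintype.sum_equiv (Equiv.prodComm _ _) _ _ fun x => ?_
    simp [hg x.1 x.2]
    rfl

lemma sum_adj_mul_adj (w x : Edge p → ℝ) :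
    ∑ i, ∑ j, adj w i j * adj x i j = 2 * ∑ e, w e * x e := by
  rw [sum_adj_mul w _ (adj_symm x)]
  simp only [adj_edge]

lemma sum_degree (w : Edge p → ℝ) : ∑ i, degree w i = 2 * ∑ e, w e := by
  simpa [degree] using sum_adj_mul w (fun _ _ => 1) (by simp)

lemma trace_adj_mul_adj (w x : Edge p → ℝ) :
    (adj w * adj x).trace = 2 * ∑ e, w e * x e := by
  rw [← sum_adj_mul_adj]
  simp only [trace, diag, mul_apply]
  exact Finset.sum_congr rfl fun i _ => Finset.sum_congr rfl fun j _ => by rw [adj_symm x j i]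

lemma le_degree {w : Edge p → ℝ} (hw : ∀ e, 0 ≤ w e) (e : Edge p) : w e ≤ degree w e.1.1 := by
  rw [← adj_edge w e]
  exact Finset.single_le_sum (f := fun j => adj w e.1.1 j)
    (fun j _ => adj_nonneg hw _ j) (Finset.mem_univ _)

end Graph

section Kron

variable {p₁ p₂ : ℕ}

lemma kronLaplacian_apply (w₁ : Edge p₁ → ℝ) (w₂ : Edge p₂ → ℝ) (x y : Fin p₁ × Fin p₂) :
    kronLaplacian w₁ w₂ x y =
      (if x = y then degree w₁ x.1 * degree w₂ x.2 else 0) - adj w₁ x.1 y.1 * adj w₂ x.2 y.2 := by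
  simp only [kronLaplacian, Matrix.sub_apply, kroneckerMap_apply, diagonal_apply, Prod.ext_iff]
  congr 1
  by_cases hfst : x.1 = y.1 <;> by_cases hsnd : x.2 = y.2 <;> simp [hfst, hsnd]

/-- The Kronecker product Laplacian as a bilinear map of the two weight vectors, which gives
access to the `LinearMap` expansion lemmas. -/
noncomputable def kronLaplacianBilin (p₁ p₂ : ℕ) :
    (Edge p₁ → ℝ) →ₗ[ℝ] (Edge p₂ → ℝ) →ₗ[ℝ] Matrix (Fin p₁ × Fin p₂) (Fin p₁ × Fin p₂) ℝ :=
  LinearMap.mk₂ ℝ kronLaplacian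
    (fun _ _ _ => by
      simp only [kronLaplacian, adj_add, diagonal_degree_add, add_kronecker]; abel)
    (fun _ _ _ => by
      simp only [kronLaplacian, adj_smul, degree_smul, diagonal_smul, smul_kronecker, smul_sub])
    (fun _ _ _ => by
      simp only [kronLaplacian, adj_add, diagonal_degree_add, kronecker_add]; abel)
    (fun _ _ _ => by
      simp only [kronLaplacian, adj_smul, degree_smul, diagonal_smul, kronecker_smul, smul_sub])

lemma kronLaplacianBilin_apply (w₁ : Edge p₁ → ℝ) (w₂ : Edge p₂ → ℝ) :
    kronLaplacianBilin p₁ p₂ w₁ w₂ = kronLaplacian w₁ w₂ := rfl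

lemma kronLaplacian_smul_smul_inv {t : ℝ} (ht : t ≠ 0) (w₁ : Edge p₁ → ℝ) (w₂ : Edge p₂ → ℝ) :
    kronLaplacian (t • w₁) (t⁻¹ • w₂) = kronLaplacian w₁ w₂ := by
  simp [← kronLaplacianBilin_apply, smul_smul, ht]

lemma kronLaplacian_transpose (w₁ : Edge p₁ → ℝ) (w₂ : Edge p₂ → ℝ) :
    (kronLaplacian w₁ w₂)ᵀ = kronLaplacian w₁ w₂ := by
  ext x y
  rw [transpose_apply, kronLaplacian_apply, kronLaplacian_apply, adj_symm w₁ y.1,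
    adj_symm w₂ y.2]
  congr 1
  by_cases h : x = y
  · simp [h]
  · rw [if_neg h, if_neg (Ne.symm h)]

lemma sum_kronLaplacian_row (w₁ : Edge p₁ → ℝ) (w₂ : Edge p₂ → ℝ) (x : Fin p₁ × Fin p₂) :
    ∑ y, kronLaplacian w₁ w₂ x y = 0 := by
  simp only [kronLaplacian_apply, Finset.sum_sub_distrib]
  rw [Fintype.sum_prod_type (f := fun y : Fin p₁ × Fin p₂ => adj w₁ x.1 y.1 * adj w₂ x.2 y.2)]
  simp [← Finset.mul_sum, ← Finset.sum_mul, degree]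

lemma kronLaplacian_mul_avgMatrix (w₁ : Edge p₁ → ℝ) (w₂ : Edge p₂ → ℝ) :
    kronLaplacian w₁ w₂ * avgMatrix (Fin p₁ × Fin p₂) = 0 := by
  ext x y
  simp [mul_apply, avgMatrix, ← Finset.sum_mul, sum_kronLaplacian_row]

lemma avgMatrix_transpose (ι : Type*) [Fintype ι] : (avgMatrix ι)ᵀ = avgMatrix ι := by
  ext; simp [avgMatrix]

lemma sum_adj_prod_left (w₁ : Edge p₁ → ℝ) (w₂ : Edge p₂ → ℝ) (f : Fin p₁ × Fin p₂ → ℝ) :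
    ∑ x : Fin p₁ × Fin p₂, ∑ y : Fin p₁ × Fin p₂, adj w₁ x.1 y.1 * adj w₂ x.2 y.2 * f x =
      ∑ x : Fin p₁ × Fin p₂, degree w₁ x.1 * degree w₂ x.2 * f x := by
  refine Finset.sum_congr rfl fun x _ => ?_
  rw [← Finset.sum_mul, Fintype.sum_prod_type]
  simp [← Finset.mul_sum, ← Finset.sum_mul, degree]

lemma sum_adj_prod_right (w₁ : Edge p₁ → ℝ) (w₂ : Edge p₂ → ℝ) (f : Fin p₁ × Fin p₂ → ℝ) :
    ∑ x : Fin p₁ × Fin p₂, ∑ y : Fin p₁ × Fin p₂, adj w₁ x.1 y.1 * adj w₂ x.2 y.2 * f y =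
      ∑ x : Fin p₁ × Fin p₂, degree w₁ x.1 * degree w₂ x.2 * f x := by
  rw [Finset.sum_comm, ← sum_adj_prod_left]
  exact Finset.sum_congr rfl fun x _ => Finset.sum_congr rfl fun y _ => by
    rw [adj_symm w₁ y.1, adj_symm w₂ y.2]

lemma dotProduct_kronLaplacian_mulVec (w₁ : Edge p₁ → ℝ) (w₂ : Edge p₂ → ℝ)
    (ξ : Fin p₁ × Fin p₂ → ℝ) :
    ξ ⬝ᵥ kronLaplacian w₁ w₂ *ᵥ ξ =
      2⁻¹ * ∑ x, ∑ y, adj w₁ x.1 y.1 * adj w₂ x.2 y.2 * (ξ x - ξ y) ^ 2 := by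
  have hL := sum_adj_prod_left w₁ w₂ fun x => ξ x ^ 2
  have hR := sum_adj_prod_right w₁ w₂ fun x => ξ x ^ 2
  have h_expand : ∑ x : Fin p₁ × Fin p₂, ∑ y : Fin p₁ × Fin p₂,
        adj w₁ x.1 y.1 * adj w₂ x.2 y.2 * (ξ x - ξ y) ^ 2 =
      ∑ x : Fin p₁ × Fin p₂, ∑ y : Fin p₁ × Fin p₂, adj w₁ x.1 y.1 * adj w₂ x.2 y.2 * ξ x ^ 2 +
      ∑ x : Fin p₁ × Fin p₂, ∑ y : Fin p₁ × Fin p₂, adj w₁ x.1 y.1 * adj w₂ x.2 y.2 * ξ y ^ 2 -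
      2 * ∑ x : Fin p₁ × Fin p₂, ∑ y : Fin p₁ × Fin p₂,
        adj w₁ x.1 y.1 * adj w₂ x.2 y.2 * ξ x * ξ y := by
    simp only [Finset.mul_sum, ← Finset.sum_add_distrib, ← Finset.sum_sub_distrib]
    exact Finset.sum_congr rfl fun x _ => Finset.sum_congr rfl fun y _ => by ring
  rw [h_expand, hL, hR, dotProduct_mulVec_eq_sum]
  simp only [kronLaplacian_apply, sub_mul, Finset.sum_sub_distrib, ite_mul, zero_mul,
    Finset.sum_ite_eq, Finset.mem_univ, if_true]
  have h_sq : ∑ x : Fin p₁ × Fin p₂, degree w₁ x.1 * degree w₂ x.2 * ξ x * ξ x =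
      ∑ x : Fin p₁ × Fin p₂, degree w₁ x.1 * degree w₂ x.2 * ξ x ^ 2 :=
    Finset.sum_congr rfl fun x _ => by ring
  rw [h_sq]; ring

lemma dotProduct_kronLaplacian_mulVec_nonneg {w₁ : Edge p₁ → ℝ} {w₂ : Edge p₂ → ℝ}
    (h₁ : ∀ e, 0 ≤ w₁ e) (h₂ : ∀ e, 0 ≤ w₂ e) (ξ : Fin p₁ × Fin p₂ → ℝ) :
    0 ≤ ξ ⬝ᵥ kronLaplacian w₁ w₂ *ᵥ ξ := by
  rw [dotProduct_kronLaplacian_mulVec]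
  refine mul_nonneg (by norm_num) (Finset.sum_nonneg fun x _ => Finset.sum_nonneg fun y _ => ?_)
  exact mul_nonneg (mul_nonneg (adj_nonneg h₁ _ _) (adj_nonneg h₂ _ _)) (sq_nonneg _)

lemma kronLaplacian_posSemidef {w₁ : Edge p₁ → ℝ} {w₂ : Edge p₂ → ℝ} (h₁ : ∀ e, 0 ≤ w₁ e)
    (h₂ : ∀ e, 0 ≤ w₂ e) : (kronLaplacian w₁ w₂).PosSemidef := by
  refine PosSemidef.of_dotProduct_mulVec_nonneg ?_ fun ξ => ?_
  · rw [IsHermitian, conjTranspose_eq_transpose_of_trivial, kronLaplacian_transpose]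
  · simpa using dotProduct_kronLaplacian_mulVec_nonneg h₁ h₂ ξ

lemma dotProduct_kronLaplacian_mulVec_le {w₁ : Edge p₁ → ℝ} {w₂ : Edge p₂ → ℝ} (h₁ : ∀ e, 0 ≤ w₁ e)
    (h₂ : ∀ e, 0 ≤ w₂ e) {K : ℝ} (hK : ∀ i j, degree w₁ i * degree w₂ j ≤ K)
    (ξ : Fin p₁ × Fin p₂ → ℝ) : ξ ⬝ᵥ kronLaplacian w₁ w₂ *ᵥ ξ ≤ 2 * K * (ξ ⬝ᵥ ξ) := by
  have h : ∑ x : Fin p₁ × Fin p₂, ∑ y : Fin p₁ × Fin p₂,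
        adj w₁ x.1 y.1 * adj w₂ x.2 y.2 * (ξ x - ξ y) ^ 2 ≤
      ∑ x : Fin p₁ × Fin p₂, ∑ y : Fin p₁ × Fin p₂,
        (2 * (adj w₁ x.1 y.1 * adj w₂ x.2 y.2 * ξ x ^ 2) +
          2 * (adj w₁ x.1 y.1 * adj w₂ x.2 y.2 * ξ y ^ 2)) := by
    refine Finset.sum_le_sum fun x _ => Finset.sum_le_sum fun y _ => ?_
    have := mul_nonneg (adj_nonneg h₁ x.1 y.1) (adj_nonneg h₂ x.2 y.2)
    nlinarith [mul_nonneg this (sq_nonneg (ξ x + ξ y))]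
  simp only [Finset.sum_add_distrib, ← Finset.mul_sum] at h
  rw [sum_adj_prod_left w₁ w₂ fun x => ξ x ^ 2, sum_adj_prod_right w₁ w₂ fun x => ξ x ^ 2] at h
  have h_degree : ∑ x : Fin p₁ × Fin p₂, degree w₁ x.1 * degree w₂ x.2 * ξ x ^ 2 ≤
      K * (ξ ⬝ᵥ ξ) := by
    rw [dotProduct, Finset.mul_sum]
    refine Finset.sum_le_sum fun x _ => ?_
    nlinarith [hK x.1 x.2, sq_nonneg (ξ x)]
  rw [dotProduct_kronLaplacian_mulVec]
  linarith

lemma trace_kronLaplacian (w₁ : Edge p₁ → ℝ) (w₂ : Edge p₂ → ℝ) :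
    (kronLaplacian w₁ w₂).trace = 4 * ((∑ e, w₁ e) * ∑ e, w₂ e) := by
  rw [kronLaplacian, trace_sub, trace_kronecker, trace_kronecker, trace_diagonal, trace_diagonal,
    sum_degree, sum_degree]
  simp only [trace, diag, adj_self, Finset.sum_const_zero]
  ring

lemma trace_kron_diagonal_mul_kronLaplacian (x : Fin p₁ → ℝ) (y : Fin p₂ → ℝ)
    (w₁ : Edge p₁ → ℝ) (w₂ : Edge p₂ → ℝ) :
    ((diagonal x ⊗ₖ diagonal y) * kronLaplacian w₁ w₂).trace =
      (∑ i, x i * degree w₁ i) * ∑ j, y j * degree w₂ j := by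
  rw [kronLaplacian, mul_sub, ← mul_kronecker_mul, ← mul_kronecker_mul, trace_sub,
    trace_kronecker, trace_kronecker, diagonal_mul_diagonal, diagonal_mul_diagonal]
  simp [trace, diag, diagonal_mul, adj_self]

lemma trace_kron_adj_mul_kronLaplacian (x w₁ : Edge p₁ → ℝ) (y w₂ : Edge p₂ → ℝ) :
    ((adj x ⊗ₖ adj y) * kronLaplacian w₁ w₂).trace =
      -(4 * ((∑ e, x e * w₁ e) * ∑ e, y e * w₂ e)) := by
  rw [kronLaplacian, mul_sub, ← mul_kronecker_mul, ← mul_kronecker_mul, trace_sub,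
    trace_kronecker, trace_kronecker, trace_adj_mul_adj, trace_adj_mul_adj]
  simp [trace, diag, mul_diagonal, adj_self]
  ring

end Kron

section FormBound

variable {ι κ : Type*} [Fintype ι] [Fintype κ]

/-- The entrywise absolute value of `A` is bounded by `a` as a bilinear form on `ℓ²`. -/
def AbsFormBound (A : Matrix ι ι ℝ) (a : ℝ) : Prop :=
  ∀ f g : ι → ℝ, (∀ i, 0 ≤ f i) → (∀ i, 0 ≤ g i) →
    ∑ i, ∑ j, |A i j| * f i * g j ≤ a * (√(∑ i, f i ^ 2) * √(∑ i, g i ^ 2))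

lemma absFormBound_of_rowSum {A : Matrix ι ι ℝ} {a : ℝ} (hA : ∀ i j, |A i j| = |A j i|)
    (h : ∀ i, ∑ j, |A i j| ≤ a) : AbsFormBound A a := by
  intro f g _ _
  rcases isEmpty_or_nonempty ι with _ | ⟨⟨i₀⟩⟩
  · simp
  have ha : 0 ≤ a := le_trans (Finset.sum_nonneg fun j _ => abs_nonneg _) (h i₀)
  have h_cauchy : ∑ i, ∑ j, |A i j| * f i * g j ≤
      √(∑ x : ι × ι, |A x.1 x.2| * f x.1 ^ 2) * √(∑ x : ι × ι, |A x.1 x.2| * g x.2 ^ 2) := by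
    rw [← Fintype.sum_prod_type']
    have := Real.sum_mul_le_sqrt_mul_sqrt Finset.univ
      (fun x : ι × ι => √|A x.1 x.2| * f x.1) (fun x : ι × ι => √|A x.1 x.2| * g x.2)
    simp only [mul_pow, Real.sq_sqrt (abs_nonneg _)] at this
    refine (le_of_eq (Finset.sum_congr rfl fun x _ => ?_)).trans this
    linear_combination (-(f x.1 * g x.2)) * Real.mul_self_sqrt (abs_nonneg (A x.1 x.2))
  have h_left : ∑ x : ι × ι, |A x.1 x.2| * f x.1 ^ 2 ≤ a * ∑ i, f i ^ 2 := by
    rw [Fintype.sum_prod_type, Finset.mul_sum]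
    refine Finset.sum_le_sum fun i _ => ?_
    simp only [← Finset.sum_mul]
    exact mul_le_mul_of_nonneg_right (h i) (sq_nonneg _)
  have h_right : ∑ x : ι × ι, |A x.1 x.2| * g x.2 ^ 2 ≤ a * ∑ i, g i ^ 2 := by
    rw [Fintype.sum_prod_type_right, Finset.mul_sum]
    refine Finset.sum_le_sum fun i _ => ?_
    simp only [← Finset.sum_mul, hA _ i]
    exact mul_le_mul_of_nonneg_right (h i) (sq_nonneg _)
  refine h_cauchy.trans ((mul_le_mul (Real.sqrt_le_sqrt h_left) (Real.sqrt_le_sqrt h_right)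
    (Real.sqrt_nonneg _) (Real.sqrt_nonneg _)).trans (le_of_eq ?_))
  rw [Real.sqrt_mul ha, Real.sqrt_mul ha]
  linear_combination (√(∑ i, f i ^ 2) * √(∑ i, g i ^ 2)) * Real.mul_self_sqrt ha

lemma absFormBound_diagonal [DecidableEq ι] {x : ι → ℝ} {a : ℝ} (h : ∀ i, |x i| ≤ a) :
    AbsFormBound (diagonal x) a := by
  refine absFormBound_of_rowSum (fun i j => ?_) fun i => ?_
  · rw [← transpose_apply (diagonal x), diagonal_transpose]
  · rw [Finset.sum_eq_single i (fun j _ hj => by simp [hj.symm]) (by simp), diagonal_apply_eq]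
    exact h i

lemma absFormBound_of_sum_sq (A : Matrix ι ι ℝ) :
    AbsFormBound A √(∑ i, ∑ j, A i j ^ 2) := by
  intro f g _ _
  have h := Real.sum_mul_le_sqrt_mul_sqrt Finset.univ (fun x : ι × ι => |A x.1 x.2|)
    (fun x : ι × ι => f x.1 * g x.2)
  simp only [Fintype.sum_prod_type, sq_abs, mul_pow, ← Finset.mul_sum, ← Finset.sum_mul] at h
  rw [Real.sqrt_mul (Finset.sum_nonneg fun _ _ => sq_nonneg _)] at h
  simpa only [mul_assoc] using h

lemma AbsFormBound.kronecker {A : Matrix ι ι ℝ} {B : Matrix κ κ ℝ} {a b : ℝ}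
    (hA : AbsFormBound A a) (hB : AbsFormBound B b) (hb : 0 ≤ b) :
    AbsFormBound (A ⊗ₖ B) (a * b) := by
  intro f g hf hg
  have h_prod : ∑ x, ∑ y, |(A ⊗ₖ B) x y| * f x * g y =
      ∑ i, ∑ i', |A i i'| * ∑ j, ∑ j', |B j j'| * f (i, j) * g (i', j') := by
    simp only [Fintype.sum_prod_type, kroneckerMap_apply, abs_mul, Finset.mul_sum]
    refine Finset.sum_congr rfl fun i _ => ?_
    rw [Finset.sum_comm]
    exact Finset.sum_congr rfl fun i' _ => Finset.sum_congr rfl fun j _ =>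
      Finset.sum_congr rfl fun j' _ => by ring
  have h_outer := hA (fun i => √(∑ j, f (i, j) ^ 2)) (fun i => √(∑ j, g (i, j) ^ 2))
    (fun _ => Real.sqrt_nonneg _) (fun _ => Real.sqrt_nonneg _)
  have hsq : ∀ (h : ι × κ → ℝ), ∑ i, √(∑ j, h (i, j) ^ 2) ^ 2 = ∑ x, h x ^ 2 := fun h => by
    rw [Fintype.sum_prod_type]
    exact Finset.sum_congr rfl fun i _ => Real.sq_sqrt (Finset.sum_nonneg fun _ _ => sq_nonneg _)
  rw [hsq, hsq] at h_outer
  rw [h_prod]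
  calc _ ≤ ∑ i, ∑ i', b * (|A i i'| * √(∑ j, f (i, j) ^ 2) * √(∑ j, g (i', j) ^ 2)) := by
        refine Finset.sum_le_sum fun i _ => Finset.sum_le_sum fun i' _ => ?_
        have := hB (fun j => f (i, j)) (fun j => g (i', j)) (fun _ => hf _) (fun _ => hg _)
        calc _ ≤ |A i i'| * _ := mul_le_mul_of_nonneg_left this (abs_nonneg _)
          _ = _ := by ring
    _ ≤ _ := by
        simp only [← Finset.mul_sum]
        calc _ ≤ b * _ := mul_le_mul_of_nonneg_left h_outer hb
          _ = _ := by ring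

lemma AbsFormBound.neg {A : Matrix ι ι ℝ} {a : ℝ} (hA : AbsFormBound A a) :
    AbsFormBound (-A) a := by
  simpa [AbsFormBound] using hA

lemma AbsFormBound.mono {A : Matrix ι ι ℝ} {a b : ℝ} (hA : AbsFormBound A a) (hab : a ≤ b) :
    AbsFormBound A b := fun f g hf hg =>
  (hA f g hf hg).trans (mul_le_mul_of_nonneg_right hab (by positivity))

lemma AbsFormBound.abs_dotProduct_mulVec_le {A : Matrix ι ι ℝ} {a : ℝ} (hA : AbsFormBound A a)
    (ξ : ι → ℝ) : |ξ ⬝ᵥ A *ᵥ ξ| ≤ a * (ξ ⬝ᵥ ξ) := by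
  have h := hA (fun i => |ξ i|) (fun i => |ξ i|) (fun _ => abs_nonneg _) (fun _ => abs_nonneg _)
  rw [Real.mul_self_sqrt (Finset.sum_nonneg fun _ _ => sq_nonneg _)] at h
  rw [dotProduct_mulVec_eq_sum]
  calc _ ≤ ∑ i, ∑ j, |A i j| * |ξ i| * |ξ j| := by
        refine (Finset.abs_sum_le_sum_abs _ _).trans (Finset.sum_le_sum fun i _ => ?_)
        refine (Finset.abs_sum_le_sum_abs _ _).trans (le_of_eq ?_)
        simp only [abs_mul]
    _ ≤ _ := h
    _ = _ := by simp [dotProduct, sq]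

lemma absFormBound_adj_of_abs_le {p : ℕ} {x w : Edge p → ℝ} {d : ℝ} (hxw : ∀ e, |x e| ≤ w e)
    (hd : ∀ i, degree w i ≤ d) : AbsFormBound (adj x) d := by
  refine absFormBound_of_rowSum (fun i j => by rw [adj_symm]) fun i => le_trans ?_ (hd i)
  refine Finset.sum_le_sum fun j _ => ?_
  rw [abs_adj]
  exact adj_mono hxw i j

lemma absFormBound_adj {p : ℕ} (x : Edge p → ℝ) :
    AbsFormBound (adj x) √(2 * ∑ e, x e ^ 2) := by
  have h := absFormBound_of_sum_sq (adj x)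
  have h_sum := sum_adj_mul_adj x x
  simp only [← sq] at h_sum
  rwa [h_sum] at h

end FormBound

section Spectral

variable {ι : Type*} [Fintype ι] [DecidableEq ι]

lemma exists_dotProduct_mulVec_eq_sum_eigenvalues {A : Matrix ι ι ℝ} (hA : A.IsHermitian)
    (ξ : ι → ℝ) :
    ∃ c : ι → ℝ, ξ ⬝ᵥ A *ᵥ ξ = ∑ i, hA.eigenvalues i * c i ^ 2 ∧ ξ ⬝ᵥ ξ = ∑ i, c i ^ 2 := by
  set U : Matrix ι ι ℝ := (hA.eigenvectorUnitary : Matrix ι ι ℝ)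
  have hUU : U * star U = 1 := Unitary.coe_mul_star_self _
  have hspec : A = U * diagonal hA.eigenvalues * star U := by
    conv_lhs => rw [hA.spectral_theorem]
    rfl
  have hst : star U = Uᵀ := by rw [star_eq_conjTranspose, conjTranspose_eq_transpose_of_trivial]
  rw [hst] at hspec hUU
  refine ⟨Uᵀ *ᵥ ξ, ?_, ?_⟩
  · have h_form : ξ ⬝ᵥ A *ᵥ ξ = (Uᵀ *ᵥ ξ) ⬝ᵥ (diagonal hA.eigenvalues *ᵥ (Uᵀ *ᵥ ξ)) := by
      conv_lhs => rw [hspec]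
      rw [← mulVec_mulVec, ← mulVec_mulVec, dotProduct_mulVec ξ U, mulVec_transpose]
    rw [h_form]
    simp only [dotProduct, mulVec_diagonal]
    exact Finset.sum_congr rfl fun i _ => by ring
  · have h_self : ξ ⬝ᵥ ξ = (Uᵀ *ᵥ ξ) ⬝ᵥ (Uᵀ *ᵥ ξ) := by
      rw [mulVec_transpose, ← dotProduct_mulVec, ← mulVec_transpose, mulVec_mulVec, hUU,
        one_mulVec]
    rw [h_self]
    simp only [dotProduct, sq]

lemma dotProduct_mulVec_le_of_eigenvalues_le {A : Matrix ι ι ℝ} (hA : A.IsHermitian) {b : ℝ}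
    (hb : ∀ i, hA.eigenvalues i ≤ b) (ξ : ι → ℝ) : ξ ⬝ᵥ A *ᵥ ξ ≤ b * (ξ ⬝ᵥ ξ) := by
  obtain ⟨c, h_form, h_self⟩ := exists_dotProduct_mulVec_eq_sum_eigenvalues hA ξ
  rw [h_form, h_self, Finset.mul_sum]
  exact Finset.sum_le_sum fun i _ => mul_le_mul_of_nonneg_right (hb i) (sq_nonneg _)

lemma le_dotProduct_mulVec_of_le_eigenvalues {A : Matrix ι ι ℝ} (hA : A.IsHermitian) {b : ℝ}
    (hb : ∀ i, b ≤ hA.eigenvalues i) (ξ : ι → ℝ) : b * (ξ ⬝ᵥ ξ) ≤ ξ ⬝ᵥ A *ᵥ ξ := by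
  obtain ⟨c, h_form, h_self⟩ := exists_dotProduct_mulVec_eq_sum_eigenvalues hA ξ
  rw [h_form, h_self, Finset.mul_sum]
  exact Finset.sum_le_sum fun i _ => mul_le_mul_of_nonneg_right (hb i) (sq_nonneg _)

lemma exists_dotProduct_mulVec_eq_eigenvalues {A : Matrix ι ι ℝ} (hA : A.IsHermitian) (i : ι) :
    ∃ ξ : ι → ℝ, ξ ⬝ᵥ ξ = 1 ∧ ξ ⬝ᵥ A *ᵥ ξ = hA.eigenvalues i := by
  refine ⟨⇑(hA.eigenvectorBasis i), ?_, ?_⟩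
  · have h := hA.eigenvectorBasis.orthonormal.1 i
    have h_norm := EuclideanSpace.real_norm_sq_eq (hA.eigenvectorBasis i)
    rw [h] at h_norm
    simp only [dotProduct, ← sq]
    rw [← h_norm]; norm_num
  · have h := hA.eigenvalues_eq i
    simpa using h.symm

lemma trace_mul_self_eq_sum_eigenvalues {A : Matrix ι ι ℝ} (hA : A.IsHermitian) :
    (A * A).trace = ∑ i, hA.eigenvalues i ^ 2 := by
  set U : Matrix ι ι ℝ := (hA.eigenvectorUnitary : Matrix ι ι ℝ)
  have hUU : star U * U = 1 := Unitary.coe_star_mul_self _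
  have hspec : A = U * diagonal hA.eigenvalues * star U := by
    conv_lhs => rw [hA.spectral_theorem]
    rfl
  have h : A * A = U * (diagonal hA.eigenvalues * diagonal hA.eigenvalues) * star U := by
    conv_lhs => rw [hspec]
    calc _ = U * diagonal hA.eigenvalues * (star U * U) * diagonal hA.eigenvalues * star U := by
          simp only [mul_assoc]
      _ = _ := by rw [hUU, mul_one]; simp only [mul_assoc]
  rw [h, trace_mul_comm, ← mul_assoc, hUU, one_mul, diagonal_mul_diagonal, trace_diagonal]
  exact Finset.sum_congr rfl fun i _ => by ring

lemma trace_eq_sum_eigenvalues_of_real {A : Matrix ι ι ℝ} (hA : A.IsHermitian) :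
    A.trace = ∑ i, hA.eigenvalues i := by simpa using hA.trace_eq_sum_eigenvalues

lemma log_det_le_trace_sub_card {A : Matrix ι ι ℝ} (hA : A.PosDef) :
    Real.log A.det ≤ A.trace - Fintype.card ι := by
  rw [trace_eq_sum_eigenvalues_of_real hA.1, hA.1.det_eq_prod_eigenvalues]
  simp only [RCLike.ofReal_real_eq_id, id]
  rw [Real.log_prod fun i _ => (hA.eigenvalues_pos i).ne']
  calc _ ≤ ∑ i, (hA.1.eigenvalues i - 1) :=
        Finset.sum_le_sum fun i _ => Real.log_le_sub_one_of_pos (hA.eigenvalues_pos i)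
    _ = _ := by simp [Finset.sum_sub_distrib]

lemma neg_sq_le_add_log_one_sub {x : ℝ} (hx : |x| ≤ 1 / 2) : -x ^ 2 ≤ x + Real.log (1 - x) := by
  have hx_le : x ≤ 1 / 2 := (abs_le.1 hx).2
  have hpos : 0 < 1 - x := by linarith
  rcases le_total x 0 with h | h
  · have hlog := Real.le_log_one_add_of_nonneg (neg_nonneg.2 h)
    have : -x - x ^ 2 ≤ 2 * -x / (-x + 2) := by
      rw [le_div_iff₀ (by linarith)]
      nlinarith [mul_nonneg (sq_nonneg x) (sub_nonneg.2 h)]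
    rw [show 1 - x = 1 + -x by ring]
    linarith
  · have hexp : (1 - x)⁻¹ ≤ Real.exp (x + x ^ 2) := by
      refine le_trans ?_ (Real.quadratic_le_exp_of_nonneg (by positivity))
      rw [inv_le_iff_one_le_mul₀ hpos]
      nlinarith [mul_nonneg (pow_nonneg h 2) (sub_nonneg.2 hx_le), pow_nonneg h 4,
        mul_nonneg (pow_nonneg h 3) (sub_nonneg.2 hx_le)]
    have hlog := (Real.log_le_iff_le_exp (inv_pos.2 hpos)).2 hexp
    rw [Real.log_inv] at hlog
    linarith

lemma neg_trace_sq_le_trace_add_log_det {U : Matrix ι ι ℝ} (hU : U.IsHermitian)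
    (h : ∀ ξ : ι → ℝ, |ξ ⬝ᵥ U *ᵥ ξ| ≤ 1 / 2 * (ξ ⬝ᵥ ξ)) :
    -(U * U).trace ≤ U.trace + Real.log (1 - U).det := by
  have hev : ∀ i, |hU.eigenvalues i| ≤ 1 / 2 := fun i => by
    obtain ⟨ξ, h_unit, h_form⟩ := exists_dotProduct_mulVec_eq_eigenvalues hU i
    simpa [h_unit, h_form] using h ξ
  have hdet : (1 - U).det = ∏ i, (1 - hU.eigenvalues i) := by
    have h_eval := congrArg (Polynomial.eval 1) hU.charpoly_eq
    rw [Matrix.eval_charpoly, Polynomial.eval_prod] at h_eval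
    simpa using h_eval
  rw [hdet, trace_mul_self_eq_sum_eigenvalues hU, trace_eq_sum_eigenvalues_of_real hU,
    Real.log_prod fun i _ => by have := abs_le.1 (hev i); linarith, ← Finset.sum_add_distrib,
    ← Finset.sum_neg_distrib]
  exact Finset.sum_le_sum fun i _ => neg_sq_le_add_log_one_sub (hev i)

open scoped MatrixOrder Matrix.Norms.L2Operator in
lemma exists_eq_transpose_mul_self {ι : Type*} [Fintype ι] {A : Matrix ι ι ℝ}
    (hA : A.PosSemidef) : ∃ Q : Matrix ι ι ℝ, A = Qᵀ * Q := by
  classical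
  obtain ⟨Q, hQ⟩ := CStarAlgebra.nonneg_iff_eq_star_mul_self.mp hA.nonneg
  exact ⟨Q, by rw [hQ, star_eq_conjTranspose, conjTranspose_eq_transpose_of_trivial]⟩

lemma isUnit_of_posDef_transpose_mul_self {Q : Matrix ι ι ℝ} (hQ : (Qᵀ * Q).PosDef) :
    IsUnit Q := by
  rw [isUnit_iff_isUnit_det, isUnit_iff_ne_zero]
  intro h
  have := hQ.det_pos
  rw [det_mul, h, mul_zero] at this
  exact this.false

lemma posDef_conj_iff {Q A : Matrix ι ι ℝ} (hQ : IsUnit Q) :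
    (Q * A * Qᵀ).PosDef ↔ A.PosDef := by
  simpa only [star_eq_conjTranspose, conjTranspose_eq_transpose_of_trivial] using
    hQ.posDef_star_right_conjugate_iff (x := A)

lemma log_det_add_log_det_le {A B : Matrix ι ι ℝ} (hA : A.PosDef) (hB : B.PosDef) :
    Real.log A.det + Real.log B.det ≤ (A * B).trace - Fintype.card ι := by
  obtain ⟨Q, rfl⟩ := exists_eq_transpose_mul_self hA.posSemidef
  have hconj := (posDef_conj_iff (isUnit_of_posDef_transpose_mul_self hA)).2 hB
  rw [← Real.log_mul hA.det_pos.ne' hB.det_pos.ne']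
  calc Real.log ((Qᵀ * Q).det * B.det) = Real.log (Q * B * Qᵀ).det := by
        simp only [det_mul]
        ring_nf
    _ ≤ (Q * B * Qᵀ).trace - Fintype.card ι := log_det_le_trace_sub_card hconj
    _ = (Qᵀ * Q * B).trace - Fintype.card ι := by rw [trace_mul_comm, mul_assoc]

lemma posDef_one_sub {U : Matrix ι ι ℝ} (hU : U.IsHermitian)
    (h : ∀ ξ : ι → ℝ, |ξ ⬝ᵥ U *ᵥ ξ| ≤ 1 / 2 * (ξ ⬝ᵥ ξ)) : (1 - U).PosDef := by
  refine PosDef.of_dotProduct_mulVec_pos (isHermitian_one.sub hU) fun ξ hξ => ?_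
  have hpos : 0 < ξ ⬝ᵥ ξ := by simpa using dotProduct_star_self_pos_iff.2 hξ
  simp only [star_trivial, sub_mulVec, one_mulVec, dotProduct_sub]
  linarith [(abs_le.1 (h ξ)).2]

lemma conj_inv_sub {Q : Matrix ι ι ℝ} (hQ : IsUnit Q) (V : Matrix ι ι ℝ) :
    Q * ((Qᵀ * Q)⁻¹ - V) * Qᵀ = 1 - Q * V * Qᵀ := by
  have hdet := (isUnit_iff_isUnit_det Q).1 hQ
  rw [mul_sub, sub_mul, Matrix.mul_inv_rev, ← mul_assoc Q, mul_nonsing_inv _ hdet, one_mul,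
    nonsing_inv_mul _ (by rwa [det_transpose])]

lemma posDef_inv_sub {M V : Matrix ι ι ℝ} {z : ℝ} (hz : 0 < z) (hM : M.PosDef)
    (hMz : ∀ ξ : ι → ℝ, ξ ⬝ᵥ M *ᵥ ξ ≤ z * (ξ ⬝ᵥ ξ)) (hV : Vᵀ = V)
    (hVz : ∀ ξ : ι → ℝ, |ξ ⬝ᵥ V *ᵥ ξ| ≤ 1 / (2 * z) * (ξ ⬝ᵥ ξ)) :
    (M⁻¹ - V).PosDef ∧
      -(V * M).trace - z ^ 2 * (V * V).trace ≤
        Real.log (M⁻¹ - V).det + Real.log M.det := by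
  obtain ⟨Q, rfl⟩ := exists_eq_transpose_mul_self hM.posSemidef
  have hQ := isUnit_of_posDef_transpose_mul_self hM
  have hU : (Q * V * Qᵀ).IsHermitian := by
    rw [IsHermitian, conjTranspose_eq_transpose_of_trivial]
    simp only [transpose_mul, transpose_transpose, hV, mul_assoc]
  have hUle := abs_dotProduct_conj_mulVec_le hz hMz hVz
  have hpos : ((Qᵀ * Q)⁻¹ - V).PosDef := by
    rw [← posDef_conj_iff hQ, conj_inv_sub hQ]
    exact posDef_one_sub hU hUle
  refine ⟨hpos, ?_⟩
  have hdet : ((Qᵀ * Q)⁻¹ - V).det * (Qᵀ * Q).det = (1 - Q * V * Qᵀ).det := by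
    rw [← conj_inv_sub hQ]
    simp only [det_mul]
    ring
  have htrace : (Q * V * Qᵀ).trace = (V * (Qᵀ * Q)).trace := by
    rw [mul_assoc, trace_mul_comm, mul_assoc]
  rw [← Real.log_mul hpos.det_pos.ne' hM.det_pos.ne', hdet, ← htrace]
  linarith [neg_trace_sq_le_trace_add_log_det hU hUle, trace_conj_mul_conj_le hz.le hV hMz]

/-- The Bregman divergence of `-log det` from the base point `M` to `N`: the loss in which the
estimation error is controlled before it is turned into a Frobenius bound. -/
noncomputable def logDetDivergence (M N : Matrix ι ι ℝ) : ℝ :=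
  (M⁻¹ * (N - M)).trace - Real.log N.det + Real.log M.det

/- Up to the quadratic term this is the Fenchel inequality for `-log det`, whose conjugate at
`V - M⁻¹` is expanded around `V = 0`. -/
lemma trace_mul_sub_le_logDetDivergence {M N V : Matrix ι ι ℝ} {z : ℝ} (hz : 0 < z)
    (hM : M.PosDef) (hN : N.PosDef) (hMz : ∀ ξ : ι → ℝ, ξ ⬝ᵥ M *ᵥ ξ ≤ z * (ξ ⬝ᵥ ξ))
    (hV : Vᵀ = V) (hVz : ∀ ξ : ι → ℝ, |ξ ⬝ᵥ V *ᵥ ξ| ≤ 1 / (2 * z) * (ξ ⬝ᵥ ξ)) :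
    (V * (N - M)).trace ≤ logDetDivergence M N + z ^ 2 * (V * V).trace := by
  obtain ⟨hpos, hlog⟩ := posDef_inv_sub hz hM hMz hV hVz
  have hdual := log_det_add_log_det_le hpos hN
  have hMM : (M⁻¹ * M).trace = Fintype.card ι := by
    rw [nonsing_inv_mul _ (isUnit_iff_ne_zero.2 hM.det_pos.ne'), trace_one]
  rw [sub_mul, trace_sub] at hdual
  rw [logDetDivergence, mul_sub, mul_sub, trace_sub, trace_sub, hMM]
  linarith

end Spectral

section AvgMatrix

open Polynomial (X C X_ne_zero X_sub_C_ne_zero roots_mul roots_X_sub_C roots_X C_1)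
open scoped Polynomial

variable {ι : Type*} [Fintype ι] [DecidableEq ι]

lemma avgMatrix_mul_self {ι : Type*} [Fintype ι] [Nonempty ι] :
    avgMatrix ι * avgMatrix ι = avgMatrix ι := by
  ext x y
  simp [avgMatrix, mul_apply]

lemma avgMatrix_eq_smul_vecMulVec (ι : Type*) [Fintype ι] :
    avgMatrix ι = (Fintype.card ι : ℝ)⁻¹ • vecMulVec 1 1 := by
  ext x y
  simp [avgMatrix, vecMulVec]

lemma avgMatrix_posSemidef (ι : Type*) [Fintype ι] : (avgMatrix ι).PosSemidef := by
  rw [avgMatrix_eq_smul_vecMulVec]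
  have h : (vecMulVec (1 : ι → ℝ) 1).PosSemidef := by
    simpa using posSemidef_vecMulVec_self_star (1 : ι → ℝ)
  exact h.smul (by positivity)

lemma X_mul_charpoly_avgMatrix [Nonempty ι] :
    X * (avgMatrix ι).charpoly = X ^ Fintype.card ι * (X - C 1) := by
  rw [avgMatrix_eq_smul_vecMulVec, ← smul_vecMulVec, charpoly_vecMulVec]
  have hdot : ((Fintype.card ι : ℝ)⁻¹ • (1 : ι → ℝ)) ⬝ᵥ 1 = 1 := by simp
  obtain ⟨m, hm⟩ := Nat.exists_eq_succ_of_ne_zero (Fintype.card_ne_zero (α := ι))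
  rw [hdot, one_smul, hm, Nat.succ_eq_add_one, Nat.add_sub_cancel, C_1]
  ring

lemma charmatrix_mul_charmatrix {A B : Matrix ι ι ℝ} (h : A * B = 0) :
    charmatrix A * charmatrix B = (X : ℝ[X]) • charmatrix (A + B) := by
  have hC : (C.mapMatrix A : Matrix ι ι ℝ[X]) * C.mapMatrix B = 0 := by
    rw [← map_mul, h, map_zero]
  have hscalar : scalar ι (X : ℝ[X]) = (X : ℝ[X]) • 1 := by
    rw [scalar_apply, smul_one_eq_diagonal]
  simp only [charmatrix, map_add, hscalar, sub_mul, mul_sub, hC, smul_mul_assoc, mul_smul_comm,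
    one_mul, mul_one, smul_sub, smul_add]
  abel

lemma charpoly_add_avgMatrix [Nonempty ι] {A : Matrix ι ι ℝ} (hA : A * avgMatrix ι = 0) :
    A.charpoly * (X - C 1) = X * (A + avgMatrix ι).charpoly := by
  have h := congrArg det (charmatrix_mul_charmatrix hA)
  rw [det_mul, det_smul] at h
  refine mul_left_cancel₀ (pow_ne_zero (Fintype.card ι) (X_ne_zero (R := ℝ))) ?_
  calc X ^ Fintype.card ι * (A.charpoly * (X - C 1))
      = X * (A.charpoly * (avgMatrix ι).charpoly) := by
        linear_combination -A.charpoly * X_mul_charpoly_avgMatrix (ι := ι)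
    _ = X ^ Fintype.card ι * (X * (A + avgMatrix ι).charpoly) := by
        rw [charpoly, charpoly, h, charpoly]
        ring

lemma roots_charpoly_add_avgMatrix [Nonempty ι] {A : Matrix ι ι ℝ} (hA : A * avgMatrix ι = 0) :
    1 ::ₘ A.charpoly.roots = 0 ::ₘ (A + avgMatrix ι).charpoly.roots := by
  have h := congrArg Polynomial.roots (charpoly_add_avgMatrix hA)
  rw [roots_mul (mul_ne_zero (charpoly_monic A).ne_zero (X_sub_C_ne_zero 1)),
    roots_mul (mul_ne_zero X_ne_zero (charpoly_monic _).ne_zero),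
    roots_X_sub_C, roots_X, add_comm] at h
  simpa using h

lemma pseudoDet_eq_det_add_avgMatrix [Nonempty ι] {A : Matrix ι ι ℝ} (hA : A * avgMatrix ι = 0)
    (hpd : (A + avgMatrix ι).PosDef) : pseudoDet A = (A + avgMatrix ι).det := by
  have h := congrArg (Multiset.filter (fun x : ℝ => x ≠ 0)) (roots_charpoly_add_avgMatrix hA)
  have h_filter : Multiset.filter (fun x : ℝ => x ≠ 0) (A + avgMatrix ι).charpoly.roots =
      (A + avgMatrix ι).charpoly.roots := by
    rw [Multiset.filter_eq_self, hpd.1.roots_charpoly_eq_eigenvalues]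
    intro x hx
    obtain ⟨i, -, rfl⟩ := Multiset.mem_map.1 hx
    simpa using (hpd.eigenvalues_pos i).ne'
  rw [Multiset.filter_cons_of_pos (p := fun x : ℝ => x ≠ 0) _ one_ne_zero,
    Multiset.filter_cons_of_neg (p := fun x : ℝ => x ≠ 0) _ (by simp), h_filter] at h
  have h_prod := congrArg Multiset.prod h
  rw [Multiset.prod_cons, one_mul] at h_prod
  rw [pseudoDet, h_prod, hpd.1.det_eq_prod_eigenvalues, hpd.1.roots_charpoly_eq_eigenvalues]
  rfl

end AvgMatrix

section MoorePenrose

variable {ι : Type*} [Fintype ι]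

lemma IsMoorePenroseInverse.unique {A B C : Matrix ι ι ℝ} (hB : IsMoorePenroseInverse A B)
    (hC : IsMoorePenroseInverse A C) : B = C := by
  have hleft : A * B = A * C := by
    calc A * B = (A * C * A) * B := by rw [hC.mul_mul_left]
      _ = (A * C) * (A * B) := by simp only [mul_assoc]
      _ = ((A * B) * (A * C))ᵀ := by rw [transpose_mul, hC.symm_left, hB.symm_left]
      _ = ((A * B * A) * C)ᵀ := by simp only [mul_assoc]
      _ = A * C := by rw [hB.mul_mul_left, hC.symm_left]
  have hright : B * A = C * A := by
    calc B * A = B * (A * C * A) := by rw [hC.mul_mul_left]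
      _ = (B * A) * (C * A) := by simp only [mul_assoc]
      _ = ((C * A) * (B * A))ᵀ := by rw [transpose_mul, hC.symm_right, hB.symm_right]
      _ = (C * (A * B * A))ᵀ := by simp only [mul_assoc]
      _ = C * A := by rw [hB.mul_mul_left, hC.symm_right]
  calc B = B * A * B := hB.mul_mul_right.symm
    _ = C * (A * B) := by rw [hright, mul_assoc]
    _ = C := by rw [hleft, ← mul_assoc, hC.mul_mul_right]

variable [DecidableEq ι]

lemma isMoorePenroseInverse_inv_sub_avgMatrix [Nonempty ι] {A : Matrix ι ι ℝ} (hsymm : Aᵀ = A)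
    (hA : A * avgMatrix ι = 0) (hpd : (A + avgMatrix ι).PosDef) :
    IsMoorePenroseInverse A ((A + avgMatrix ι)⁻¹ - avgMatrix ι) := by
  set J := avgMatrix ι with hJ
  set M := A + J with hM
  have hJJ : J * J = J := avgMatrix_mul_self
  have hJA : J * A = 0 := by
    have := congrArg transpose hA
    rwa [transpose_mul, hJ, avgMatrix_transpose, hsymm, transpose_zero] at this
  have hu : IsUnit M.det := isUnit_iff_ne_zero.2 hpd.det_pos.ne'
  have hMJ : M * J = J := by rw [hM, add_mul, hA, hJJ, zero_add]
  have hJM : J * M = J := by rw [hM, mul_add, hJA, hJJ, zero_add]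
  have hiJ : M⁻¹ * J = J := by
    conv_lhs => rw [← hMJ]
    rw [← mul_assoc, nonsing_inv_mul _ hu, one_mul]
  have hJi : J * M⁻¹ = J := by
    conv_lhs => rw [← hJM]
    rw [mul_assoc, mul_nonsing_inv _ hu, mul_one]
  have hAM : A = M - J := by rw [hM]; abel
  have hleft : A * (M⁻¹ - J) = 1 - J := by
    rw [hAM, sub_mul, mul_sub, mul_sub, mul_nonsing_inv _ hu, hMJ, hJi, hJJ]; abel
  have hright : (M⁻¹ - J) * A = 1 - J := by
    rw [hAM, sub_mul, mul_sub, mul_sub, nonsing_inv_mul _ hu, hJM, hiJ, hJJ]; abel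
  have hT : (1 - J)ᵀ = 1 - J := by rw [transpose_sub, transpose_one, hJ, avgMatrix_transpose]
  refine ⟨?_, ?_, ?_, ?_⟩
  · rw [hleft, sub_mul, one_mul, hJA, sub_zero]
  · rw [hright, sub_mul, one_mul, mul_sub, hJi, hJJ]; abel
  · rw [hleft, hT]
  · rw [hright, hT]

lemma dotProduct_inv_mulVec_le {M : Matrix ι ι ℝ} {z : ℝ} (hz : 0 < z) (hM : IsUnit M.det)
    (h : ∀ ξ : ι → ℝ, 1 / z * (ξ ⬝ᵥ ξ) ≤ ξ ⬝ᵥ M *ᵥ ξ) (ξ : ι → ℝ) :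
    ξ ⬝ᵥ M⁻¹ *ᵥ ξ ≤ z * (ξ ⬝ᵥ ξ) := by
  set η := M⁻¹ *ᵥ ξ with hη
  have hMη : M *ᵥ η = ξ := by rw [hη, mulVec_mulVec, mul_nonsing_inv _ hM, one_mulVec]
  have hηη : η ⬝ᵥ η ≤ z * (ξ ⬝ᵥ η) := by
    have := h η
    rwa [hMη, dotProduct_comm η ξ, one_div, inv_mul_le_iff₀ hz] at this
  have hξ := dotProduct_self_nonneg ξ
  have hsq : (ξ ⬝ᵥ η) * (ξ ⬝ᵥ η) ≤ (z * (ξ ⬝ᵥ ξ)) * (ξ ⬝ᵥ η) := by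
    linarith [dotProduct_sq_le ξ η, mul_le_mul_of_nonneg_left hηη hξ]
  rcases le_or_gt (ξ ⬝ᵥ η) 0 with hξη | hξη
  · exact hξη.trans (by positivity)
  · exact le_of_mul_le_mul_right hsq hξη

end MoorePenrose

section TrueGraphs

variable {s₁ s₂ d z : ℝ} {p₁ p₂ : ℕ} {w₁ : Edge p₁ → ℝ} {w₂ : Edge p₂ → ℝ}

lemma TrueGraphs.nonempty (h : TrueGraphs s₁ s₂ d z w₁ w₂) : Nonempty (Fin p₁ × Fin p₂) := by
  by_contra he
  rw [not_nonempty_iff] at he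
  obtain ⟨l, hl, -⟩ := h.spectrum
  rw [charpoly, det_isEmpty, Polynomial.roots_one] at hl
  exact Multiset.cons_ne_zero hl.symm

lemma one_lt_of_degree_pos {p : ℕ} {w : Edge p → ℝ} (hp : 0 < p)
    (h : ∀ i, 0 < degree w i) : 1 < p := by
  by_contra hlt
  obtain rfl : p = 1 := by omega
  have hpos := h 0
  have : degree w 0 = 0 := by
    rw [degree, Fin.sum_univ_one, adj_self]
  linarith

lemma TrueGraphs.one_lt (h : TrueGraphs s₁ s₂ d z w₁ w₂) (hd : 0 < d) : 1 < p₁ ∧ 1 < p₂ := by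
  obtain ⟨⟨i, j⟩⟩ := h.nonempty
  have hd' : 0 < 1 / d := by positivity
  exact ⟨one_lt_of_degree_pos i.pos fun i => hd'.trans_le (h.degree₁ i).1,
    one_lt_of_degree_pos j.pos fun i => hd'.trans_le (h.degree₂ i).1⟩

lemma isHermitian_kronLaplacian_add_avgMatrix (w₁ : Edge p₁ → ℝ) (w₂ : Edge p₂ → ℝ) :
    (kronLaplacian w₁ w₂ + avgMatrix (Fin p₁ × Fin p₂)).IsHermitian := by
  rw [IsHermitian, conjTranspose_eq_transpose_of_trivial, transpose_add, kronLaplacian_transpose,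
    avgMatrix_transpose]

lemma TrueGraphs.eigenvalues_mem_Icc (h : TrueGraphs s₁ s₂ d z w₁ w₂) (hz : 1 < z)
    (x : Fin p₁ × Fin p₂) :
    (isHermitian_kronLaplacian_add_avgMatrix w₁ w₂).eigenvalues x ∈ Set.Icc (1 / z) z := by
  set hH := isHermitian_kronLaplacian_add_avgMatrix w₁ w₂
  have := h.nonempty
  obtain ⟨l, hl, hlz⟩ := h.spectrum
  have hroots := roots_charpoly_add_avgMatrix (kronLaplacian_mul_avgMatrix w₁ w₂)
  rw [hl, Multiset.cons_swap, Multiset.cons_inj_right, hH.roots_charpoly_eq_eigenvalues] at hroots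
  have hx : hH.eigenvalues x ∈ 1 ::ₘ l := by
    rw [hroots]
    exact Multiset.mem_map.2 ⟨x, Finset.mem_univ_val x, by simp⟩
  rcases Multiset.mem_cons.1 hx with hx | hx
  · rw [hx]
    exact ⟨by rw [div_le_one (by linarith)]; exact hz.le, hz.le⟩
  · exact hlz _ hx

lemma TrueGraphs.le_dotProduct_mulVec (h : TrueGraphs s₁ s₂ d z w₁ w₂) (hz : 1 < z)
    (ξ : Fin p₁ × Fin p₂ → ℝ) :
    1 / z * (ξ ⬝ᵥ ξ) ≤ ξ ⬝ᵥ (kronLaplacian w₁ w₂ + avgMatrix (Fin p₁ × Fin p₂)) *ᵥ ξ :=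
  le_dotProduct_mulVec_of_le_eigenvalues _ (fun x => (h.eigenvalues_mem_Icc hz x).1) ξ

lemma TrueGraphs.dotProduct_mulVec_le (h : TrueGraphs s₁ s₂ d z w₁ w₂) (hz : 1 < z)
    (ξ : Fin p₁ × Fin p₂ → ℝ) :
    ξ ⬝ᵥ (kronLaplacian w₁ w₂ + avgMatrix (Fin p₁ × Fin p₂)) *ᵥ ξ ≤ z * (ξ ⬝ᵥ ξ) :=
  dotProduct_mulVec_le_of_eigenvalues_le _ (fun x => (h.eigenvalues_mem_Icc hz x).2) ξ

lemma TrueGraphs.posDef (h : TrueGraphs s₁ s₂ d z w₁ w₂) (hz : 1 < z) :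
    (kronLaplacian w₁ w₂ + avgMatrix (Fin p₁ × Fin p₂)).PosDef := by
  have hH := isHermitian_kronLaplacian_add_avgMatrix w₁ w₂
  rw [hH.posDef_iff_eigenvalues_pos]
  exact fun x => lt_of_lt_of_le (by positivity) (h.eigenvalues_mem_Icc hz x).1

lemma TrueGraphs.feasible (h : TrueGraphs s₁ s₂ d z w₁ w₂) (hz : 1 < z) : Feasible w₁ w₂ :=
  ⟨h.nonneg₁, h.nonneg₂, h.posDef hz⟩

lemma TrueGraphs.moorePenrose_eq (h : TrueGraphs s₁ s₂ d z w₁ w₂) (hz : 1 < z)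
    {C : Matrix (Fin p₁ × Fin p₂) (Fin p₁ × Fin p₂) ℝ}
    (hC : IsMoorePenroseInverse (kronLaplacian w₁ w₂) C) :
    C = (kronLaplacian w₁ w₂ + avgMatrix _)⁻¹ - avgMatrix _ := by
  have := h.nonempty
  exact hC.unique (isMoorePenroseInverse_inv_sub_avgMatrix (kronLaplacian_transpose _ _)
    (kronLaplacian_mul_avgMatrix _ _) (h.posDef hz))

lemma TrueGraphs.dotProduct_moorePenrose_mulVec_le (h : TrueGraphs s₁ s₂ d z w₁ w₂) (hz : 1 < z)
    {C : Matrix (Fin p₁ × Fin p₂) (Fin p₁ × Fin p₂) ℝ}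
    (hC : IsMoorePenroseInverse (kronLaplacian w₁ w₂) C) (ξ : Fin p₁ × Fin p₂ → ℝ) :
    ξ ⬝ᵥ C *ᵥ ξ ≤ z * (ξ ⬝ᵥ ξ) := by
  rw [h.moorePenrose_eq hz hC, sub_mulVec, dotProduct_sub]
  have hinv := dotProduct_inv_mulVec_le (by linarith)
    (isUnit_iff_ne_zero.2 (h.posDef hz).det_pos.ne') (h.le_dotProduct_mulVec hz) ξ
  have havg : 0 ≤ ξ ⬝ᵥ avgMatrix _ *ᵥ ξ := by
    simpa using (avgMatrix_posSemidef _).dotProduct_mulVec_nonneg ξ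
  linarith

lemma TrueGraphs.moorePenrose_posSemidef (h : TrueGraphs s₁ s₂ d z w₁ w₂) (hz : 1 < z)
    {C : Matrix (Fin p₁ × Fin p₂) (Fin p₁ × Fin p₂) ℝ}
    (hC : IsMoorePenroseInverse (kronLaplacian w₁ w₂) C) : C.PosSemidef := by
  have hT : Cᵀ = C := by
    rw [h.moorePenrose_eq hz hC, transpose_sub, transpose_nonsing_inv, transpose_add,
      kronLaplacian_transpose, avgMatrix_transpose]
  have h_conj := (kronLaplacian_posSemidef h.nonneg₁ h.nonneg₂).mul_mul_conjTranspose_same C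
  rwa [conjTranspose_eq_transpose_of_trivial, hT, hC.mul_mul_right] at h_conj

end TrueGraphs

section Existence

lemma continuous_adj_apply {p : ℕ} (i j : Fin p) : Continuous fun w : Edge p → ℝ => adj w i j := by
  simp only [adj, of_apply]
  split_ifs
  exacts [continuous_apply _, continuous_apply _, continuous_const]

lemma continuous_degree_apply {p : ℕ} (i : Fin p) : Continuous fun w : Edge p → ℝ => degree w i :=
  continuous_finsetSum _ fun j _ => continuous_adj_apply i j

variable {p₁ p₂ : ℕ}

lemma continuous_kronLaplacian :
    Continuous fun w : (Edge p₁ → ℝ) × (Edge p₂ → ℝ) => kronLaplacian w.1 w.2 := by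
  refine continuous_matrix fun x y => ?_
  have hadj := ((continuous_adj_apply x.1 y.1).comp continuous_fst).mul
    ((continuous_adj_apply x.2 y.2).comp continuous_snd)
  have hdeg := ((continuous_degree_apply x.1).comp continuous_fst).mul
    ((continuous_degree_apply x.2).comp continuous_snd)
  simp only [kronLaplacian_apply]
  split_ifs
  exacts [hdeg.sub hadj, continuous_const.sub hadj]

lemma continuous_det_kronLaplacian_add_avgMatrix :
    Continuous fun w : (Edge p₁ → ℝ) × (Edge p₂ → ℝ) =>
      (kronLaplacian w.1 w.2 + avgMatrix (Fin p₁ × Fin p₂)).det :=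
  (continuous_kronLaplacian.add continuous_const).matrix_det

lemma trace_avgMatrix {ι : Type*} [Fintype ι] [Nonempty ι] : (avgMatrix ι).trace = 1 := by
  simp [trace, diag, avgMatrix]

lemma trace_mul_nonneg {ι : Type*} [Fintype ι] {A B : Matrix ι ι ℝ}
    (hA : A.PosSemidef) (hB : B.PosSemidef) : 0 ≤ (A * B).trace := by
  obtain ⟨Q, rfl⟩ := exists_eq_transpose_mul_self hB
  have h := (hA.mul_mul_conjTranspose_same Q).trace_nonneg
  rwa [conjTranspose_eq_transpose_of_trivial, mul_assoc, trace_mul_comm, mul_assoc] at h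

lemma log_det_le_card_mul_log_trace {ι : Type*} [Fintype ι] [DecidableEq ι]
    {A : Matrix ι ι ℝ} (hA : A.PosDef) (h : 1 ≤ A.trace) :
    Real.log A.det ≤ Fintype.card ι * Real.log A.trace := by
  have hpos : 0 < A.trace := by linarith
  have hlog := log_det_le_trace_sub_card (hA.smul (inv_pos.2 hpos))
  rw [det_smul, trace_smul, smul_eq_mul, inv_mul_cancel₀ hpos.ne',
    Real.log_mul (by positivity) hA.det_pos.ne', Real.log_pow, Real.log_inv] at hlog
  have hcard : (1 : ℝ) ≤ Fintype.card ι := by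
    have : Nonempty ι := by
      by_contra hι
      rw [not_nonempty_iff] at hι
      simp [trace] at hpos
    exact_mod_cast Fintype.card_pos
  linarith

lemma log_det_kronLaplacian_add_avgMatrix_le [Nonempty (Fin p₁ × Fin p₂)] {w₁ : Edge p₁ → ℝ}
    {w₂ : Edge p₂ → ℝ} (hw : Feasible w₁ w₂) :
    Real.log (kronLaplacian w₁ w₂ + avgMatrix (Fin p₁ × Fin p₂)).det ≤
      Fintype.card (Fin p₁ × Fin p₂) * Real.log (4 * ((∑ e, w₁ e) * ∑ e, w₂ e) + 1) := by
  have htrace : (kronLaplacian w₁ w₂ + avgMatrix (Fin p₁ × Fin p₂)).trace =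
      4 * ((∑ e, w₁ e) * ∑ e, w₂ e) + 1 := by
    rw [trace_add, trace_kronLaplacian, trace_avgMatrix]
  have hnonneg : 0 ≤ (∑ e, w₁ e) * ∑ e, w₂ e :=
    mul_nonneg (Finset.sum_nonneg fun e _ => hw.1 e) (Finset.sum_nonneg fun e _ => hw.2.1 e)
  rw [← htrace]
  exact log_det_le_card_mul_log_trace hw.2.2 (by linarith)

lemma four_mul_mul_add_one_le_sq {α β a b : ℝ} (hα : 0 < α) (hβ : 0 < β) (ha : 0 ≤ a)
    (hb : 0 ≤ b) : 4 * (a * b) + 1 ≤ (1 + (α * a + β * b) / √(α * β)) ^ 2 := by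
  have hle : 4 * (a * b) ≤ ((α * a + β * b) / √(α * β)) ^ 2 := by
    rw [div_pow, Real.sq_sqrt (by positivity), le_div_iff₀ (by positivity)]
    nlinarith [sq_nonneg (α * a - β * b)]
  have hnonneg : 0 ≤ (α * a + β * b) / √(α * β) := by positivity
  linarith [add_sq 1 ((α * a + β * b) / √(α * β))]

lemma log_le_mul_sub_log {ε x : ℝ} (hε : 0 < ε) (hx : 0 < x) :
    Real.log x ≤ ε * x - 1 - Real.log ε := by
  have h := Real.log_le_sub_one_of_pos (mul_pos hε hx)
  rw [Real.log_mul hε.ne' hx.ne'] at h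
  linarith

lemma exists_penalty_le {α β : ℝ} (hα : 0 < α) (hβ : 0 < β) (q : ℕ) (F : ℝ) :
    ∃ R, ∀ a b : ℝ, 0 ≤ a → 0 ≤ b →
      α * a + β * b - q * Real.log (4 * (a * b) + 1) ≤ F → α * a + β * b ≤ R := by
  set t := √(α * β)
  have ht : 0 < t := Real.sqrt_pos.2 (mul_pos hα hβ)
  obtain rfl | hq := q.eq_zero_or_pos
  · exact ⟨F, fun a b _ _ h => by simpa using h⟩
  have hq : (0 : ℝ) < q := by exact_mod_cast hq
  set ε := t / (4 * q)
  have hε : 0 < ε := by positivity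
  refine ⟨2 * (F + 2 * q * (ε - 1 - Real.log ε)), fun a b ha hb hF => ?_⟩
  set P := α * a + β * b
  have hP : 0 < 1 + P / t := by positivity
  have hlog : Real.log (4 * (a * b) + 1) ≤ 2 * (ε * (1 + P / t) - 1 - Real.log ε) :=
    calc Real.log (4 * (a * b) + 1)
        ≤ Real.log ((1 + P / t) ^ 2) :=
          Real.log_le_log (by positivity) (four_mul_mul_add_one_le_sq hα hβ ha hb)
      _ = 2 * Real.log (1 + P / t) := by rw [Real.log_pow, Nat.cast_ofNat]
      _ ≤ _ := by gcongr; exact log_le_mul_sub_log hε hP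
  have hhalf : q * (2 * (ε * (P / t))) = P / 2 := by simp only [ε]; field_simp; norm_num
  linarith [mul_le_mul_of_nonneg_left hlog hq.le]

lemma penNegLogLik_eq [Nonempty (Fin p₁ × Fin p₂)] (α₁ α₂ : ℝ)
    (S : Matrix (Fin p₁ × Fin p₂) (Fin p₁ × Fin p₂) ℝ) {w₁ : Edge p₁ → ℝ} {w₂ : Edge p₂ → ℝ}
    (hw : Feasible w₁ w₂) :
    penNegLogLik α₁ α₂ S w₁ w₂ = (kronLaplacian w₁ w₂ * S).trace
      - Real.log (kronLaplacian w₁ w₂ + avgMatrix (Fin p₁ × Fin p₂)).det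
      + α₁ * ∑ e, w₁ e + α₂ * ∑ e, w₂ e := by
  rw [penNegLogLik, pseudoDet_eq_det_add_avgMatrix (kronLaplacian_mul_avgMatrix _ _) hw.2.2]

lemma feasible_of_det_pos {w₁ : Edge p₁ → ℝ} {w₂ : Edge p₂ → ℝ} (h₁ : ∀ e, 0 ≤ w₁ e)
    (h₂ : ∀ e, 0 ≤ w₂ e) (hdet : 0 < (kronLaplacian w₁ w₂ + avgMatrix (Fin p₁ × Fin p₂)).det) :
    Feasible w₁ w₂ := by
  refine ⟨h₁, h₂, ?_⟩
  rw [((kronLaplacian_posSemidef h₁ h₂).add (avgMatrix_posSemidef _)).posDef_iff_isUnit,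
    isUnit_iff_isUnit_det, isUnit_iff_ne_zero]
  exact hdet.ne'

/-- The weights with total penalty at most `R` at which the log-determinant barrier is at
least `log δ`; the sublevel sets of the penalized likelihood are contained in sets of this form. -/
def barrierSet (p₁ p₂ : ℕ) (α₁ α₂ R δ : ℝ) : Set ((Edge p₁ → ℝ) × (Edge p₂ → ℝ)) :=
  {w | (0 ≤ w.1 ∧ 0 ≤ w.2) ∧ α₁ * ∑ e, w.1 e + α₂ * ∑ e, w.2 e ≤ R ∧
    δ ≤ (kronLaplacian w.1 w.2 + avgMatrix (Fin p₁ × Fin p₂)).det}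

variable {α₁ α₂ : ℝ}

lemma isCompact_barrierSet (hα₁ : 0 < α₁) (hα₂ : 0 < α₂) (R δ : ℝ) :
    IsCompact (barrierSet p₁ p₂ α₁ α₂ R δ) := by
  have hclosed : IsClosed (barrierSet p₁ p₂ α₁ α₂ R δ) :=
    ((isClosed_le continuous_const continuous_fst).inter
      (isClosed_le continuous_const continuous_snd)).inter
      ((isClosed_le (f := fun w : (Edge p₁ → ℝ) × (Edge p₂ → ℝ) =>
        α₁ * ∑ e, w.1 e + α₂ * ∑ e, w.2 e) (by fun_prop) continuous_const).inter
        (isClosed_le continuous_const continuous_det_kronLaplacian_add_avgMatrix))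
  refine (isCompact_Icc (a := (0, 0)) (b := (fun _ => R / α₁, fun _ => R / α₂))).of_isClosed_subset
    hclosed ?_
  rintro w ⟨⟨h₁, h₂⟩, hR, -⟩
  have hsum₁ : 0 ≤ α₁ * ∑ e, w.1 e := mul_nonneg hα₁.le (Finset.sum_nonneg fun e _ => h₁ e)
  have hsum₂ : 0 ≤ α₂ * ∑ e, w.2 e := mul_nonneg hα₂.le (Finset.sum_nonneg fun e _ => h₂ e)
  refine ⟨⟨h₁, h₂⟩, fun e => ?_, fun e => ?_⟩
  · have he : w.1 e ≤ ∑ e, w.1 e := Finset.single_le_sum (fun e _ => h₁ e) (Finset.mem_univ e)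
    exact (le_div_iff₀' hα₁).2 (by nlinarith)
  · have he : w.2 e ≤ ∑ e, w.2 e := Finset.single_le_sum (fun e _ => h₂ e) (Finset.mem_univ e)
    exact (le_div_iff₀' hα₂).2 (by nlinarith)

lemma exists_mem_barrierSet_of_penNegLogLik_le [Nonempty (Fin p₁ × Fin p₂)] (hα₁ : 0 < α₁)
    (hα₂ : 0 < α₂) {S : Matrix (Fin p₁ × Fin p₂) (Fin p₁ × Fin p₂) ℝ} (hS : S.PosSemidef) (F : ℝ) :
    ∃ R, ∀ w₁ w₂, Feasible w₁ w₂ → penNegLogLik α₁ α₂ S w₁ w₂ ≤ F →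
      (w₁, w₂) ∈ barrierSet p₁ p₂ α₁ α₂ R (Real.exp (-F)) := by
  obtain ⟨R, hR⟩ := exists_penalty_le hα₁ hα₂ (Fintype.card (Fin p₁ × Fin p₂)) F
  refine ⟨R, fun w₁ w₂ hw hF => ?_⟩
  have hsum₁ : 0 ≤ ∑ e, w₁ e := Finset.sum_nonneg fun e _ => hw.1 e
  have hsum₂ : 0 ≤ ∑ e, w₂ e := Finset.sum_nonneg fun e _ => hw.2.1 e
  have htrace := trace_mul_nonneg (kronLaplacian_posSemidef hw.1 hw.2.1) hS
  have hlog := log_det_kronLaplacian_add_avgMatrix_le hw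
  rw [penNegLogLik_eq α₁ α₂ S hw] at hF
  refine ⟨⟨hw.1, hw.2.1⟩, hR _ _ hsum₁ hsum₂ (by linarith), ?_⟩
  rw [← Real.le_log_iff_exp_le hw.2.2.det_pos]
  linarith [mul_nonneg hα₁.le hsum₁, mul_nonneg hα₂.le hsum₂]

lemma continuousOn_penNegLogLik [Nonempty (Fin p₁ × Fin p₂)]
    (S : Matrix (Fin p₁ × Fin p₂) (Fin p₁ × Fin p₂) ℝ) (α₁ α₂ : ℝ) :
    ContinuousOn (fun w : (Edge p₁ → ℝ) × (Edge p₂ → ℝ) => penNegLogLik α₁ α₂ S w.1 w.2)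
      {w | Feasible w.1 w.2} := by
  refine ContinuousOn.congr ?_ fun w hw => penNegLogLik_eq α₁ α₂ S hw
  have htrace : Continuous fun w : (Edge p₁ → ℝ) × (Edge p₂ → ℝ) =>
      (kronLaplacian w.1 w.2 * S).trace :=
    (continuous_kronLaplacian.matrix_mul continuous_const).matrix_trace
  have hlog := continuous_det_kronLaplacian_add_avgMatrix (p₁ := p₁) (p₂ := p₂)
    |>.continuousOn.log fun w (hw : Feasible w.1 w.2) => hw.2.2.det_pos.ne'
  exact ((htrace.continuousOn.sub hlog).add (by fun_prop)).add (by fun_prop)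

lemma exists_isPenalizedMLE [Nonempty (Fin p₁ × Fin p₂)] (hα₁ : 0 < α₁) (hα₂ : 0 < α₂)
    {S : Matrix (Fin p₁ × Fin p₂) (Fin p₁ × Fin p₂) ℝ} (hS : S.PosSemidef)
    {u₁ : Edge p₁ → ℝ} {u₂ : Edge p₂ → ℝ} (hu : Feasible u₁ u₂) :
    ∃ v₁ v₂, IsPenalizedMLE α₁ α₂ S v₁ v₂ := by
  obtain ⟨F, hF⟩ : ∃ F, penNegLogLik α₁ α₂ S u₁ u₂ = F := ⟨_, rfl⟩
  obtain ⟨R, hR⟩ := exists_mem_barrierSet_of_penNegLogLik_le hα₁ hα₂ hS F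
  have hfeasible : ∀ w ∈ barrierSet p₁ p₂ α₁ α₂ R (Real.exp (-F)), Feasible w.1 w.2 :=
    fun w hw => feasible_of_det_pos hw.1.1 hw.1.2 ((Real.exp_pos _).trans_le hw.2.2)
  have hu_mem := hR u₁ u₂ hu hF.le
  obtain ⟨v, hv, hmin⟩ := (isCompact_barrierSet hα₁ hα₂ R _).exists_isMinOn ⟨_, hu_mem⟩
    ((continuousOn_penNegLogLik S α₁ α₂).mono hfeasible)
  refine ⟨v.1, v.2, hfeasible v hv, fun x₁ x₂ hx => ?_⟩
  rcases le_total (penNegLogLik α₁ α₂ S x₁ x₂) F with h | h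
  · exact isMinOn_iff.1 hmin (x₁, x₂) (hR x₁ x₂ hx h)
  · exact (isMinOn_iff.1 hmin (u₁, u₂) hu_mem).trans (hF.trans_le h)

end Existence

section SubexponentialMGF

variable {Ω Ω' : Type*} {mΩ : MeasurableSpace Ω} {mΩ' : MeasurableSpace Ω'} {μ : Measure Ω}
  {X : Ω → ℝ} {v b : ℝ}

/-- `X` is sub-exponential with variance proxy `2 * v` and scale `b⁻¹`: near the origin its moment
generating function is dominated by that of a centred Gaussian. -/
structure HasSubexponentialMGF (X : Ω → ℝ) (v b : ℝ) (μ : Measure Ω) : Prop where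
  integrable_exp_mul : ∀ t, |t| ≤ b → Integrable (fun ω => Real.exp (t * X ω)) μ
  mgf_le : ∀ t, |t| ≤ b → mgf X μ t ≤ Real.exp (v * t ^ 2)

namespace HasSubexponentialMGF

lemma mono {v' : ℝ} (hX : HasSubexponentialMGF X v b μ) (hv : v ≤ v') :
    HasSubexponentialMGF X v' b μ where
  integrable_exp_mul := hX.integrable_exp_mul
  mgf_le t ht := (hX.mgf_le t ht).trans (Real.exp_le_exp.2 (by gcongr))

lemma const_mul {c b' : ℝ} (hX : HasSubexponentialMGF X v b μ) (hc : |c| * b' ≤ b) :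
    HasSubexponentialMGF (fun ω => c * X ω) (c ^ 2 * v) b' μ := by
  have hscale : ∀ t, |t| ≤ b' → |c * t| ≤ b := fun t ht =>
    (abs_mul c t).trans_le ((mul_le_mul_of_nonneg_left ht (abs_nonneg c)).trans hc)
  refine ⟨fun t ht => ?_, fun t ht => ?_⟩
  · simpa only [mul_assoc, mul_left_comm t c] using hX.integrable_exp_mul (c * t) (hscale t ht)
  · rw [mgf_const_mul]
    exact (hX.mgf_le _ (hscale t ht)).trans_eq (by congr 1; ring)

lemma sum {ι : Type*} [Fintype ι] {X : ι → Ω → ℝ} {v : ι → ℝ} (hindep : iIndepFun X μ)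
    (hmeas : ∀ i, AEMeasurable (X i) μ) (hX : ∀ i, HasSubexponentialMGF (X i) (v i) b μ) :
    HasSubexponentialMGF (∑ i, X i) (∑ i, v i) b μ := by
  have : IsProbabilityMeasure μ := hindep.isProbabilityMeasure
  have hmgf : ∀ t, mgf (∑ i, X i) μ t = ∏ i, mgf (X i) μ t := fun t => hindep.mgf_sum₀ hmeas _
  refine ⟨fun t ht => Integrable.of_integral_ne_zero ?_, fun t ht => ?_⟩
  · change mgf (∑ i, X i) μ t ≠ 0
    rw [hmgf]
    exact (Finset.prod_pos fun i _ => mgf_pos ((hX i).integrable_exp_mul t ht)).ne'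
  · rw [hmgf, Finset.sum_mul, Real.exp_sum]
    exact Finset.prod_le_prod (fun i _ => mgf_nonneg) fun i _ => (hX i).mgf_le t ht

lemma comp_iff_of_hasLaw {Y : Ω' → Ω} {P : Measure Ω'} (hmeas : AEMeasurable X μ)
    (hY : HasLaw Y μ P) : HasSubexponentialMGF (X ∘ Y) v b P ↔ HasSubexponentialMGF X v b μ := by
  obtain rfl := hY.map_eq
  have hexp : ∀ t, AEStronglyMeasurable (fun ω => Real.exp (t * X ω)) (P.map Y) := fun t =>
    (hmeas.const_mul t).exp.aestronglyMeasurable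
  have hint : ∀ t, Integrable (fun ω => Real.exp (t * X ω)) (P.map Y) ↔
      Integrable (fun ω => Real.exp (t * (X ∘ Y) ω)) P :=
    fun t => integrable_map_measure (hexp t) hY.aemeasurable
  have hmgf : ∀ t, mgf X (P.map Y) t = mgf (X ∘ Y) P t := fun t => mgf_map hY.aemeasurable (hexp t)
  exact ⟨fun h => ⟨fun t ht => (hint t).2 (h.1 t ht), fun t ht => (hmgf t).trans_le (h.2 t ht)⟩,
    fun h => ⟨fun t ht => (hint t).1 (h.1 t ht), fun t ht => (hmgf t).symm.trans_le (h.2 t ht)⟩⟩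

lemma measureReal_abs_ge_le [IsFiniteMeasure μ] (hX : HasSubexponentialMGF X v b μ) {t : ℝ}
    (ht₀ : 0 ≤ t) (ht : t ≤ b) (r : ℝ) :
    μ.real {ω | r ≤ |X ω|} ≤ 2 * Real.exp (-(t * r) + v * t ^ 2) := by
  have hsub : {ω | r ≤ |X ω|} ⊆ {ω | r ≤ X ω} ∪ {ω | X ω ≤ -r} := fun ω hω =>
    (le_abs.1 (Set.mem_ofPred_eq ▸ hω)).imp id fun h => le_neg_of_le_neg h
  have habs : |t| ≤ b := (abs_of_nonneg ht₀).trans_le ht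
  have habs_neg : |-t| ≤ b := (abs_neg t).trans_le habs
  calc μ.real {ω | r ≤ |X ω|}
      ≤ μ.real {ω | r ≤ X ω} + μ.real {ω | X ω ≤ -r} :=
        (measureReal_mono hsub).trans (measureReal_union_le _ _)
    _ ≤ Real.exp (-t * r) * mgf X μ t + Real.exp (-(-t) * -r) * mgf X μ (-t) :=
        add_le_add (measure_ge_le_exp_mul_mgf _ ht₀ (hX.integrable_exp_mul t habs))
          (measure_le_le_exp_mul_mgf _ (neg_nonpos.2 ht₀) (hX.integrable_exp_mul _ habs_neg))
    _ ≤ Real.exp (-t * r) * Real.exp (v * t ^ 2) +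
          Real.exp (-(-t) * -r) * Real.exp (v * (-t) ^ 2) := by
        gcongr
        exacts [hX.mgf_le t habs, hX.mgf_le _ habs_neg]
    _ = 2 * Real.exp (-(t * r) + v * t ^ 2) := by
        simp only [← Real.exp_add, mul_neg, neg_mul, neg_neg, neg_sq, two_mul]

end HasSubexponentialMGF

end SubexponentialMGF

section Gaussian

lemma integral_exp_mul_sq_sub_one_gaussianReal {u : ℝ} (hu : u < 1 / 2) :
    ∫ x, Real.exp (u * (x ^ 2 - 1)) ∂(gaussianReal 0 1) = Real.exp (-u) * (√(1 - 2 * u))⁻¹ := by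
  have : 0 < 1 / 2 - u := by linarith
  calc ∫ x, Real.exp (u * (x ^ 2 - 1)) ∂(gaussianReal 0 1)
      = Real.exp (-u) * ((√(2 * Real.pi))⁻¹ * √(Real.pi / (1 / 2 - u))) := by
        rw [integral_gaussianReal_eq_integral_smul one_ne_zero, ← integral_gaussian,
          ← integral_const_mul, ← integral_const_mul]
        refine integral_congr_ae (Filter.Eventually.of_forall fun x => ?_)
        simp only [gaussianPDFReal, NNReal.coe_one, mul_one, sub_zero, smul_eq_mul]
        rw [mul_assoc, ← Real.exp_add, mul_left_comm, ← Real.exp_add]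
        congr 2
        ring
    _ = _ := by
        rw [← Real.sqrt_inv, ← Real.sqrt_mul (by positivity), ← Real.sqrt_inv,
          show 1 - 2 * u = 2 * (1 / 2 - u) by ring]
        congr 2
        field_simp

lemma hasSubexponentialMGF_sq_sub_one_gaussianReal :
    HasSubexponentialMGF (fun x => x ^ 2 - 1) 2 (1 / 4) (gaussianReal 0 1) := by
  have hpos : ∀ t : ℝ, |t| ≤ 1 / 4 → 0 < 1 - 2 * t := fun t ht => by linarith [(abs_le.1 ht).2]
  refine ⟨fun t ht => Integrable.of_integral_ne_zero ?_, fun t ht => ?_⟩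
  · have := Real.sqrt_pos.2 (hpos t ht)
    rw [integral_exp_mul_sq_sub_one_gaussianReal (by linarith [hpos t ht])]
    positivity
  · have hlog := neg_sq_le_add_log_one_sub (x := 2 * t) (by rw [abs_mul, abs_two]; linarith)
    rw [mgf, integral_exp_mul_sq_sub_one_gaussianReal (by linarith [hpos t ht]),
      ← Real.exp_log (Real.sqrt_pos.2 (hpos t ht)), ← Real.exp_neg, ← Real.exp_add,
      Real.exp_le_exp, Real.log_sqrt (hpos t ht).le]
    linarith

variable {ι : Type*} [Fintype ι]

lemma hasSubexponentialMGF_pi_gaussianReal {c : ι → ℝ} {b : ℝ} (hc : ∀ i, |c i| * b ≤ 1 / 4) :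
    HasSubexponentialMGF (fun x => ∑ i, c i * (x i ^ 2 - 1)) (2 * ∑ i, c i ^ 2) b
      (Measure.pi fun _ : ι => gaussianReal 0 1) := by
  have hmeas : ∀ i, Measurable fun y : ℝ => c i * (y ^ 2 - 1) := fun i => by fun_prop
  have hindep := iIndepFun_pi (μ := fun _ : ι => gaussianReal 0 1) fun i => (hmeas i).aemeasurable
  have hsum := HasSubexponentialMGF.sum hindep
    (fun i => ((hmeas i).comp (measurable_pi_apply i)).aemeasurable) fun i =>
      (HasSubexponentialMGF.comp_iff_of_hasLaw (hmeas i).aemeasurable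
        (measurePreserving_eval (fun _ : ι => gaussianReal 0 1) i).hasLaw).2
        (hasSubexponentialMGF_sq_sub_one_gaussianReal.const_mul (hc i))
  rw [← Finset.sum_mul, mul_comm] at hsum
  simpa only [Finset.sum_fn] using hsum

variable [DecidableEq ι]

lemma dotProduct_mulVec_sum_smul_eigenvectorBasis {B : Matrix ι ι ℝ} (hB : B.IsHermitian)
    (x : ι → ℝ) :
    (⇑(∑ i, x i • hB.eigenvectorBasis i) : ι → ℝ) ⬝ᵥ
      B *ᵥ ⇑(∑ i, x i • hB.eigenvectorBasis i) = ∑ i, hB.eigenvalues i * x i ^ 2 := by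
  set e := hB.eigenvectorBasis
  set y : EuclideanSpace ℝ ι := ∑ i, x i • e i with hy
  have hy_apply : (⇑y : ι → ℝ) = ∑ i, x i • (⇑(e i) : ι → ℝ) := by
    ext k; simp [hy]
  have hBy : B *ᵥ (⇑y : ι → ℝ) = ∑ i, (x i * hB.eigenvalues i) • (⇑(e i) : ι → ℝ) := by
    rw [hy_apply, mulVec_sum]
    refine Finset.sum_congr rfl fun i _ => ?_
    rw [mulVec_smul, hB.mulVec_eigenvectorBasis i, smul_smul]
  have hcoord : ∀ i, (⇑y : ι → ℝ) ⬝ᵥ (⇑(e i) : ι → ℝ) = x i := fun i => by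
    rw [← e.orthonormal.inner_right_fintype x i, EuclideanSpace.inner_eq_star_dotProduct]
    simp [hy]
  rw [hBy, dotProduct_sum]
  refine Finset.sum_congr rfl fun i _ => ?_
  rw [dotProduct_smul, hcoord, smul_eq_mul]
  ring

lemma hasSubexponentialMGF_stdGaussian {B : Matrix ι ι ℝ} (hB : B.IsHermitian) {b : ℝ}
    (hb : ∀ i, |hB.eigenvalues i| * b ≤ 1 / 4) :
    HasSubexponentialMGF (fun y : EuclideanSpace ℝ ι => (⇑y : ι → ℝ) ⬝ᵥ B *ᵥ ⇑y - B.trace)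
      (2 * (B * B).trace) b (stdGaussian (EuclideanSpace ℝ ι)) := by
  have hlaw : HasLaw (fun x : ι → ℝ => ∑ i, x i • hB.eigenvectorBasis i)
      (stdGaussian (EuclideanSpace ℝ ι)) (Measure.pi fun _ : ι => gaussianReal 0 1) :=
    ⟨Measurable.aemeasurable (by fun_prop),
      (stdGaussian_eq_map_pi_orthonormalBasis hB.eigenvectorBasis).symm⟩
  rw [← HasSubexponentialMGF.comp_iff_of_hasLaw ?_ hlaw, trace_mul_self_eq_sum_eigenvalues hB]
  · convert hasSubexponentialMGF_pi_gaussianReal hb using 2 with x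
    rw [Function.comp_apply, dotProduct_mulVec_sum_smul_eigenvectorBasis,
      trace_eq_sum_eigenvalues_of_real hB, ← Finset.sum_sub_distrib]
    exact Finset.sum_congr rfl fun i _ => by ring
  · simp only [dotProduct_mulVec_eq_sum]
    exact Measurable.aemeasurable (by fun_prop)

lemma trace_mul_le_mul_trace {ι : Type*} [Fintype ι] {A C : Matrix ι ι ℝ} {z : ℝ}
    (hA : A.PosSemidef) (hCz : ∀ ξ : ι → ℝ, ξ ⬝ᵥ C *ᵥ ξ ≤ z * (ξ ⬝ᵥ ξ)) :
    (A * C).trace ≤ z * A.trace := by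
  obtain ⟨Q, rfl⟩ := exists_eq_transpose_mul_self hA
  have h := trace_transpose_mul_mul_le hCz Qᵀ
  rwa [transpose_transpose, mul_assoc, trace_mul_comm, mul_assoc, trace_mul_comm C,
    trace_mul_comm Q] at h

open scoped MatrixOrder in
lemma hasSubexponentialMGF_multivariateGaussian {A C : Matrix ι ι ℝ} {z K b : ℝ} (hz : 0 ≤ z)
    (hK : 0 ≤ K) (hb : 0 ≤ b) (hA : A.PosSemidef) (hC : C.PosSemidef)
    (hAK : ∀ ξ : ι → ℝ, ξ ⬝ᵥ A *ᵥ ξ ≤ K * (ξ ⬝ᵥ ξ))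
    (hCz : ∀ ξ : ι → ℝ, ξ ⬝ᵥ C *ᵥ ξ ≤ z * (ξ ⬝ᵥ ξ)) (hKb : K * z * b ≤ 1 / 4) :
    HasSubexponentialMGF
      (fun x : EuclideanSpace ℝ ι => (⇑x : ι → ℝ) ⬝ᵥ A *ᵥ ⇑x - (A * C).trace)
      (2 * (K * z * (z * A.trace))) b (multivariateGaussian 0 C) := by
  set R := CFC.sqrt C
  have hR_sq : R * R = C := CFC.sqrt_mul_sqrt_self _ hC.nonneg
  have hR : Rᵀ = R := by
    simpa [IsHermitian, conjTranspose_eq_transpose_of_trivial] using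
      (CFC.sqrt_nonneg C).posSemidef.isHermitian
  have hB : (R * A * R).PosSemidef := by
    simpa [conjTranspose_eq_transpose_of_trivial, hR] using hA.mul_mul_conjTranspose_same R
  have hB_form : ∀ ξ : ι → ℝ, ξ ⬝ᵥ (R * A * R) *ᵥ ξ = (R *ᵥ ξ) ⬝ᵥ A *ᵥ (R *ᵥ ξ) := fun ξ => by
    simpa only [hR] using dotProduct_conj_mulVec R A ξ
  have hB_le : ∀ ξ : ι → ℝ, ξ ⬝ᵥ (R * A * R) *ᵥ ξ ≤ K * z * (ξ ⬝ᵥ ξ) := fun ξ =>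
    calc ξ ⬝ᵥ (R * A * R) *ᵥ ξ ≤ K * ((R *ᵥ ξ) ⬝ᵥ (R *ᵥ ξ)) := (hB_form ξ).trans_le (hAK _)
      _ = K * (ξ ⬝ᵥ C *ᵥ ξ) := by
        rw [← hR_sq, ← mulVec_mulVec, dotProduct_mulVec ξ R, ← mulVec_transpose, hR]
      _ ≤ K * z * (ξ ⬝ᵥ ξ) := by rw [mul_assoc]; gcongr; exact hCz ξ
  have hB_eigenvalues : ∀ i, |hB.isHermitian.eigenvalues i| * b ≤ 1 / 4 := fun i => by
    obtain ⟨ξ, hξ, hform⟩ := exists_dotProduct_mulVec_eq_eigenvalues hB.isHermitian i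
    have hle := hB_le ξ
    rw [hξ, mul_one, hform] at hle
    rw [abs_of_nonneg (hB.eigenvalues_nonneg i)]
    exact (mul_le_mul_of_nonneg_right hle hb).trans hKb
  have hB_trace : (R * A * R).trace = (A * C).trace := by
    rw [mul_assoc, trace_mul_comm, mul_assoc, hR_sq]
  have hB_sq_trace : (R * A * R * (R * A * R)).trace ≤ K * z * (z * A.trace) :=
    calc _ ≤ K * z * (A * C).trace := hB_trace ▸ trace_mul_le_mul_trace hB hB_le
      _ ≤ _ := by gcongr; exact trace_mul_le_mul_trace hA hCz
  have hlaw : HasLaw (fun y : EuclideanSpace ℝ ι => 0 + toEuclideanCLM (𝕜 := ℝ) R y)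
      (multivariateGaussian 0 C) (stdGaussian (EuclideanSpace ℝ ι)) :=
    ⟨Measurable.aemeasurable (by fun_prop), rfl⟩
  rw [← HasSubexponentialMGF.comp_iff_of_hasLaw ?_ hlaw]
  · convert (hasSubexponentialMGF_stdGaussian hB.isHermitian hB_eigenvalues).mono
      (mul_le_mul_of_nonneg_left hB_sq_trace zero_le_two) using 2 with y
    rw [hB_trace, hB_form]
    simp only [Function.comp_apply, zero_add]
    rfl
  · simp only [dotProduct_mulVec_eq_sum]
    exact Measurable.aemeasurable (by fun_prop)

lemma trace_mul_sampleCov {ι : Type*} [Fintype ι] {n : ℕ} (A : Matrix ι ι ℝ)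
    (x : Fin n → EuclideanSpace ℝ ι) :
    (A * sampleCov x).trace = (n : ℝ)⁻¹ * ∑ k, (⇑(x k) : ι → ℝ) ⬝ᵥ A *ᵥ ⇑(x k) := by
  simp only [dotProduct_mulVec_eq_sum, trace, diag, mul_apply, sampleCov, of_apply,
    Finset.mul_sum]
  conv_rhs => rw [Finset.sum_comm]
  refine Finset.sum_congr rfl fun i _ => ?_
  conv_rhs => rw [Finset.sum_comm]
  exact Finset.sum_congr rfl fun i _ => Finset.sum_congr rfl fun k _ => by ring

lemma sampleCov_posSemidef {ι : Type*} [Finite ι] {n : ℕ} (x : Fin n → EuclideanSpace ℝ ι) :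
    (sampleCov x).PosSemidef := by
  have h : sampleCov x = (n : ℝ)⁻¹ • ∑ k, vecMulVec (⇑(x k) : ι → ℝ) (star (⇑(x k) : ι → ℝ)) := by
    ext i j
    simp [sampleCov, vecMulVec_apply, Matrix.sum_apply]
  rw [h]
  exact (posSemidef_sum _ fun k _ => posSemidef_vecMulVec_self_star _).smul (by positivity)

lemma hasSubexponentialMGF_trace_mul_sampleCov_sub {n : ℕ} (hn : 0 < n) {Ω : Type*}
    [MeasurableSpace Ω] {μ : Measure Ω} {X : Fin n → Ω → EuclideanSpace ℝ ι} {A C : Matrix ι ι ℝ}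
    {z K b : ℝ} (hX : iIndepFun X μ) (hlaw : ∀ k, HasLaw (X k) (multivariateGaussian 0 C) μ)
    (hz : 0 ≤ z) (hK : 0 ≤ K) (hb : 0 ≤ b) (hA : A.PosSemidef) (hC : C.PosSemidef)
    (hAK : ∀ ξ : ι → ℝ, ξ ⬝ᵥ A *ᵥ ξ ≤ K * (ξ ⬝ᵥ ξ))
    (hCz : ∀ ξ : ι → ℝ, ξ ⬝ᵥ C *ᵥ ξ ≤ z * (ξ ⬝ᵥ ξ)) (hKb : K * z * b ≤ 1 / 4) :
    HasSubexponentialMGF (fun ω => (A * (sampleCov (fun k => X k ω) - C)).trace)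
      (2 * (K * z * (z * A.trace)) / n) (n * b) μ := by
  have hn' : (n : ℝ) ≠ 0 := by exact_mod_cast hn.ne'
  set q : EuclideanSpace ℝ ι → ℝ := fun x => (⇑x : ι → ℝ) ⬝ᵥ A *ᵥ ⇑x - (A * C).trace
  have hq : Measurable q := by
    simp only [q, dotProduct_mulVec_eq_sum]
    fun_prop
  have hsum := HasSubexponentialMGF.sum (hX.comp (fun _ => q) fun _ => hq)
    (fun k => hq.comp_aemeasurable (hlaw k).aemeasurable) fun k =>
      (HasSubexponentialMGF.comp_iff_of_hasLaw hq.aemeasurable (hlaw k)).2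
        (hasSubexponentialMGF_multivariateGaussian hz hK hb hA hC hAK hCz hKb)
  have hscale : |(n : ℝ)⁻¹| * (n * b) ≤ b := by
    rw [abs_of_nonneg (by positivity), inv_mul_cancel_left₀ hn']
  convert hsum.const_mul hscale using 1
  · ext ω
    rw [mul_sub, trace_sub, trace_mul_sampleCov]
    simp only [Finset.sum_apply, q, Function.comp_apply, Finset.sum_sub_distrib,
      Finset.sum_const, Finset.card_univ, Fintype.card_fin, nsmul_eq_mul, mul_sub]
    rw [inv_mul_cancel_left₀ hn']
  · rw [Finset.sum_const, Finset.card_univ, Fintype.card_fin, nsmul_eq_mul]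
    field_simp

end Gaussian

section RankOne

lemma abs_le_of_forall_mul_le {A B D κ₀ : ℝ} (hκ₀ : 0 < κ₀)
    (h : ∀ κ, |κ| ≤ κ₀ → κ * A ≤ D + B * κ ^ 2) (hD : D ≤ B * κ₀ ^ 2) : |A| ≤ 2 * B * κ₀ := by
  have h_pos := h κ₀ (abs_of_pos hκ₀).le
  have h_neg := h (-κ₀) (by rw [abs_neg, abs_of_pos hκ₀])
  refine abs_le.2 ⟨?_, ?_⟩ <;> refine le_of_mul_le_mul_left ?_ hκ₀ <;> linarith

lemma sq_le_of_forall_mul_le {A B D κ₀ : ℝ} (hB : 0 < B) (hκ₀ : 0 < κ₀)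
    (h : ∀ κ, |κ| ≤ κ₀ → κ * A ≤ D + B * κ ^ 2) (hD : D ≤ B * κ₀ ^ 2) : A ^ 2 ≤ 4 * B * D := by
  have h_opt := h (A / (2 * B)) (by
    rw [abs_div, abs_of_pos (show 0 < 2 * B by positivity), div_le_iff₀ (by positivity)]
    linarith [abs_le_of_forall_mul_le hκ₀ h hD])
  have h_val : A / (2 * B) * A - B * (A / (2 * B)) ^ 2 = A ^ 2 / (4 * B) := by field_simp; ring
  have h_le : A ^ 2 / (4 * B) ≤ D := by linarith
  rw [div_le_iff₀ (by positivity)] at h_le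
  linarith

variable {ι₁ ι₂ : Type*} [Fintype ι₁] [Fintype ι₂] {D Z k : ℝ} {u₀ u : ι₁ → ℝ} {v₀ v : ι₂ → ℝ}

/-- The rank-one array `u ⊗ v` obeys the test `x ⊗ y` against the reference array `u₀ ⊗ v₀`, i.e.
`⟨x ⊗ y, u ⊗ v - u₀ ⊗ v₀⟩ ≤ D + Z ‖x ⊗ y‖²`. -/
def RankOneTest (D Z : ℝ) (u₀ u : ι₁ → ℝ) (v₀ v : ι₂ → ℝ) (x : ι₁ → ℝ) (y : ι₂ → ℝ) : Prop :=
  (x ⬝ᵥ u) * (y ⬝ᵥ v) - (x ⬝ᵥ u₀) * (y ⬝ᵥ v₀) ≤ D + Z * ((x ⬝ᵥ x) * (y ⬝ᵥ y))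

/-- The tests of radius `k` that force `u ⊗ v` to be `ℓ²`-close to `u₀ ⊗ v₀`: one factor of the
test array is a reference factor and the other one is free, or is a multiple of the other
reference factor. -/
structure RankOneTests (D Z k : ℝ) (u₀ u : ι₁ → ℝ) (v₀ v : ι₂ → ℝ) : Prop where
  scale : ∀ κ, |κ| ≤ k → RankOneTest D Z u₀ u v₀ v (κ • u₀) v₀
  left : ∀ x, x ⬝ᵥ x ≤ k ^ 2 → RankOneTest D Z u₀ u v₀ v x v₀
  right : ∀ y, y ⬝ᵥ y ≤ k ^ 2 → RankOneTest D Z u₀ u v₀ v u₀ y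

lemma RankOneTest.smul_smul_inv {x : ι₁ → ℝ} {y : ι₂ → ℝ} {t : ℝ} (ht : t ≠ 0)
    (h : RankOneTest D Z u₀ u v₀ v x y) : RankOneTest D Z u₀ (t • u) v₀ (t⁻¹ • v) x y := by
  have h_scale : (t * (x ⬝ᵥ u)) * (t⁻¹ * (y ⬝ᵥ v)) = (x ⬝ᵥ u) * (y ⬝ᵥ v) := by field_simp
  simpa only [RankOneTest, dotProduct_smul, smul_eq_mul, h_scale] using h

lemma RankOneTests.smul_smul_inv {t : ℝ} (ht : t ≠ 0) (h : RankOneTests D Z k u₀ u v₀ v) :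
    RankOneTests D Z k u₀ (t • u) v₀ (t⁻¹ • v) :=
  ⟨fun κ hκ => (h.scale κ hκ).smul_smul_inv ht, fun x hx => (h.left x hx).smul_smul_inv ht,
    fun y hy => (h.right y hy).smul_smul_inv ht⟩

lemma RankOneTests.inner_sub_sq_le (h : RankOneTests D Z k u₀ u v₀ v) (hk : 0 < k)
    (hR : 0 < Z * ((u₀ ⬝ᵥ u₀) * (v₀ ⬝ᵥ v₀)))
    (hD : D ≤ Z * ((u₀ ⬝ᵥ u₀) * (v₀ ⬝ᵥ v₀)) * k ^ 2) :
    ((u₀ ⬝ᵥ u) * (v₀ ⬝ᵥ v) - (u₀ ⬝ᵥ u₀) * (v₀ ⬝ᵥ v₀)) ^ 2 ≤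
      4 * (Z * ((u₀ ⬝ᵥ u₀) * (v₀ ⬝ᵥ v₀))) * D := by
  refine sq_le_of_forall_mul_le hR hk (fun κ hκ => ?_) hD
  have h_test := h.scale κ hκ
  simp only [RankOneTest, smul_dotProduct, dotProduct_smul, smul_eq_mul] at h_test
  linarith

lemma RankOneTests.half_le_inner (h : RankOneTests D Z k u₀ u v₀ v) (hk : 0 < k) (hZ : 0 < Z)
    (hZk : Z * k ≤ 1 / 4) (hU : 0 < u₀ ⬝ᵥ u₀) (hV : 0 < v₀ ⬝ᵥ v₀)
    (hD : D ≤ Z * ((u₀ ⬝ᵥ u₀) * (v₀ ⬝ᵥ v₀)) * k ^ 2) :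
    (u₀ ⬝ᵥ u₀) * (v₀ ⬝ᵥ v₀) / 2 ≤ (u₀ ⬝ᵥ u) * (v₀ ⬝ᵥ v) := by
  have h_sq := h.inner_sub_sq_le hk (by positivity) hD
  set R := (u₀ ⬝ᵥ u₀) * (v₀ ⬝ᵥ v₀)
  have : 0 < R := mul_pos hU hV
  have h_close : |(u₀ ⬝ᵥ u) * (v₀ ⬝ᵥ v) - R| ≤ R / 2 := by
    refine abs_le_of_sq_le_sq (h_sq.trans ?_) (by positivity)
    calc 4 * (Z * R) * D ≤ 4 * (Z * R) * (Z * R * k ^ 2) := by gcongr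
      _ = 4 * R ^ 2 * (Z * k) ^ 2 := by ring
      _ ≤ 4 * R ^ 2 * (1 / 4) ^ 2 := by gcongr
      _ = (R / 2) ^ 2 := by ring
  linarith [(abs_le.1 h_close).1]

lemma le_one_of_forall_mul_le {X W D k m Z : ℝ} (hX : 0 ≤ X) (hW : 0 < W) (hk : 0 < k)
    (hm : W / 2 ≤ m) (hD : D < k / 4 * W) (hZk : Z * k ≤ 1 / 4)
    (htest : ∀ c, 0 ≤ c → c ^ 2 * X ≤ k ^ 2 → c * (m * X) ≤ D + Z * (c ^ 2 * X) * W) : X ≤ 1 := by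
  by_contra! h_one
  obtain ⟨y, hy, rfl⟩ : ∃ y, 0 ≤ y ∧ y ^ 2 = X := ⟨√X, Real.sqrt_nonneg X, Real.sq_sqrt hX⟩
  have hy_one : 1 < y := by nlinarith
  have h_boundary : (k / y) ^ 2 * y ^ 2 = k ^ 2 := by field_simp
  have h_test := htest (k / y) (by positivity) h_boundary.le
  rw [h_boundary, show k / y * (m * y ^ 2) = k * m * y by field_simp] at h_test
  have hm_pos : 0 < m := by linarith
  have h_lower : k * (W / 2) * 1 ≤ k * m * y := by gcongr
  have h_upper : Z * k ^ 2 * W ≤ 1 / 4 * (k * W) := by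
    calc Z * k ^ 2 * W = (Z * k) * (k * W) := by ring
      _ ≤ 1 / 4 * (k * W) := by gcongr
  linarith

lemma mul_le_of_forall_mul_le {X W D k m Z : ℝ} (hX : 0 ≤ X) (hW : 0 < W) (hk : 0 < k)
    (hm : W / 2 ≤ m) (hD : D < k / 4 * W) (hZk : Z * k ≤ 1 / 4)
    (htest : ∀ c, 0 ≤ c → c ^ 2 * X ≤ k ^ 2 → c * (m * X) ≤ D + Z * (c ^ 2 * X) * W) :
    X * W ≤ 4 / k * D := by
  have hX_one := le_one_of_forall_mul_le hX hW hk hm hD hZk htest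
  have h_test := htest k hk.le (by nlinarith [sq_nonneg k])
  have h_upper : Z * (k ^ 2 * X) * W ≤ 1 / 4 * (k * (X * W)) := by
    calc Z * (k ^ 2 * X) * W = (Z * k) * (k * (X * W)) := by ring
      _ ≤ 1 / 4 * (k * (X * W)) := by gcongr
  have h_lower : k * (W / 2 * X) ≤ k * (m * X) := by gcongr
  rw [div_mul_eq_mul_div, le_div_iff₀ hk]
  linarith

lemma RankOneTests.left_sub_le (h : RankOneTests D Z k u₀ u v₀ v) (hk : 0 < k)
    (hZk : Z * k ≤ 1 / 4) (hV : 0 < v₀ ⬝ᵥ v₀) (hnorm : v₀ ⬝ᵥ v = v₀ ⬝ᵥ v₀)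
    (hD : D < k / 4 * (v₀ ⬝ᵥ v₀)) :
    (u - u₀) ⬝ᵥ (u - u₀) * (v₀ ⬝ᵥ v₀) ≤ 4 / k * D := by
  refine mul_le_of_forall_mul_le (m := v₀ ⬝ᵥ v₀) (dotProduct_self_nonneg _) hV hk (by linarith) hD
    hZk fun c _ hc => ?_
  have h_test := h.left (c • (u - u₀)) (by
    simpa only [smul_dotProduct, dotProduct_smul, smul_eq_mul, ← mul_assoc, ← sq] using hc)
  simp only [RankOneTest, hnorm, ← sub_mul, ← dotProduct_sub] at h_test
  simp only [smul_dotProduct, dotProduct_smul, smul_eq_mul] at h_test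
  linarith

lemma RankOneTests.right_sub_le (h : RankOneTests D Z k u₀ u v₀ v) (hk : 0 < k)
    (hZk : Z * k ≤ 1 / 4) (hU : 0 < u₀ ⬝ᵥ u₀) (hm : u₀ ⬝ᵥ u₀ / 2 ≤ u₀ ⬝ᵥ u)
    (hnorm : v₀ ⬝ᵥ v = v₀ ⬝ᵥ v₀) (hD : D < k / 4 * (u₀ ⬝ᵥ u₀)) :
    (v - v₀) ⬝ᵥ (v - v₀) * (u₀ ⬝ᵥ u₀) ≤ 4 / k * D := by
  refine mul_le_of_forall_mul_le (m := u₀ ⬝ᵥ u) (dotProduct_self_nonneg _) hU hk hm hD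
    hZk fun c _ hc => ?_
  have h_orth : (v - v₀) ⬝ᵥ v₀ = 0 := by
    rw [sub_dotProduct, dotProduct_comm v, hnorm, sub_self]
  have h_self : (v - v₀) ⬝ᵥ v = (v - v₀) ⬝ᵥ (v - v₀) := by rw [dotProduct_sub, h_orth, sub_zero]
  have h_test := h.right (c • (v - v₀)) (by
    simpa only [smul_dotProduct, dotProduct_smul, smul_eq_mul, ← mul_assoc, ← sq] using hc)
  simp only [RankOneTest, smul_dotProduct, dotProduct_smul, smul_eq_mul, h_orth, h_self,
    mul_zero, sub_zero] at h_test
  linarith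

lemma sum_sum_mul_sq (x : ι₁ → ℝ) (y : ι₂ → ℝ) :
    ∑ i, ∑ j, (x i * y j) ^ 2 = (x ⬝ᵥ x) * (y ⬝ᵥ y) := by
  simp only [dotProduct, Finset.sum_mul_sum]
  exact Finset.sum_congr rfl fun i _ => Finset.sum_congr rfl fun j _ => by ring

lemma sum_sum_mul_sub_mul_sq_le (u₀ u : ι₁ → ℝ) (v₀ v : ι₂ → ℝ) :
    ∑ i, ∑ j, (u i * v j - u₀ i * v₀ j) ^ 2 ≤
      2 * ((u - u₀) ⬝ᵥ (u - u₀) * (v₀ ⬝ᵥ v₀)) + 4 * ((v - v₀) ⬝ᵥ (v - v₀) * (u₀ ⬝ᵥ u₀)) +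
        4 * ((u - u₀) ⬝ᵥ (u - u₀) * ((v - v₀) ⬝ᵥ (v - v₀))) := by
  calc ∑ i, ∑ j, (u i * v j - u₀ i * v₀ j) ^ 2
      ≤ ∑ i, ∑ j, (2 * ((u - u₀) i * v₀ j) ^ 2 + 4 * (u₀ i * (v - v₀) j) ^ 2 +
          4 * ((u - u₀) i * (v - v₀) j) ^ 2) :=
        Finset.sum_le_sum fun i _ => Finset.sum_le_sum fun j _ => by
          simp only [Pi.sub_apply]
          nlinarith [sq_nonneg ((u i - u₀ i) * v₀ j - u i * (v j - v₀ j)),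
            sq_nonneg (u₀ i * (v j - v₀ j) - (u i - u₀ i) * (v j - v₀ j))]
    _ = _ := by
        simp only [Finset.sum_add_distrib, ← Finset.mul_sum, sum_sum_mul_sq]
        rw [mul_comm (u₀ ⬝ᵥ u₀)]

lemma RankOneTests.sum_sq_le_of_normalized {η : ℝ} (h : RankOneTests D Z k u₀ u v₀ v) (hk : 0 < k)
    (hZk : Z * k ≤ 1 / 4) (hη : 0 ≤ η) (hUη : 1 ≤ η * (u₀ ⬝ᵥ u₀)) (hU : 0 < u₀ ⬝ᵥ u₀)
    (hV : 0 < v₀ ⬝ᵥ v₀) (hm : u₀ ⬝ᵥ u₀ / 2 ≤ u₀ ⬝ᵥ u) (hnorm : v₀ ⬝ᵥ v = v₀ ⬝ᵥ v₀)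
    (hDU : D < k / 4 * (u₀ ⬝ᵥ u₀)) (hDV : D < k / 4 * (v₀ ⬝ᵥ v₀)) :
    ∑ i, ∑ j, (u i * v j - u₀ i * v₀ j) ^ 2 ≤ (24 + 16 * η) / k * D := by
  have h_left := h.left_sub_le hk hZk hV hnorm hDV
  have h_right := h.right_sub_le hk hZk hU hm hnorm hDU
  refine (sum_sum_mul_sub_mul_sq_le u₀ u v₀ v).trans ?_
  have hc := dotProduct_self_nonneg (v - v₀)
  set a := (u - u₀) ⬝ᵥ (u - u₀)
  set c := (v - v₀) ⬝ᵥ (v - v₀)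
  have ha_one : a ≤ 1 := by
    refine le_of_mul_le_mul_right (h_left.trans ?_) hV
    rw [div_mul_eq_mul_div, div_le_iff₀ hk]
    linarith
  have h_cross : a * c ≤ η * (4 / k * D) := by
    calc a * c ≤ 1 * c := by gcongr
      _ ≤ (η * (u₀ ⬝ᵥ u₀)) * c := by gcongr
      _ = η * (c * (u₀ ⬝ᵥ u₀)) := by ring
      _ ≤ η * (4 / k * D) := by gcongr
  calc 2 * (a * (v₀ ⬝ᵥ v₀)) + 4 * (c * (u₀ ⬝ᵥ u₀)) + 4 * (a * c)
      ≤ 2 * (4 / k * D) + 4 * (4 / k * D) + 4 * (η * (4 / k * D)) := by gcongr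
    _ = (24 + 16 * η) / k * D := by ring

lemma RankOneTests.sum_sq_le {η : ℝ} (h : RankOneTests D Z k u₀ u v₀ v) (hk : 0 < k) (hZ : 0 < Z)
    (hZk : Z * k ≤ 1 / 4) (hη : 0 ≤ η) (hUη : 1 ≤ η * (u₀ ⬝ᵥ u₀)) (hV : 0 < v₀ ⬝ᵥ v₀)
    (hvv : 0 ≤ v₀ ⬝ᵥ v) (hD : D ≤ Z * ((u₀ ⬝ᵥ u₀) * (v₀ ⬝ᵥ v₀)) * k ^ 2)
    (hDU : D < k / 4 * (u₀ ⬝ᵥ u₀)) (hDV : D < k / 4 * (v₀ ⬝ᵥ v₀)) :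
    ∑ i, ∑ j, (u i * v j - u₀ i * v₀ j) ^ 2 ≤ (24 + 16 * η) / k * D := by
  have hU : 0 < u₀ ⬝ᵥ u₀ := pos_of_mul_pos_right (zero_lt_one.trans_le hUη) hη
  have h_half := h.half_le_inner hk hZ hZk hU hV hD
  have hvv_pos : 0 < v₀ ⬝ᵥ v := hvv.lt_of_ne fun h_zero => by
    rw [← h_zero, mul_zero] at h_half
    linarith [mul_pos hU hV]
  set t := (v₀ ⬝ᵥ v) / (v₀ ⬝ᵥ v₀) with ht
  have ht_pos : 0 < t := div_pos hvv_pos hV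
  have h_norm : v₀ ⬝ᵥ (t⁻¹ • v) = v₀ ⬝ᵥ v₀ := by
    rw [dotProduct_smul, smul_eq_mul, ht, inv_div, div_mul_cancel₀ _ hvv_pos.ne']
  have h_inner : u₀ ⬝ᵥ u₀ / 2 ≤ u₀ ⬝ᵥ (t • u) := by
    rw [dotProduct_smul, smul_eq_mul, ht, div_mul_eq_mul_div, le_div_iff₀ hV]
    linarith
  have h_bound := (h.smul_smul_inv ht_pos.ne').sum_sq_le_of_normalized hk hZk hη hUη hU hV
    h_inner h_norm hDU hDV
  have h_scale : ∀ i j, (t • u) i * (t⁻¹ • v) j = u i * v j := fun i j => by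
    simp only [Pi.smul_apply, smul_eq_mul]; field_simp
  simpa only [h_scale] using h_bound

end RankOne

section NegPart

variable {ι₁ ι₂ : Type*} [Fintype ι₁] [Fintype ι₂] {D Z k : ℝ} {w₁ v₁ : ι₁ → ℝ} {w₂ v₂ : ι₂ → ℝ}

lemma sum_abs_sub_eq {ι : Type*} [Fintype ι] (v w : ι → ℝ) :
    ∑ e, |v e - w e| = ∑ e, v e - ∑ e, w e + 2 * ∑ e, (w - v)⁺ e := by
  rw [Finset.mul_sum, ← Finset.sum_sub_distrib, ← Finset.sum_add_distrib]
  refine Finset.sum_congr rfl fun e _ => ?_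
  rw [Pi.posPart_apply, Pi.sub_apply, abs_sub_comm, ← posPart_add_negPart (w e - v e)]
  linarith [posPart_sub_negPart (w e - v e)]

lemma posPart_dotProduct_self {ι : Type*} [Fintype ι] (x : ι → ℝ) : x⁺ ⬝ᵥ x = x⁺ ⬝ᵥ x⁺ := by
  refine Finset.sum_congr rfl fun e _ => ?_
  rw [Pi.posPart_apply]
  rcases le_total (x e) 0 with h | h
  · simp only [posPart_eq_zero.2 h, zero_mul]
  · rw [posPart_eq_self.2 h]

lemma posPart_sub_dotProduct {ι : Type*} [Fintype ι] (v w : ι → ℝ) :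
    (w - v)⁺ ⬝ᵥ v = (w - v)⁺ ⬝ᵥ w - (w - v)⁺ ⬝ᵥ (w - v)⁺ := by
  rw [← posPart_dotProduct_self, dotProduct_sub, sub_sub_cancel]

lemma abs_posPart_sub_le {ι : Type*} {v w : ι → ℝ} (hv : ∀ e, 0 ≤ v e) (hw : ∀ e, 0 ≤ w e)
    (e : ι) : |(w - v)⁺ e| ≤ w e := by
  rw [Pi.posPart_apply, abs_of_nonneg (posPart_nonneg _)]
  exact sup_le (sub_le_self _ (hv e)) (hw e)

lemma sum_sub_sum_le_posPart {ι : Type*} [Fintype ι] (w v : ι → ℝ) :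
    ∑ e, w e - ∑ e, v e ≤ ∑ e, (w - v)⁺ e := by
  rw [← Finset.sum_sub_distrib]
  exact Finset.sum_le_sum fun e _ => le_posPart (w e - v e)

lemma RankOneTest.posPart_left_le (h : RankOneTest D Z w₁ v₁ w₂ v₂ ((-k) • (w₁ - v₁)⁺) w₂)
    (hk : 0 < k) (hZk : Z * k ≤ 1 / 4) (hnorm : w₂ ⬝ᵥ v₂ = w₂ ⬝ᵥ w₂) (hD : 0 ≤ D) :
    (w₁ - v₁)⁺ ⬝ᵥ (w₁ - v₁)⁺ * (w₂ ⬝ᵥ w₂) ≤ 24 / k * D := by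
  have hXW := mul_nonneg (dotProduct_self_nonneg (w₁ - v₁)⁺) (dotProduct_self_nonneg w₂)
  simp only [RankOneTest, smul_dotProduct, dotProduct_smul, smul_eq_mul, hnorm,
    posPart_sub_dotProduct v₁] at h
  set X := (w₁ - v₁)⁺ ⬝ᵥ (w₁ - v₁)⁺
  have h_quad : Z * (k * (k * X) * (w₂ ⬝ᵥ w₂)) ≤ 1 / 4 * (k * (X * (w₂ ⬝ᵥ w₂))) := by
    calc Z * (k * (k * X) * (w₂ ⬝ᵥ w₂)) = Z * k * (k * (X * (w₂ ⬝ᵥ w₂))) := by ring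
      _ ≤ 1 / 4 * (k * (X * (w₂ ⬝ᵥ w₂))) := by gcongr
  rw [div_mul_eq_mul_div, le_div_iff₀ hk]
  linarith

lemma mul_inner_posPart_le (hZ : 0 < Z) (hD : 0 ≤ D) (hW₂ : 0 < w₂ ⬝ᵥ w₂)
    (hR : ((w₁ ⬝ᵥ v₁ - w₁ ⬝ᵥ w₁) * (w₂ ⬝ᵥ w₂)) ^ 2 ≤
      4 * (Z * ((w₁ ⬝ᵥ w₁) * (w₂ ⬝ᵥ w₂))) * D) (y : ι₂ → ℝ) :
    (w₁ ⬝ᵥ v₁ - w₁ ⬝ᵥ w₁) * (y ⬝ᵥ w₂) ≤ (w₁ ⬝ᵥ w₁) * (y ⬝ᵥ y) / 8 + 8 * Z * D := by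
  have hY := dotProduct_self_nonneg y
  have hW₁ := dotProduct_self_nonneg w₁
  have h_cauchy : (y ⬝ᵥ w₂) ^ 2 ≤ (y ⬝ᵥ y) * (w₂ ⬝ᵥ w₂) := by
    simpa only [dotProduct, sq] using Finset.sum_mul_sq_le_sq_mul_sq Finset.univ y w₂
  set m := w₁ ⬝ᵥ v₁ - w₁ ⬝ᵥ w₁
  have hm : m ^ 2 * (w₂ ⬝ᵥ w₂) ≤ 4 * Z * (w₁ ⬝ᵥ w₁) * D := by
    refine le_of_mul_le_mul_right ?_ hW₂
    linarith
  have h_sq : (m * (y ⬝ᵥ w₂)) ^ 2 ≤ 4 * Z * D * ((w₁ ⬝ᵥ w₁) * (y ⬝ᵥ y)) := by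
    calc (m * (y ⬝ᵥ w₂)) ^ 2 = m ^ 2 * (y ⬝ᵥ w₂) ^ 2 := by ring
      _ ≤ m ^ 2 * ((y ⬝ᵥ y) * (w₂ ⬝ᵥ w₂)) := by gcongr
      _ = m ^ 2 * (w₂ ⬝ᵥ w₂) * (y ⬝ᵥ y) := by ring
      _ ≤ 4 * Z * (w₁ ⬝ᵥ w₁) * D * (y ⬝ᵥ y) := by gcongr
      _ = 4 * Z * D * ((w₁ ⬝ᵥ w₁) * (y ⬝ᵥ y)) := by ring
  refine le_of_abs_le (abs_le_of_sq_le_sq (h_sq.trans ?_) (by positivity))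
  nlinarith [sq_nonneg ((w₁ ⬝ᵥ w₁) * (y ⬝ᵥ y) / 8 - 8 * Z * D)]

lemma RankOneTest.posPart_right_le (h : RankOneTest D Z w₁ v₁ w₂ v₂ ((-k) • w₁) (w₂ - v₂)⁺)
    (hk : 0 < k) (hZ : 0 < Z) (hZk : Z * k ≤ 1 / 4) (hD : 0 ≤ D) (hW₂ : 0 < w₂ ⬝ᵥ w₂)
    (hm : w₁ ⬝ᵥ w₁ / 2 ≤ w₁ ⬝ᵥ v₁)
    (hR : ((w₁ ⬝ᵥ v₁ - w₁ ⬝ᵥ w₁) * (w₂ ⬝ᵥ w₂)) ^ 2 ≤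
      4 * (Z * ((w₁ ⬝ᵥ w₁) * (w₂ ⬝ᵥ w₂))) * D) :
    (w₂ - v₂)⁺ ⬝ᵥ (w₂ - v₂)⁺ * (w₁ ⬝ᵥ w₁) ≤ 24 / k * D := by
  have h_cross := mul_inner_posPart_le hZ hD hW₂ hR (w₂ - v₂)⁺
  have hY := dotProduct_self_nonneg (w₂ - v₂)⁺
  have hW₁ := dotProduct_self_nonneg w₁
  simp only [RankOneTest, smul_dotProduct, dotProduct_smul, smul_eq_mul,
    posPart_sub_dotProduct v₂] at h
  set Y := (w₂ - v₂)⁺ ⬝ᵥ (w₂ - v₂)⁺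
  set c := (w₂ - v₂)⁺ ⬝ᵥ w₂
  set m := w₁ ⬝ᵥ v₁
  set W₁ := w₁ ⬝ᵥ w₁
  have : k * (m * Y - (m - W₁) * c) ≤ D + Z * k * (k * (W₁ * Y)) := by linarith
  have h_lower : k * (W₁ / 2 * Y - (W₁ * Y / 8 + 8 * Z * D)) ≤ k * (m * Y - (m - W₁) * c) := by
    gcongr
  have h_quad : Z * k * (k * (W₁ * Y)) ≤ 1 / 4 * (k * (W₁ * Y)) := by gcongr
  have h_noise : 8 * D * (Z * k) ≤ 8 * D * (1 / 4) := by gcongr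
  rw [div_mul_eq_mul_div, le_div_iff₀ hk]
  linarith [mul_nonneg hk.le (mul_nonneg hW₁ hY)]

lemma mul_sum_le_of_sq_sum_le {ι : Type*} [Fintype ι] {x : ι → ℝ} {A B W T K β s c : ℝ}
    (hA : 0 ≤ A) (hT : 0 ≤ T) (hβ : 0 < β) (hs : 0 ≤ s) (hc : 0 ≤ c)
    (hcK : c ^ 2 * β = s * K) (hsupp : (∑ e, x e) ^ 2 ≤ s * A ^ 2 * (x ⬝ᵥ x))
    (hW : β * B ^ 2 ≤ W) (hx : x ⬝ᵥ x * W ≤ K * T ^ 2) :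
    B * ∑ e, x e ≤ c * A * T := by
  refine le_of_abs_le (abs_le_of_sq_le_sq (le_of_mul_le_mul_right ?_ hβ) (by positivity))
  have hX := dotProduct_self_nonneg x
  calc (B * ∑ e, x e) ^ 2 * β = β * B ^ 2 * (∑ e, x e) ^ 2 := by ring
    _ ≤ β * B ^ 2 * (s * A ^ 2 * (x ⬝ᵥ x)) := by gcongr
    _ = s * A ^ 2 * (x ⬝ᵥ x * (β * B ^ 2)) := by ring
    _ ≤ s * A ^ 2 * (x ⬝ᵥ x * W) := by gcongr
    _ ≤ s * A ^ 2 * (K * T ^ 2) := by gcongr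
    _ = (c * A * T) ^ 2 * β := by linear_combination (-(A ^ 2 * T ^ 2)) * hcK

end NegPart

section FactorGraph

variable {p : ℕ} {s d : ℝ} {w : Edge p → ℝ}

/-- The assumptions of `TrueGraphs` on a single factor graph: nonnegative weights, at most `s p`
edges, and weighted degrees in `[1/d, d]`. -/
structure FactorGraph (s d : ℝ) {p : ℕ} (w : Edge p → ℝ) : Prop where
  nonneg : ∀ e, 0 ≤ w e
  sparse : ((Finset.univ.filter fun e => w e ≠ 0).card : ℝ) ≤ s * p
  degree : ∀ i, 1 / d ≤ degree w i ∧ degree w i ≤ d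

/-- Lower bound, per vertex, for the squared norms of the weights and of the degrees of a factor
graph. -/
noncomputable def energyConst (s d : ℝ) : ℝ := 1 / (4 * d ^ 2 * s)

lemma energyConst_pos (hs : 1 ≤ s) (hd : 1 < d) : 0 < energyConst s d := by
  unfold energyConst; positivity

lemma energyConst_le_one_div_sq (hs : 1 ≤ s) (hd : 1 < d) : energyConst s d ≤ 1 / d ^ 2 := by
  unfold energyConst
  gcongr
  nlinarith [sq_nonneg d]

lemma FactorGraph.abs_degree_le (h : FactorGraph s d w) (i : Fin p) : |KSGL.degree w i| ≤ d := by
  rw [abs_of_nonneg (degree_nonneg h.nonneg i)]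
  exact (h.degree i).2

lemma FactorGraph.absFormBound_adj (h : FactorGraph s d w) : AbsFormBound (adj w) d :=
  absFormBound_adj_of_abs_le (fun e => (abs_of_nonneg (h.nonneg e)).le) fun i => (h.degree i).2

lemma FactorGraph.absFormBound_adj_smul (h : FactorGraph s d w) (hd : 0 ≤ d) {x : Edge p → ℝ}
    (hx : ∀ e, |x e| ≤ w e) {κ k : ℝ} (hκ : |κ| ≤ k) : AbsFormBound (adj (κ • x)) (k * d) := by
  refine (absFormBound_adj_of_abs_le (w := |κ| • w) (d := |κ| * d) (fun e => ?_) fun i => ?_).mono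
    (mul_le_mul_of_nonneg_right hκ hd)
  · rw [Pi.smul_apply, Pi.smul_apply, smul_eq_mul, smul_eq_mul, abs_mul]
    exact mul_le_mul_of_nonneg_left (hx e) (abs_nonneg κ)
  · rw [degree_smul]
    exact mul_le_mul_of_nonneg_left (h.degree i).2 (abs_nonneg κ)

lemma FactorGraph.le (h : FactorGraph s d w) (e : Edge p) : w e ≤ d :=
  (le_degree h.nonneg e).trans (h.degree _).2

lemma FactorGraph.div_le_sum (h : FactorGraph s d w) : p / (2 * d) ≤ ∑ e, w e := by
  have h_degree : (p : ℝ) * (1 / d) ≤ ∑ i, KSGL.degree w i := by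
    simpa using Finset.sum_le_sum fun i (_ : i ∈ Finset.univ) => (h.degree i).1
  rw [sum_degree] at h_degree
  calc p / (2 * d) = p * (1 / d) / 2 := by ring
    _ ≤ ∑ e, w e := by linarith

lemma FactorGraph.sum_le (h : FactorGraph s d w) : ∑ e, w e ≤ d * p / 2 := by
  have h_degree : ∑ i, KSGL.degree w i ≤ p * d := by
    simpa using Finset.sum_le_sum fun i (_ : i ∈ Finset.univ) => (h.degree i).2
  rw [sum_degree] at h_degree
  linarith

lemma FactorGraph.sum_pos (h : FactorGraph s d w) (hp : 0 < p) (hd : 0 < d) : 0 < ∑ e, w e := by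
  have : (0 : ℝ) < p := by exact_mod_cast hp
  exact (show 0 < p / (2 * d) by positivity).trans_le h.div_le_sum

lemma FactorGraph.sq_sum_le (h : FactorGraph s d w) {x : Edge p → ℝ} (hx : ∀ e, |x e| ≤ w e) :
    (∑ e, x e) ^ 2 ≤ s * p * (x ⬝ᵥ x) := by
  classical
  set F := Finset.univ.filter fun e => w e ≠ 0
  have h_zero : ∀ e, e ∉ F → x e = 0 := fun e he => by
    have hw : w e = 0 := by simpa [F] using he
    exact abs_nonpos_iff.1 (hw ▸ hx e)
  rw [← Finset.sum_subset (Finset.subset_univ F) fun e _ he => h_zero e he]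
  calc (∑ e ∈ F, x e) ^ 2 ≤ F.card * ∑ e ∈ F, x e ^ 2 := sq_sum_le_card_mul_sum_sq
    _ ≤ F.card * (x ⬝ᵥ x) := by
        gcongr
        simp only [dotProduct, ← sq]
        exact Finset.sum_le_univ_sum_of_nonneg fun _ => sq_nonneg _
    _ ≤ s * p * (x ⬝ᵥ x) := mul_le_mul_of_nonneg_right h.sparse (dotProduct_self_nonneg x)

lemma FactorGraph.le_dotProduct_self (h : FactorGraph s d w) (hp : 0 < p) (hs : 1 ≤ s)
    (hd : 1 < d) : energyConst s d * p ≤ w ⬝ᵥ w := by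
  have : (0 : ℝ) < p := by exact_mod_cast hp
  refine le_of_mul_le_mul_left ?_ (show 0 < s * p by positivity)
  calc s * p * (energyConst s d * p) = (p / (2 * d)) ^ 2 := by
        unfold energyConst; field_simp; norm_num
    _ ≤ (∑ e, w e) ^ 2 := pow_le_pow_left₀ (by positivity) h.div_le_sum 2
    _ ≤ s * p * (w ⬝ᵥ w) := h.sq_sum_le fun e => (abs_of_nonneg (h.nonneg e)).le

lemma FactorGraph.le_degree_dotProduct_self (h : FactorGraph s d w) (hs : 1 ≤ s) (hd : 1 < d) :
    energyConst s d * p ≤ KSGL.degree w ⬝ᵥ KSGL.degree w := by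
  have h_entry : ∀ i, 1 / d ^ 2 ≤ KSGL.degree w i * KSGL.degree w i := fun i => by
    rw [← sq, ← _root_.one_div_pow]
    exact pow_le_pow_left₀ (by positivity) (h.degree i).1 2
  calc energyConst s d * p ≤ 1 / d ^ 2 * p := by
        gcongr
        exact energyConst_le_one_div_sq hs hd
    _ = ∑ _ : Fin p, 1 / d ^ 2 := by simp [mul_comm]
    _ ≤ KSGL.degree w ⬝ᵥ KSGL.degree w := Finset.sum_le_sum fun i _ => h_entry i

end FactorGraph

section Divergence

variable {p₁ p₂ : ℕ} {s₁ s₂ s d z : ℝ} {w₁ v₁ : Edge p₁ → ℝ} {w₂ v₂ : Edge p₂ → ℝ}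

lemma TrueGraphs.factor₁ (h : TrueGraphs s₁ s₂ d z w₁ w₂) : FactorGraph s₁ d w₁ :=
  ⟨h.nonneg₁, h.sparse₁, h.degree₁⟩

lemma TrueGraphs.factor₂ (h : TrueGraphs s₁ s₂ d z w₁ w₂) : FactorGraph s₂ d w₂ :=
  ⟨h.nonneg₂, h.sparse₂, h.degree₂⟩

lemma TrueGraphs.mono {s₁' s₂' : ℝ} (h : TrueGraphs s₁ s₂ d z w₁ w₂) (h₁ : s₁ ≤ s₁')
    (h₂ : s₂ ≤ s₂') : TrueGraphs s₁' s₂' d z w₁ w₂ :=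
  { h with
    sparse₁ := h.sparse₁.trans (by gcongr)
    sparse₂ := h.sparse₂.trans (by gcongr) }

/-- The Gaussian divergence between the precision matrices `L(w₁, w₂) + J` and `L(v₁, v₂) + J`;
adding the averaging matrix `J` makes both of them invertible. -/
noncomputable def divergence (w₁ v₁ : Edge p₁ → ℝ) (w₂ v₂ : Edge p₂ → ℝ) : ℝ :=
  logDetDivergence (kronLaplacian w₁ w₂ + avgMatrix (Fin p₁ × Fin p₂))
    (kronLaplacian v₁ v₂ + avgMatrix (Fin p₁ × Fin p₂))

/-- Radius of the test matrices: it keeps every test below `1 / (2 z)` in quadratic form. -/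
noncomputable def testRadius (d z : ℝ) : ℝ := 1 / (4 * z ^ 2 * d ^ 2)

lemma testRadius_pos (hd : 1 < d) (hz : 1 < z) : 0 < testRadius d z := by
  unfold testRadius; positivity

lemma sq_mul_testRadius_le (hd : 1 < d) (hz : 1 < z) : z ^ 2 * testRadius d z ≤ 1 / 4 := by
  calc z ^ 2 * testRadius d z = 1 / 4 * (1 / d ^ 2) := by unfold testRadius; field_simp
    _ ≤ 1 / 4 * 1 := by
        gcongr
        rw [div_le_one (by positivity)]
        exact one_le_pow₀ hd.le
    _ = 1 / 4 := mul_one _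

lemma testRadius_mul_sq_le (hd : 1 < d) (hz : 1 < z) :
    2 * testRadius d z * d * d ≤ 1 / (2 * z) := by
  calc 2 * testRadius d z * d * d = 1 / (2 * z) * (1 / z) := by
        unfold testRadius; field_simp; norm_num
    _ ≤ 1 / (2 * z) * 1 := by
        gcongr
        exact (div_le_one (by positivity)).2 hz.le
    _ = 1 / (2 * z) := mul_one _

lemma testRadius_mul_le (hd : 1 < d) (hz : 1 < z) : 2 * testRadius d z * d ≤ 1 / (2 * z) := by
  refine le_trans ?_ (testRadius_mul_sq_le hd hz)
  have hk := testRadius_pos hd hz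
  exact le_mul_of_one_le_right (by positivity) hd.le

lemma TrueGraphs.trace_test_le (h : TrueGraphs s₁ s₂ d z w₁ w₂) (hz : 1 < z)
    (hv : Feasible v₁ v₂) {V : Matrix (Fin p₁ × Fin p₂) (Fin p₁ × Fin p₂) ℝ} (hV : Vᵀ = V)
    {c : ℝ} (hVc : AbsFormBound V c) (hc : c ≤ 1 / (2 * z)) :
    (V * kronLaplacian v₁ v₂).trace - (V * kronLaplacian w₁ w₂).trace ≤
      divergence w₁ v₁ w₂ v₂ + z ^ 2 * (V * V).trace := by
  have h_test := trace_mul_sub_le_logDetDivergence (V := V) (by linarith) (h.posDef hz) hv.2.2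
    (h.dotProduct_mulVec_le hz) hV fun ξ => (hVc.abs_dotProduct_mulVec_le ξ).trans
      (mul_le_mul_of_nonneg_right hc (dotProduct_self_nonneg ξ))
  rwa [add_sub_add_right_eq_sub, mul_sub, trace_sub] at h_test

lemma TrueGraphs.divergence_nonneg (h : TrueGraphs s₁ s₂ d z w₁ w₂) (hz : 1 < z)
    (hv : Feasible v₁ v₂) : 0 ≤ divergence w₁ v₁ w₂ v₂ := by
  have h_test := h.trace_test_le hz hv (V := 0) (c := 0) (by simp) (by intro f g _ _; simp)
    (by positivity)
  simpa using h_test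

lemma TrueGraphs.rankOneTest_degree (h : TrueGraphs s₁ s₂ d z w₁ w₂) (hz : 1 < z)
    (hv : Feasible v₁ v₂) {x : Fin p₁ → ℝ} {y : Fin p₂ → ℝ} {a b : ℝ} (hx : ∀ i, |x i| ≤ a)
    (hy : ∀ j, |y j| ≤ b) (hb : 0 ≤ b) (hab : a * b ≤ 1 / (2 * z)) :
    RankOneTest (divergence w₁ v₁ w₂ v₂) (z ^ 2) (degree w₁) (degree v₁) (degree w₂) (degree v₂)
      x y := by
  have h_symm : (diagonal x ⊗ₖ diagonal y)ᵀ = diagonal x ⊗ₖ diagonal y := by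
    rw [← kroneckerMap_transpose, diagonal_transpose, diagonal_transpose]
  have h_test := h.trace_test_le hz hv h_symm
    ((absFormBound_diagonal hx).kronecker (absFormBound_diagonal hy) hb) hab
  rwa [trace_kron_diagonal_mul_kronLaplacian, trace_kron_diagonal_mul_kronLaplacian,
    ← mul_kronecker_mul, trace_kronecker, diagonal_mul_diagonal, diagonal_mul_diagonal,
    trace_diagonal, trace_diagonal] at h_test

lemma TrueGraphs.rankOneTest_weight (h : TrueGraphs s₁ s₂ d z w₁ w₂) (hz : 1 < z)
    (hv : Feasible v₁ v₂) {x : Edge p₁ → ℝ} {y : Edge p₂ → ℝ} {a b : ℝ}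
    (hx : AbsFormBound (adj x) a) (hy : AbsFormBound (adj y) b) (hb : 0 ≤ b)
    (hab : a * b ≤ 1 / (2 * z)) :
    RankOneTest (divergence w₁ v₁ w₂ v₂) (z ^ 2) w₁ v₁ w₂ v₂ x y := by
  have h_symm : (-(adj x ⊗ₖ adj y))ᵀ = -(adj x ⊗ₖ adj y) := by
    rw [transpose_neg, ← kroneckerMap_transpose, adj_transpose, adj_transpose]
  have h_test := h.trace_test_le hz hv h_symm (hx.kronecker hy hb).neg hab
  rw [neg_mul, neg_mul, neg_mul_neg, trace_neg, trace_neg, trace_kron_adj_mul_kronLaplacian,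
    trace_kron_adj_mul_kronLaplacian, ← mul_kronecker_mul, trace_kronecker, trace_adj_mul_adj,
    trace_adj_mul_adj] at h_test
  simp only [RankOneTest, dotProduct]
  linarith [h.divergence_nonneg hz hv]

lemma TrueGraphs.rankOneTests_degree (h : TrueGraphs s₁ s₂ d z w₁ w₂) (hd : 1 < d) (hz : 1 < z)
    (hv : Feasible v₁ v₂) :
    RankOneTests (divergence w₁ v₁ w₂ v₂) (z ^ 2) (testRadius d z) (degree w₁) (degree v₁)
      (degree w₂) (degree v₂) := by
  have hk := (testRadius_pos hd hz).le
  have h_abs : ∀ {p : ℕ} {x : Fin p → ℝ}, x ⬝ᵥ x ≤ testRadius d z ^ 2 →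
      ∀ i, |x i| ≤ 2 * testRadius d z := fun {p x} hx i => by
    have h_entry : x i ^ 2 ≤ x ⬝ᵥ x := by
      rw [sq]
      exact Finset.single_le_sum (fun j _ => mul_self_nonneg (x j)) (Finset.mem_univ i)
    linarith [abs_le_of_sq_le_sq (h_entry.trans hx) hk]
  refine ⟨fun κ hκ => ?_, fun x hx => ?_, fun y hy => ?_⟩
  · refine h.rankOneTest_degree hz hv (fun i => ?_) h.factor₂.abs_degree_le (by positivity)
      (testRadius_mul_sq_le hd hz)
    rw [Pi.smul_apply, smul_eq_mul, abs_mul]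
    exact mul_le_mul (by linarith) (h.factor₁.abs_degree_le i) (abs_nonneg _) (by positivity)
  · exact h.rankOneTest_degree hz hv (h_abs hx) h.factor₂.abs_degree_le (by positivity)
      (testRadius_mul_le hd hz)
  · refine h.rankOneTest_degree hz hv h.factor₁.abs_degree_le (h_abs hy) (by positivity) ?_
    linarith [testRadius_mul_le hd hz]

lemma TrueGraphs.rankOneTest_smul_weight (h : TrueGraphs s₁ s₂ d z w₁ w₂) (hd : 1 < d)
    (hz : 1 < z) (hv : Feasible v₁ v₂) {x : Edge p₁ → ℝ} {y : Edge p₂ → ℝ} {κ : ℝ}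
    (hκ : |κ| ≤ testRadius d z) (hx : ∀ e, |x e| ≤ w₁ e) (hy : ∀ e, |y e| ≤ w₂ e) :
    RankOneTest (divergence w₁ v₁ w₂ v₂) (z ^ 2) w₁ v₁ w₂ v₂ (κ • x) y := by
  have hk := (testRadius_pos hd hz).le
  refine h.rankOneTest_weight hz hv (h.factor₁.absFormBound_adj_smul (by positivity) hx
    (show |κ| ≤ 2 * testRadius d z by linarith))
    (absFormBound_adj_of_abs_le hy fun j => (h.degree₂ j).2) (by positivity)
    (testRadius_mul_sq_le hd hz)

lemma TrueGraphs.rankOneTests_weight (h : TrueGraphs s₁ s₂ d z w₁ w₂) (hd : 1 < d) (hz : 1 < z)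
    (hv : Feasible v₁ v₂) :
    RankOneTests (divergence w₁ v₁ w₂ v₂) (z ^ 2) (testRadius d z) w₁ v₁ w₂ v₂ := by
  have hk := (testRadius_pos hd hz).le
  have h_bound : ∀ {p : ℕ} {x : Edge p → ℝ}, x ⬝ᵥ x ≤ testRadius d z ^ 2 →
      AbsFormBound (adj x) (2 * testRadius d z) := fun {p x} hx => by
    refine (absFormBound_adj x).mono ((Real.sqrt_le_left (by positivity)).2 ?_)
    simp only [dotProduct, ← sq] at hx
    nlinarith
  refine ⟨fun κ hκ => ?_, fun x hx => ?_, fun y hy => ?_⟩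
  · exact h.rankOneTest_smul_weight hd hz hv hκ (fun e => (abs_of_nonneg (h.nonneg₁ e)).le)
      fun e => (abs_of_nonneg (h.nonneg₂ e)).le
  · exact h.rankOneTest_weight hz hv (h_bound hx) h.factor₂.absFormBound_adj (by positivity)
      (testRadius_mul_le hd hz)
  · refine h.rankOneTest_weight hz hv h.factor₁.absFormBound_adj (h_bound hy) (by positivity) ?_
    linarith [testRadius_mul_le hd hz]

lemma TrueGraphs.total_weight_test (h : TrueGraphs s₁ s₂ d z w₁ w₂) (hd : 1 < d) (hz : 1 < z)
    (hv : Feasible v₁ v₂) {κ : ℝ} (hκ : |κ| ≤ testRadius d z) :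
    κ * (4 * ((∑ e, v₁ e) * ∑ e, v₂ e - (∑ e, w₁ e) * ∑ e, w₂ e)) ≤
      divergence w₁ v₁ w₂ v₂ + z ^ 2 * (p₁ * p₂) * κ ^ 2 := by
  have hk := testRadius_pos hd hz
  have h_radius : testRadius d z * 1 ≤ 1 / (2 * z) := by
    refine le_trans ?_ (testRadius_mul_le hd hz)
    nlinarith
  have h_test := h.rankOneTest_degree hz hv (x := fun _ => κ) (y := fun _ => 1) (fun _ => hκ)
    (fun _ => abs_one.le) zero_le_one h_radius
  simp only [RankOneTest, dotProduct, ← Finset.mul_sum, one_mul, sum_degree, Finset.sum_const,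
    Finset.card_univ, Fintype.card_fin, nsmul_eq_mul, mul_one] at h_test
  linarith

end Divergence

section Localized

variable {p₁ p₂ : ℕ} {s₁ s₂ s d z : ℝ} {w₁ v₁ : Edge p₁ → ℝ} {w₂ v₂ : Edge p₂ → ℝ}

lemma Feasible.smul_smul_inv {t : ℝ} (ht : 0 < t) (hv : Feasible v₁ v₂) :
    Feasible (t • v₁) (t⁻¹ • v₂) :=
  ⟨fun e => mul_nonneg ht.le (hv.1 e), fun e => mul_nonneg (inv_pos.2 ht).le (hv.2.1 e), by
    rw [kronLaplacian_smul_smul_inv ht.ne']; exact hv.2.2⟩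

lemma divergence_smul_smul_inv {t : ℝ} (ht : t ≠ 0) :
    divergence w₁ (t • v₁) w₂ (t⁻¹ • v₂) = divergence w₁ v₁ w₂ v₂ := by
  simp only [divergence, kronLaplacian_smul_smul_inv ht]

/-- Divergence per vertex of the product graph below which the tests of radius `testRadius d z`
are effective. -/
noncomputable def localRadius (s d z : ℝ) : ℝ :=
  (z * testRadius d z * energyConst s d) ^ 2

lemma localRadius_pos (hs : 1 ≤ s) (hd : 1 < d) (hz : 1 < z) : 0 < localRadius s d z := by
  have hk := testRadius_pos hd hz
  have hβ := energyConst_pos hs hd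
  unfold localRadius
  positivity

/-- The feasible pair `(v₁, v₂)` lies in the neighbourhood of the true factor graphs `(w₁, w₂)` in
which the divergence controls the distance. -/
structure Localized (s d z : ℝ) {p₁ p₂ : ℕ} (w₁ v₁ : Edge p₁ → ℝ) (w₂ v₂ : Edge p₂ → ℝ) :
    Prop where
  truth : TrueGraphs s s d z w₁ w₂
  feasible : Feasible v₁ v₂
  small : divergence w₁ v₁ w₂ v₂ ≤ localRadius s d z * (p₁ * p₂)

lemma Localized.smul_smul_inv {t : ℝ} (h : Localized s d z w₁ v₁ w₂ v₂) (ht : 0 < t) :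
    Localized s d z w₁ (t • v₁) w₂ (t⁻¹ • v₂) :=
  ⟨h.truth, h.feasible.smul_smul_inv ht, by
    rw [divergence_smul_smul_inv ht.ne']; exact h.small⟩

lemma TrueGraphs.le_dotProduct_self₁ (h : TrueGraphs s s d z w₁ w₂) (hs : 1 ≤ s) (hd : 1 < d) :
    energyConst s d * p₁ ≤ w₁ ⬝ᵥ w₁ :=
  h.factor₁.le_dotProduct_self (zero_lt_one.trans (h.one_lt (by linarith)).1) hs hd

lemma TrueGraphs.le_dotProduct_self₂ (h : TrueGraphs s s d z w₁ w₂) (hs : 1 ≤ s) (hd : 1 < d) :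
    energyConst s d * p₂ ≤ w₂ ⬝ᵥ w₂ :=
  h.factor₂.le_dotProduct_self (zero_lt_one.trans (h.one_lt (by linarith)).2) hs hd

lemma TrueGraphs.energyConst_mul_pos (h : TrueGraphs s s d z w₁ w₂) (hs : 1 ≤ s) (hd : 1 < d) :
    0 < energyConst s d * p₁ ∧ 0 < energyConst s d * p₂ := by
  obtain ⟨hp₁, hp₂⟩ := h.one_lt (by linarith)
  have hβ := energyConst_pos hs hd
  constructor <;> positivity

lemma Localized.divergence_le (h : Localized s d z w₁ v₁ w₂ v₂) (hs : 1 ≤ s) (hd : 1 < d)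
    {U V : ℝ} (hU : energyConst s d * p₁ ≤ U) (hV : energyConst s d * p₂ ≤ V) :
    divergence w₁ v₁ w₂ v₂ ≤ z ^ 2 * (U * V) * testRadius d z ^ 2 := by
  obtain ⟨h₁, h₂⟩ := h.truth.energyConst_mul_pos hs hd
  have hU_nonneg : 0 ≤ U := h₁.le.trans hU
  calc divergence w₁ v₁ w₂ v₂ ≤ localRadius s d z * (p₁ * p₂) := h.small
    _ = z ^ 2 * ((energyConst s d * p₁) * (energyConst s d * p₂)) * testRadius d z ^ 2 := by
        unfold localRadius; ring
    _ ≤ z ^ 2 * (U * V) * testRadius d z ^ 2 := by gcongr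

lemma Localized.divergence_le_weight (h : Localized s d z w₁ v₁ w₂ v₂) (hs : 1 ≤ s)
    (hd : 1 < d) :
    divergence w₁ v₁ w₂ v₂ ≤ z ^ 2 * ((w₁ ⬝ᵥ w₁) * (w₂ ⬝ᵥ w₂)) * testRadius d z ^ 2 :=
  h.divergence_le hs hd (h.truth.le_dotProduct_self₁ hs hd) (h.truth.le_dotProduct_self₂ hs hd)

lemma Localized.half_le_inner (h : Localized s d z w₁ v₁ w₂ v₂) (hs : 1 ≤ s) (hd : 1 < d)
    (hz : 1 < z) : (w₁ ⬝ᵥ w₁) * (w₂ ⬝ᵥ w₂) / 2 ≤ (w₁ ⬝ᵥ v₁) * (w₂ ⬝ᵥ v₂) := by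
  obtain ⟨h₁, h₂⟩ := h.truth.energyConst_mul_pos hs hd
  exact (h.truth.rankOneTests_weight hd hz h.feasible).half_le_inner (testRadius_pos hd hz)
    (by positivity) (sq_mul_testRadius_le hd hz) (h₁.trans_le (h.truth.le_dotProduct_self₁ hs hd))
    (h₂.trans_le (h.truth.le_dotProduct_self₂ hs hd)) (h.divergence_le_weight hs hd)

lemma Localized.inner_sub_sq_le (h : Localized s d z w₁ v₁ w₂ v₂) (hs : 1 ≤ s) (hd : 1 < d)
    (hz : 1 < z) :
    ((w₁ ⬝ᵥ v₁) * (w₂ ⬝ᵥ v₂) - (w₁ ⬝ᵥ w₁) * (w₂ ⬝ᵥ w₂)) ^ 2 ≤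
      4 * (z ^ 2 * ((w₁ ⬝ᵥ w₁) * (w₂ ⬝ᵥ w₂))) * divergence w₁ v₁ w₂ v₂ := by
  obtain ⟨h₁, h₂⟩ := h.truth.energyConst_mul_pos hs hd
  have hW₁ := h₁.trans_le (h.truth.le_dotProduct_self₁ hs hd)
  have hW₂ := h₂.trans_le (h.truth.le_dotProduct_self₂ hs hd)
  exact (h.truth.rankOneTests_weight hd hz h.feasible).inner_sub_sq_le (testRadius_pos hd hz)
    (by positivity) (h.divergence_le_weight hs hd)

lemma Localized.abs_sum_mul_sum_sub_le (h : Localized s d z w₁ v₁ w₂ v₂) (hs : 1 ≤ s)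
    (hd : 1 < d) (hz : 1 < z) :
    |(∑ e, v₁ e) * (∑ e, v₂ e) - (∑ e, w₁ e) * ∑ e, w₂ e| ≤
      z / 2 * (√p₁ * √p₂) * √(divergence w₁ v₁ w₂ v₂) := by
  obtain ⟨hp₁, hp₂⟩ := h.truth.one_lt (by linarith)
  have hD := h.truth.divergence_nonneg hz h.feasible
  have hβ : energyConst s d ≤ 1 := (energyConst_le_one_div_sq hs hd).trans
    ((div_le_one (by positivity)).2 (one_le_pow₀ hd.le))
  have h_sq := sq_le_of_forall_mul_le (by positivity) (testRadius_pos hd hz)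
    (fun κ hκ => h.truth.total_weight_test hd hz h.feasible hκ)
    (h.divergence_le hs hd (mul_le_of_le_one_left p₁.cast_nonneg hβ)
      (mul_le_of_le_one_left p₂.cast_nonneg hβ))
  refine abs_le_of_sq_le_sq ?_ (by positivity)
  rw [mul_pow, mul_pow, mul_pow, Real.sq_sqrt hD, Real.sq_sqrt p₁.cast_nonneg,
    Real.sq_sqrt p₂.cast_nonneg]
  linarith

/-- The constant of the `ℓ¹` bounds for the positive parts `(wᵢ - vᵢ)⁺`. -/
noncomputable def posPartConst (s d z : ℝ) : ℝ :=
  √(24 * s / (testRadius d z * energyConst s d))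

lemma posPartConst_sq_mul (hs : 1 ≤ s) (hd : 1 < d) (hz : 1 < z) :
    posPartConst s d z ^ 2 * energyConst s d = s * (24 / testRadius d z) := by
  have hk := testRadius_pos hd hz
  have hβ := energyConst_pos hs hd
  rw [posPartConst, Real.sq_sqrt (by positivity)]
  field_simp

lemma Localized.sum_posPart_left_le (h : Localized s d z w₁ v₁ w₂ v₂) (hs : 1 ≤ s) (hd : 1 < d)
    (hz : 1 < z) (hnorm : w₂ ⬝ᵥ v₂ = w₂ ⬝ᵥ w₂) :
    √p₂ * ∑ e, (w₁ - v₁)⁺ e ≤ posPartConst s d z * √p₁ * √(divergence w₁ v₁ w₂ v₂) := by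
  have hk := testRadius_pos hd hz
  have hD := h.truth.divergence_nonneg hz h.feasible
  have h_abs := abs_posPart_sub_le h.feasible.1 h.truth.nonneg₁
  refine mul_sum_le_of_sq_sum_le (Real.sqrt_nonneg _) (Real.sqrt_nonneg _)
    (energyConst_pos hs hd) (zero_le_one.trans hs) (Real.sqrt_nonneg _)
    (posPartConst_sq_mul hs hd hz) ?_ ?_ ?_ (W := w₂ ⬝ᵥ w₂)
  · rw [Real.sq_sqrt p₁.cast_nonneg]
    exact h.truth.factor₁.sq_sum_le h_abs
  · rw [Real.sq_sqrt p₂.cast_nonneg]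
    exact h.truth.le_dotProduct_self₂ hs hd
  · rw [Real.sq_sqrt hD]
    refine RankOneTest.posPart_left_le (h.truth.rankOneTest_smul_weight hd hz h.feasible ?_ h_abs
      fun e => (abs_of_nonneg (h.truth.nonneg₂ e)).le) hk (sq_mul_testRadius_le hd hz) hnorm hD
    rw [abs_neg, abs_of_pos hk]

lemma Localized.half_le_inner_left (h : Localized s d z w₁ v₁ w₂ v₂) (hs : 1 ≤ s) (hd : 1 < d)
    (hz : 1 < z) (hnorm : w₂ ⬝ᵥ v₂ = w₂ ⬝ᵥ w₂) : w₁ ⬝ᵥ w₁ / 2 ≤ w₁ ⬝ᵥ v₁ := by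
  have h_half := h.half_le_inner hs hd hz
  rw [hnorm] at h_half
  have hW₂ := (h.truth.energyConst_mul_pos hs hd).2.trans_le (h.truth.le_dotProduct_self₂ hs hd)
  refine le_of_mul_le_mul_right ?_ hW₂
  linarith

lemma Localized.sum_posPart_right_le (h : Localized s d z w₁ v₁ w₂ v₂) (hs : 1 ≤ s) (hd : 1 < d)
    (hz : 1 < z) (hnorm : w₂ ⬝ᵥ v₂ = w₂ ⬝ᵥ w₂) :
    √p₁ * ∑ e, (w₂ - v₂)⁺ e ≤ posPartConst s d z * √p₂ * √(divergence w₁ v₁ w₂ v₂) := by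
  have hk := testRadius_pos hd hz
  have hD := h.truth.divergence_nonneg hz h.feasible
  have h_abs := abs_posPart_sub_le h.feasible.2.1 h.truth.nonneg₂
  have h_inner := h.inner_sub_sq_le hs hd hz
  rw [hnorm, ← sub_mul] at h_inner
  have hW₂ := (h.truth.energyConst_mul_pos hs hd).2.trans_le (h.truth.le_dotProduct_self₂ hs hd)
  refine mul_sum_le_of_sq_sum_le (Real.sqrt_nonneg _) (Real.sqrt_nonneg _)
    (energyConst_pos hs hd) (zero_le_one.trans hs) (Real.sqrt_nonneg _)
    (posPartConst_sq_mul hs hd hz) ?_ ?_ ?_ (W := w₁ ⬝ᵥ w₁)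
  · rw [Real.sq_sqrt p₂.cast_nonneg]
    exact h.truth.factor₂.sq_sum_le h_abs
  · rw [Real.sq_sqrt p₁.cast_nonneg]
    exact h.truth.le_dotProduct_self₁ hs hd
  · rw [Real.sq_sqrt hD]
    refine RankOneTest.posPart_right_le (h.truth.rankOneTest_smul_weight hd hz h.feasible ?_
      (fun e => (abs_of_nonneg (h.truth.nonneg₁ e)).le) h_abs) hk (by positivity)
      (sq_mul_testRadius_le hd hz) hD hW₂ (h.half_le_inner_left hs hd hz hnorm) h_inner
    rw [abs_neg, abs_of_pos hk]

lemma dotProduct_le_mul_sum {ι : Type*} [Fintype ι] {w v : ι → ℝ} (hw : ∀ e, w e ≤ d)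
    (hv : ∀ e, 0 ≤ v e) : w ⬝ᵥ v ≤ d * ∑ e, v e := by
  rw [Finset.mul_sum]
  exact Finset.sum_le_sum fun e _ => mul_le_mul_of_nonneg_right (hw e) (hv e)

lemma mul_sub_add_le_of_mul_sub_mul_le {A B T β c n₁ n₂ q₁ q₂ x₁ x₂ : ℝ} (hA : 0 < A)
    (hB : 0 < B) (hT : 0 ≤ T) (hz : 0 < z) (hd : 0 < d) (hβ : 0 < β) (hc : 0 ≤ c)
    (hQ : n₁ * n₂ - q₁ * q₂ ≤ z / 2 * (A * B) * T) (hn₂ : β * B ^ 2 ≤ 2 * d * n₂)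
    (hq₁ : q₁ ≤ d * A ^ 2 / 2) (hq₁_nonneg : 0 ≤ q₁) (hx₂_nonneg : 0 ≤ x₂)
    (hqn : q₂ - n₂ ≤ x₂) (hx₁ : B * x₁ ≤ c * A * T) (hx₂ : A * x₂ ≤ c * B * T) :
    B * (n₁ - q₁ + 2 * x₁) ≤ (d * (z + d * c) / β + 2 * c) * A * T := by
  have hn₂_pos : 0 < n₂ := by
    refine pos_of_mul_pos_right (lt_of_lt_of_le ?_ hn₂) (by positivity)
    positivity
  have h_cross : q₁ * (q₂ - n₂) ≤ d / 2 * A * (c * B * T) := by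
    calc q₁ * (q₂ - n₂) ≤ q₁ * x₂ := by gcongr
      _ ≤ d * A ^ 2 / 2 * x₂ := by gcongr
      _ = d / 2 * A * (A * x₂) := by ring
      _ ≤ d / 2 * A * (c * B * T) := by gcongr
  have h_sub : B * (n₁ - q₁) ≤ d * (z + d * c) / β * A * T := by
    refine le_of_mul_le_mul_right ?_ hn₂_pos
    calc B * (n₁ - q₁) * n₂ = B * ((n₁ * n₂ - q₁ * q₂) + q₁ * (q₂ - n₂)) := by ring
      _ ≤ B * (z / 2 * (A * B) * T + d / 2 * A * (c * B * T)) := by gcongr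
      _ = (z + d * c) / (2 * β) * A * T * (β * B ^ 2) := by field_simp
      _ ≤ (z + d * c) / (2 * β) * A * T * (2 * d * n₂) := by gcongr
      _ = d * (z + d * c) / β * A * T * n₂ := by field_simp
  linarith

/-- The constant of the `ℓ¹` bounds for the deviations `vᵢ - wᵢ`. -/
noncomputable def deviationConst (s d z : ℝ) : ℝ :=
  d * (z + d * posPartConst s d z) / energyConst s d + 2 * posPartConst s d z

lemma deviationConst_pos (hs : 1 ≤ s) (hd : 1 < d) (hz : 1 < z) : 0 < deviationConst s d z := by
  have hβ := energyConst_pos hs hd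
  have hc : 0 ≤ posPartConst s d z := Real.sqrt_nonneg _
  unfold deviationConst
  positivity

lemma Localized.sum_abs_sub_left_le (h : Localized s d z w₁ v₁ w₂ v₂) (hs : 1 ≤ s) (hd : 1 < d)
    (hz : 1 < z) (hnorm : w₂ ⬝ᵥ v₂ = w₂ ⬝ᵥ w₂) :
    √p₂ * ∑ e, |v₁ e - w₁ e| ≤ deviationConst s d z * √p₁ * √(divergence w₁ v₁ w₂ v₂) := by
  obtain ⟨hp₁, hp₂⟩ := h.truth.one_lt (by linarith)
  have hv₂ := dotProduct_le_mul_sum h.truth.factor₂.le h.feasible.2.1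
  rw [sum_abs_sub_eq]
  refine mul_sub_add_le_of_mul_sub_mul_le (by positivity) (by positivity) (Real.sqrt_nonneg _)
    (by positivity) (by positivity) (energyConst_pos hs hd) (Real.sqrt_nonneg _)
    (le_of_abs_le (h.abs_sum_mul_sum_sub_le hs hd hz)) ?_ ?_
    (Finset.sum_nonneg fun e _ => h.truth.nonneg₁ e) (Finset.sum_nonneg fun e _ => posPart_nonneg _)
    (sum_sub_sum_le_posPart w₂ v₂) (h.sum_posPart_left_le hs hd hz hnorm)
    (h.sum_posPart_right_le hs hd hz hnorm)
  · rw [Real.sq_sqrt p₂.cast_nonneg]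
    have hW₂ := h.truth.le_dotProduct_self₂ hs hd
    linarith [dotProduct_self_nonneg w₂]
  · rw [Real.sq_sqrt p₁.cast_nonneg]
    exact h.truth.factor₁.sum_le

lemma Localized.sum_abs_sub_right_le (h : Localized s d z w₁ v₁ w₂ v₂) (hs : 1 ≤ s) (hd : 1 < d)
    (hz : 1 < z) (hnorm : w₂ ⬝ᵥ v₂ = w₂ ⬝ᵥ w₂) :
    √p₁ * ∑ e, |v₂ e - w₂ e| ≤ deviationConst s d z * √p₂ * √(divergence w₁ v₁ w₂ v₂) := by
  obtain ⟨hp₁, hp₂⟩ := h.truth.one_lt (by linarith)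
  have hv₁ := dotProduct_le_mul_sum h.truth.factor₁.le h.feasible.1
  have hQ := le_of_abs_le (h.abs_sum_mul_sum_sub_le hs hd hz)
  rw [mul_comm (∑ e, v₁ e), mul_comm (∑ e, w₁ e), mul_comm √(p₁ : ℝ)] at hQ
  rw [sum_abs_sub_eq]
  refine mul_sub_add_le_of_mul_sub_mul_le (by positivity) (by positivity) (Real.sqrt_nonneg _)
    (by positivity) (by positivity) (energyConst_pos hs hd) (Real.sqrt_nonneg _) hQ ?_ ?_
    (Finset.sum_nonneg fun e _ => h.truth.nonneg₂ e) (Finset.sum_nonneg fun e _ => posPart_nonneg _)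
    (sum_sub_sum_le_posPart w₁ v₁) (h.sum_posPart_right_le hs hd hz hnorm)
    (h.sum_posPart_left_le hs hd hz hnorm)
  · rw [Real.sq_sqrt p₁.cast_nonneg]
    linarith [h.truth.le_dotProduct_self₁ hs hd, h.half_le_inner_left hs hd hz hnorm]
  · rw [Real.sq_sqrt p₂.cast_nonneg]
    exact h.truth.factor₂.sum_le

end Localized

section FrobeniusNorm

variable {p₁ p₂ : ℕ}

lemma frobNorm_sq {ι : Type*} [Fintype ι] (A : Matrix ι ι ℝ) :
    frobNorm A ^ 2 = ∑ i, ∑ j, A i j ^ 2 :=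
  Real.sq_sqrt (Finset.sum_nonneg fun _ _ => Finset.sum_nonneg fun _ _ => sq_nonneg _)

lemma sum_adj_mul_adj_mul_adj_mul_adj (a b : Edge p₁ → ℝ) (a' b' : Edge p₂ → ℝ) :
    ∑ x : Fin p₁ × Fin p₂, ∑ y : Fin p₁ × Fin p₂,
      (adj a x.1 y.1 * adj b x.1 y.1) * (adj a' x.2 y.2 * adj b' x.2 y.2) =
    4 * ((∑ e, a e * b e) * ∑ f, a' f * b' f) := by
  calc _ = (∑ i, ∑ i', adj a i i' * adj b i i') * ∑ j, ∑ j', adj a' j j' * adj b' j j' := by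
        simp only [Fintype.sum_prod_type, Finset.sum_mul_sum]
    _ = _ := by rw [sum_adj_mul_adj, sum_adj_mul_adj]; ring

lemma sum_adj_mul_adj_sub_sq (w₁ v₁ : Edge p₁ → ℝ) (w₂ v₂ : Edge p₂ → ℝ) :
    ∑ x : Fin p₁ × Fin p₂, ∑ y : Fin p₁ × Fin p₂,
      (adj v₁ x.1 y.1 * adj v₂ x.2 y.2 - adj w₁ x.1 y.1 * adj w₂ x.2 y.2) ^ 2 =
    4 * ∑ e, ∑ f, (v₁ e * v₂ f - w₁ e * w₂ f) ^ 2 := by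
  have h_expand : ∀ a b c d : ℝ, (a * b - c * d) ^ 2 =
      (a * a) * (b * b) - 2 * ((a * c) * (b * d)) + (c * c) * (d * d) := fun a b c d => by ring
  simp only [h_expand, Finset.sum_add_distrib, Finset.sum_sub_distrib, ← Finset.mul_sum,
    sum_adj_mul_adj_mul_adj_mul_adj]
  simp only [← Finset.sum_mul]
  ring

lemma frobNorm_kronLaplacian_sub_sq_le (w₁ v₁ : Edge p₁ → ℝ) (w₂ v₂ : Edge p₂ → ℝ) :
    frobNorm (kronLaplacian v₁ v₂ - kronLaplacian w₁ w₂) ^ 2 ≤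
      2 * ∑ i, ∑ j, (degree v₁ i * degree v₂ j - degree w₁ i * degree w₂ j) ^ 2 +
      8 * ∑ e, ∑ f, (v₁ e * v₂ f - w₁ e * w₂ f) ^ 2 := by
  have h_diag : ∑ x : Fin p₁ × Fin p₂, ∑ y : Fin p₁ × Fin p₂,
      (if x = y then degree v₁ x.1 * degree v₂ x.2 - degree w₁ x.1 * degree w₂ x.2 else 0) ^ 2 =
      ∑ i, ∑ j, (degree v₁ i * degree v₂ j - degree w₁ i * degree w₂ j) ^ 2 := by
    simp only [ite_pow, ne_eq, OfNat.ofNat_ne_zero, not_false_eq_true, zero_pow,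
      Finset.sum_ite_eq, Finset.mem_univ, if_true, Fintype.sum_prod_type]
  have h_sub_sq : ∀ a b : ℝ, (a - b) ^ 2 ≤ 2 * a ^ 2 + 2 * b ^ 2 := fun a b => by
    linarith [sq_nonneg (a + b)]
  calc frobNorm (kronLaplacian v₁ v₂ - kronLaplacian w₁ w₂) ^ 2
      ≤ ∑ x : Fin p₁ × Fin p₂, ∑ y : Fin p₁ × Fin p₂,
        (2 * (if x = y then
            degree v₁ x.1 * degree v₂ x.2 - degree w₁ x.1 * degree w₂ x.2 else 0) ^ 2 +
          2 * (adj v₁ x.1 y.1 * adj v₂ x.2 y.2 - adj w₁ x.1 y.1 * adj w₂ x.2 y.2) ^ 2) := by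
        rw [frobNorm_sq]
        refine Finset.sum_le_sum fun x _ => Finset.sum_le_sum fun y _ => ?_
        refine le_of_eq_of_le (congrArg (· ^ 2) ?_) (h_sub_sq _ _)
        rw [Matrix.sub_apply, kronLaplacian_apply, kronLaplacian_apply]
        split_ifs <;> ring
    _ = _ := by
        simp only [Finset.sum_add_distrib, ← Finset.mul_sum]
        rw [h_diag, sum_adj_mul_adj_sub_sq]
        ring

end FrobeniusNorm

section BasicInequality

variable {p₁ p₂ : ℕ} {s₁ s₂ s d z α₁ α₂ ρ : ℝ} {w₁ v₁ : Edge p₁ → ℝ} {w₂ v₂ : Edge p₂ → ℝ}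
  {S C Z : Matrix (Fin p₁ × Fin p₂) (Fin p₁ × Fin p₂) ℝ}

/-- The inequality satisfied by a minimiser `(v₁, v₂)` when the sample covariance deviates by `Z`
from the true covariance and `ρ` is the geometric mean of the penalties. -/
def BasicInequality (Z : Matrix (Fin p₁ × Fin p₂) (Fin p₁ × Fin p₂) ℝ) (ρ : ℝ)
    (w₁ v₁ : Edge p₁ → ℝ) (w₂ v₂ : Edge p₂ → ℝ) : Prop :=
  divergence w₁ v₁ w₂ v₂ ≤ (kronLaplacian w₁ w₂ * Z).trace - (kronLaplacian v₁ v₂ * Z).trace +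
    2 * ρ * (√((∑ e, w₁ e) * ∑ e, w₂ e) - √((∑ e, v₁ e) * ∑ e, v₂ e))

lemma BasicInequality.smul_smul_inv (h : BasicInequality Z ρ w₁ v₁ w₂ v₂) {t : ℝ} (ht : t ≠ 0) :
    BasicInequality Z ρ w₁ (t • v₁) w₂ (t⁻¹ • v₂) := by
  have h_sum : (∑ e, (t • v₁) e) * ∑ e, (t⁻¹ • v₂) e = (∑ e, v₁ e) * ∑ e, v₂ e := by
    simp only [Pi.smul_apply, smul_eq_mul, ← Finset.mul_sum]
    field_simp
  unfold BasicInequality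
  rw [divergence_smul_smul_inv ht, kronLaplacian_smul_smul_inv ht, h_sum]
  exact h

lemma two_mul_sqrt_mul_sqrt_le {q₁ q₂ : ℝ} (hα₁ : 0 ≤ α₁) (hα₂ : 0 ≤ α₂) (hq₁ : 0 ≤ q₁)
    (hq₂ : 0 ≤ q₂) : 2 * √(α₁ * α₂) * √(q₁ * q₂) ≤ α₁ * q₁ + α₂ * q₂ := by
  calc 2 * √(α₁ * α₂) * √(q₁ * q₂) = 2 * √(α₁ * q₁) * √(α₂ * q₂) := by
        rw [mul_assoc, mul_assoc, ← Real.sqrt_mul (by positivity), ← Real.sqrt_mul (by positivity),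
          mul_mul_mul_comm]
    _ ≤ √(α₁ * q₁) ^ 2 + √(α₂ * q₂) ^ 2 := two_mul_le_add_sq _ _
    _ = α₁ * q₁ + α₂ * q₂ := by rw [Real.sq_sqrt (by positivity), Real.sq_sqrt (by positivity)]

lemma exists_scaling_eq_two_mul_sqrt_mul_sqrt {q₁ q₂ : ℝ} (hα₁ : 0 < α₁) (hα₂ : 0 < α₂)
    (hq₁ : 0 < q₁) (hq₂ : 0 < q₂) :
    ∃ t > 0, α₁ * (t * q₁) + α₂ * (t⁻¹ * q₂) = 2 * √(α₁ * α₂) * √(q₁ * q₂) := by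
  have ha : 0 < α₁ * q₁ := by positivity
  have : 0 < α₂ * q₂ := by positivity
  refine ⟨√(α₂ * q₂) / √(α₁ * q₁), by positivity, ?_⟩
  rw [mul_assoc 2, ← Real.sqrt_mul (by positivity) (q₁ * q₂), mul_mul_mul_comm,
    Real.sqrt_mul ha.le, inv_div]
  calc _ = √(α₂ * q₂) / √(α₁ * q₁) * (α₁ * q₁) + √(α₁ * q₁) / √(α₂ * q₂) * (α₂ * q₂) := by ring
    _ = √(α₂ * q₂) * √(α₁ * q₁) + √(α₁ * q₁) * √(α₂ * q₂) := by
        rw [div_mul_eq_mul_div, mul_div_assoc, Real.div_sqrt, div_mul_eq_mul_div, mul_div_assoc,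
          Real.div_sqrt]
    _ = _ := by ring

lemma TrueGraphs.sum_pos (h : TrueGraphs s₁ s₂ d z w₁ w₂) (hd : 0 < d) :
    0 < ∑ e, w₁ e ∧ 0 < ∑ e, w₂ e :=
  ⟨h.factor₁.sum_pos (zero_lt_one.trans (h.one_lt hd).1) hd,
    h.factor₂.sum_pos (zero_lt_one.trans (h.one_lt hd).2) hd⟩

lemma TrueGraphs.trace_mul_moorePenrose (h : TrueGraphs s₁ s₂ d z w₁ w₂) (hz : 1 < z)
    (hC : IsMoorePenroseInverse (kronLaplacian w₁ w₂) C) (x₁ : Edge p₁ → ℝ) (x₂ : Edge p₂ → ℝ) :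
    (kronLaplacian x₁ x₂ * C).trace =
      ((kronLaplacian w₁ w₂ + avgMatrix (Fin p₁ × Fin p₂))⁻¹ * kronLaplacian x₁ x₂).trace := by
  have := h.nonempty
  rw [h.moorePenrose_eq hz hC, mul_sub, kronLaplacian_mul_avgMatrix, sub_zero, trace_mul_comm]

lemma IsPenalizedMLE.basicInequality (hv : IsPenalizedMLE α₁ α₂ S v₁ v₂) (hα₁ : 0 < α₁)
    (hα₂ : 0 < α₂) (h : TrueGraphs s₁ s₂ d z w₁ w₂) (hd : 0 < d) (hz : 1 < z)
    (hC : IsMoorePenroseInverse (kronLaplacian w₁ w₂) C) :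
    BasicInequality (S - C) √(α₁ * α₂) w₁ v₁ w₂ v₂ := by
  have := h.nonempty
  obtain ⟨hq₁, hq₂⟩ := h.sum_pos hd
  obtain ⟨t, ht, h_scaling⟩ := exists_scaling_eq_two_mul_sqrt_mul_sqrt hα₁ hα₂ hq₁ hq₂
  have h_feasible := (h.feasible hz).smul_smul_inv ht
  have h_min := hv.2 _ _ h_feasible
  rw [penNegLogLik_eq _ _ _ hv.1, penNegLogLik_eq _ _ _ h_feasible,
    kronLaplacian_smul_smul_inv ht.ne'] at h_min
  simp only [Pi.smul_apply, smul_eq_mul, ← Finset.mul_sum] at h_min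
  have h_amgm := two_mul_sqrt_mul_sqrt_le (q₁ := ∑ e, v₁ e) (q₂ := ∑ e, v₂ e) hα₁.le hα₂.le
    (Finset.sum_nonneg fun e _ => hv.1.1 e) (Finset.sum_nonneg fun e _ => hv.1.2.1 e)
  rw [BasicInequality, divergence, logDetDivergence, add_sub_add_right_eq_sub, mul_sub, mul_sub,
    mul_sub, trace_sub, trace_sub, trace_sub, h.trace_mul_moorePenrose hz hC,
    h.trace_mul_moorePenrose hz hC]
  linarith

end BasicInequality

section NoiseBound

variable {p₁ p₂ : ℕ} {s d z γ σ ρ : ℝ} {w₁ v₁ : Edge p₁ → ℝ} {w₂ v₂ : Edge p₂ → ℝ}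
  {Z : Matrix (Fin p₁ × Fin p₂) (Fin p₁ × Fin p₂) ℝ}

/-- The deviation `Z` of the sample covariance has size at most `γ`, tested on edge indicators of
both factors and on products of an edge indicator with a true factor graph. -/
structure NoiseBound (Z : Matrix (Fin p₁ × Fin p₂) (Fin p₁ × Fin p₂) ℝ) (w₁ : Edge p₁ → ℝ)
    (w₂ : Edge p₂ → ℝ) (γ : ℝ) : Prop where
  left : ∀ e, |(kronLaplacian (Pi.single e 1) w₂ * Z).trace| ≤ γ * √p₂
  right : ∀ f, |(kronLaplacian w₁ (Pi.single f 1) * Z).trace| ≤ γ * √p₁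
  both : ∀ e f, |(kronLaplacian (Pi.single e 1) (Pi.single f 1) * Z).trace| ≤ γ

lemma abs_apply_le_mul_sum_abs {ι : Type*} [Fintype ι] [DecidableEq ι] (f : (ι → ℝ) →ₗ[ℝ] ℝ)
    {K : ℝ} (hf : ∀ e, |f (Pi.single e 1)| ≤ K) (x : ι → ℝ) : |f x| ≤ K * ∑ e, |x e| := by
  have hx : f x = ∑ e, f (Pi.single e (x e)) := by rw [← map_sum, Finset.univ_sum_single]
  rw [hx, Finset.mul_sum]
  refine (Finset.abs_sum_le_sum_abs _ _).trans (Finset.sum_le_sum fun e _ => ?_)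
  calc |f (Pi.single e (x e))| = |f (Pi.single e 1)| * |x e| := by
        rw [← abs_mul, mul_comm, ← smul_eq_mul, ← map_smul, ← Pi.single_smul, smul_eq_mul, mul_one]
    _ ≤ K * |x e| := mul_le_mul_of_nonneg_right (hf e) (abs_nonneg _)

/-- The pairing `(x, y) ↦ ⟨L(x, y), Z⟩` as a bilinear map. -/
noncomputable def tracePairing (Z : Matrix (Fin p₁ × Fin p₂) (Fin p₁ × Fin p₂) ℝ) :
    (Edge p₁ → ℝ) →ₗ[ℝ] (Edge p₂ → ℝ) →ₗ[ℝ] ℝ :=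
  (kronLaplacianBilin p₁ p₂).compr₂
    ((Matrix.traceLinearMap (Fin p₁ × Fin p₂) ℝ ℝ).comp (LinearMap.mulRight ℝ Z))

lemma tracePairing_apply (Z : Matrix (Fin p₁ × Fin p₂) (Fin p₁ × Fin p₂) ℝ)
    (x : Edge p₁ → ℝ) (y : Edge p₂ → ℝ) : tracePairing Z x y = (kronLaplacian x y * Z).trace := rfl

lemma NoiseBound.abs_tracePairing_left_le (h : NoiseBound Z w₁ w₂ γ) (x : Edge p₁ → ℝ) :
    |tracePairing Z x w₂| ≤ γ * √p₂ * ∑ e, |x e| :=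
  abs_apply_le_mul_sum_abs ((tracePairing Z).flip w₂) h.left x

lemma NoiseBound.abs_tracePairing_right_le (h : NoiseBound Z w₁ w₂ γ) (y : Edge p₂ → ℝ) :
    |tracePairing Z w₁ y| ≤ γ * √p₁ * ∑ f, |y f| :=
  abs_apply_le_mul_sum_abs (tracePairing Z w₁) h.right y

lemma NoiseBound.abs_tracePairing_le (h : NoiseBound Z w₁ w₂ γ) (x : Edge p₁ → ℝ)
    (y : Edge p₂ → ℝ) : |tracePairing Z x y| ≤ γ * (∑ e, |x e|) * ∑ f, |y f| :=
  abs_apply_le_mul_sum_abs (tracePairing Z x) (fun f =>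
    abs_apply_le_mul_sum_abs ((tracePairing Z).flip (Pi.single f 1)) (fun e => h.both e f) x) y

lemma NoiseBound.trace_sub_le (h : NoiseBound Z w₁ w₂ γ) (hγ : 0 ≤ γ) {c T : ℝ} (hp₁ : 0 < p₁)
    (hp₂ : 0 < p₂) (hμ : √p₂ * ∑ e, |v₁ e - w₁ e| ≤ c * √p₁ * T)
    (hν : √p₁ * ∑ f, |v₂ f - w₂ f| ≤ c * √p₂ * T) :
    (kronLaplacian w₁ w₂ * Z).trace - (kronLaplacian v₁ v₂ * Z).trace ≤
      γ * c * (√p₁ + √p₂) * T + γ * c ^ 2 * T ^ 2 := by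
  have h_split : tracePairing Z w₁ w₂ - tracePairing Z v₁ v₂ =
      -(tracePairing Z (v₁ - w₁) w₂) - tracePairing Z w₁ (v₂ - w₂) -
        tracePairing Z (v₁ - w₁) (v₂ - w₂) := by
    simp only [map_sub, LinearMap.sub_apply]; ring
  have h_left := neg_le_of_abs_le (h.abs_tracePairing_left_le (v₁ - w₁))
  have h_right := neg_le_of_abs_le (h.abs_tracePairing_right_le (v₂ - w₂))
  have h_both := neg_le_of_abs_le (h.abs_tracePairing_le (v₁ - w₁) (v₂ - w₂))
  simp only [Pi.sub_apply] at h_left h_right h_both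
  have hM_nonneg : 0 ≤ ∑ e, |v₁ e - w₁ e| := Finset.sum_nonneg fun _ _ => abs_nonneg _
  have hN_nonneg : 0 ≤ ∑ f, |v₂ f - w₂ f| := Finset.sum_nonneg fun _ _ => abs_nonneg _
  set M := ∑ e, |v₁ e - w₁ e|
  set N := ∑ f, |v₂ f - w₂ f|
  have hA : 0 < √(p₁ : ℝ) := by positivity
  have hB : 0 < √(p₂ : ℝ) := by positivity
  have h_prod : M * N ≤ c ^ 2 * T ^ 2 := by
    refine le_of_mul_le_mul_left ?_ (mul_pos hA hB)
    calc √p₁ * √p₂ * (M * N) = (√p₂ * M) * (√p₁ * N) := by ring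
      _ ≤ (c * √p₁ * T) * (c * √p₂ * T) :=
          mul_le_mul hμ hν (by positivity) ((mul_nonneg hB.le hM_nonneg).trans hμ)
      _ = √p₁ * √p₂ * (c ^ 2 * T ^ 2) := by ring
  rw [← tracePairing_apply, ← tracePairing_apply, h_split]
  linarith [mul_le_mul_of_nonneg_left hμ hγ, mul_le_mul_of_nonneg_left hν hγ,
    mul_le_mul_of_nonneg_left h_prod hγ]

end NoiseBound

section Consistency

variable {p₁ p₂ : ℕ} {s₁ s₂ s d z γ σ ρ : ℝ} {w₁ v₁ : Edge p₁ → ℝ} {w₂ v₂ : Edge p₂ → ℝ}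
  {Z : Matrix (Fin p₁ × Fin p₂) (Fin p₁ × Fin p₂) ℝ}

lemma TrueGraphs.card_le_sum_mul_sum (h : TrueGraphs s₁ s₂ d z w₁ w₂) (hd : 0 < d) :
    p₁ * p₂ ≤ 4 * d ^ 2 * ((∑ e, w₁ e) * ∑ e, w₂ e) := by
  calc (p₁ * p₂ : ℝ) = 4 * d ^ 2 * (p₁ / (2 * d) * (p₂ / (2 * d))) := by field_simp; norm_num
    _ ≤ 4 * d ^ 2 * ((∑ e, w₁ e) * ∑ e, w₂ e) := by
        gcongr
        · exact (h.sum_pos hd).1.le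
        · exact h.factor₁.div_le_sum
        · exact h.factor₂.div_le_sum

lemma TrueGraphs.sum_mul_sum_le (h : TrueGraphs s₁ s₂ d z w₁ w₂) (hd : 0 < d) :
    (∑ e, w₁ e) * ∑ e, w₂ e ≤ d ^ 2 / 4 * (p₁ * p₂) := by
  calc (∑ e, w₁ e) * ∑ e, w₂ e ≤ (d * p₁ / 2) * (d * p₂ / 2) :=
        mul_le_mul h.factor₁.sum_le h.factor₂.sum_le (h.sum_pos hd).2.le (by positivity)
    _ = d ^ 2 / 4 * (p₁ * p₂) := by ring

lemma TrueGraphs.sqrt_add_le (h : TrueGraphs s₁ s₂ d z w₁ w₂) (hd : 0 < d) :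
    √(p₁ + p₂) ≤ 3 * d * √((∑ e, w₁ e) * ∑ e, w₂ e) := by
  obtain ⟨hq₁, hq₂⟩ := h.sum_pos hd
  have h_card := h.card_le_sum_mul_sum hd
  have hp₁ : (1 : ℝ) ≤ p₁ := by exact_mod_cast (h.one_lt hd).1.le
  have hp₂ : (1 : ℝ) ≤ p₂ := by exact_mod_cast (h.one_lt hd).2.le
  refine Real.sqrt_le_iff.2 ⟨by positivity, ?_⟩
  calc (p₁ + p₂ : ℝ) ≤ 2 * (p₁ * p₂) := by
        nlinarith [mul_nonneg (sub_nonneg.2 hp₁) (sub_nonneg.2 hp₂)]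
    _ ≤ 9 * d ^ 2 * ((∑ e, w₁ e) * ∑ e, w₂ e) := by
        linarith [mul_pos (pow_pos hd 2) (mul_pos hq₁ hq₂)]
    _ = (3 * d * √((∑ e, w₁ e) * ∑ e, w₂ e)) ^ 2 := by
        rw [mul_pow, Real.sq_sqrt (by positivity)]; ring

lemma TrueGraphs.penalty_sub_le (h : TrueGraphs s₁ s₂ d z w₁ w₂) (hd : 0 < d) (hρ : 0 ≤ ρ)
    (hσ : 0 ≤ σ) (hρσ : ρ ≤ σ * √(p₁ + p₂)) (Q' : ℝ) :
    2 * ρ * (√((∑ e, w₁ e) * ∑ e, w₂ e) - √Q') ≤ 6 * d * σ * ((∑ e, w₁ e) * ∑ e, w₂ e) := by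
  obtain ⟨hq₁, hq₂⟩ := h.sum_pos hd
  have h_sqrt := h.sqrt_add_le hd
  set Q := (∑ e, w₁ e) * ∑ e, w₂ e
  calc 2 * ρ * (√Q - √Q') ≤ 2 * ρ * √Q :=
        mul_le_mul_of_nonneg_left (sub_le_self _ (Real.sqrt_nonneg _)) (by positivity)
    _ ≤ 2 * (σ * (3 * d * √Q)) * √Q := by
        gcongr
        exact hρσ.trans (by gcongr)
    _ = 6 * d * σ * (√Q * √Q) := by ring
    _ = 6 * d * σ * Q := by rw [Real.mul_self_sqrt (mul_pos hq₁ hq₂).le]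

lemma NoiseBound.trace_sub_le_sum_mul_sum (h : NoiseBound Z w₁ w₂ γ) (hw₁ : ∀ e, 0 ≤ w₁ e)
    (hw₂ : ∀ e, 0 ≤ w₂ e) (hv₁ : ∀ e, 0 ≤ v₁ e) (hv₂ : ∀ e, 0 ≤ v₂ e) :
    (kronLaplacian w₁ w₂ * Z).trace - (kronLaplacian v₁ v₂ * Z).trace ≤
      γ * ((∑ e, w₁ e) * (∑ e, w₂ e) + (∑ e, v₁ e) * ∑ e, v₂ e) := by
  have hw := le_of_abs_le (h.abs_tracePairing_le w₁ w₂)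
  have hv := neg_le_of_abs_le (h.abs_tracePairing_le v₁ v₂)
  simp only [abs_of_nonneg (hw₁ _), abs_of_nonneg (hw₂ _), tracePairing_apply] at hw
  simp only [abs_of_nonneg (hv₁ _), abs_of_nonneg (hv₂ _), tracePairing_apply] at hv
  linarith

lemma TrueGraphs.sum_mul_sum_le_two_mul (h : TrueGraphs s₁ s₂ d z w₁ w₂) (hd : 1 < d)
    (hz : 1 < z) (hv : Feasible v₁ v₂)
    (hD : divergence w₁ v₁ w₂ v₂ ≤
      testRadius d z * ((∑ e, w₁ e) * (∑ e, w₂ e) + (∑ e, v₁ e) * ∑ e, v₂ e)) :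
    (∑ e, v₁ e) * ∑ e, v₂ e ≤ 2 * ((∑ e, w₁ e) * ∑ e, w₂ e) := by
  have hk := testRadius_pos hd hz
  have h_test := h.total_weight_test hd hz hv (abs_of_pos hk).le
  have h_card := h.card_le_sum_mul_sum (by linarith)
  set Q := (∑ e, w₁ e) * ∑ e, w₂ e
  have h_quad : z ^ 2 * (p₁ * p₂) * testRadius d z ^ 2 ≤ testRadius d z * Q := by
    calc z ^ 2 * (p₁ * p₂) * testRadius d z ^ 2
        ≤ z ^ 2 * (4 * d ^ 2 * Q) * testRadius d z ^ 2 := by gcongr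
      _ = testRadius d z * Q * (4 * z ^ 2 * d ^ 2 * testRadius d z) := by ring
      _ = testRadius d z * Q := by unfold testRadius; field_simp
  refine le_of_mul_le_mul_left ?_ hk
  linarith

lemma NoiseBound.divergence_le (hN : NoiseBound Z w₁ w₂ γ) (h : TrueGraphs s₁ s₂ d z w₁ w₂)
    (hd : 1 < d) (hz : 1 < z) (hv : Feasible v₁ v₂) (hB : BasicInequality Z ρ w₁ v₁ w₂ v₂)
    (hγ : 0 ≤ γ) (hρ : 0 ≤ ρ) (hσ : 0 ≤ σ) (hρσ : ρ ≤ σ * √(p₁ + p₂))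
    (hsmall : γ + 6 * d * σ ≤ testRadius d z) :
    divergence w₁ v₁ w₂ v₂ ≤ 3 * (γ + 6 * d * σ) * ((∑ e, w₁ e) * ∑ e, w₂ e) := by
  obtain ⟨hq₁, hq₂⟩ := h.sum_pos (by linarith)
  have hv₁ := Finset.sum_nonneg fun e (_ : e ∈ Finset.univ) => hv.1 e
  have hv₂ := Finset.sum_nonneg fun e (_ : e ∈ Finset.univ) => hv.2.1 e
  have h_penalty := h.penalty_sub_le (by linarith) hρ hσ hρσ ((∑ e, v₁ e) * ∑ e, v₂ e)
  have h_noise := hN.trace_sub_le_sum_mul_sum h.nonneg₁ h.nonneg₂ hv.1 hv.2.1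
  have hD : divergence w₁ v₁ w₂ v₂ ≤
      (γ + 6 * d * σ) * ((∑ e, w₁ e) * (∑ e, w₂ e) + (∑ e, v₁ e) * ∑ e, v₂ e) := by
    have h_extra : 0 ≤ 6 * d * σ * ((∑ e, v₁ e) * ∑ e, v₂ e) := by positivity
    unfold BasicInequality at hB
    linarith
  have h_weight := h.sum_mul_sum_le_two_mul hd hz hv
    (hD.trans (mul_le_mul_of_nonneg_right hsmall (by positivity)))
  calc divergence w₁ v₁ w₂ v₂
      ≤ (γ + 6 * d * σ) * ((∑ e, w₁ e) * (∑ e, w₂ e) + (∑ e, v₁ e) * ∑ e, v₂ e) := hD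
    _ ≤ (γ + 6 * d * σ) *
          ((∑ e, w₁ e) * (∑ e, w₂ e) + 2 * ((∑ e, w₁ e) * ∑ e, w₂ e)) := by gcongr
    _ = 3 * (γ + 6 * d * σ) * ((∑ e, w₁ e) * ∑ e, w₂ e) := by ring

lemma localRadius_le_testRadius (hs : 1 ≤ s) (hd : 1 < d) (hz : 1 < z) :
    localRadius s d z ≤ testRadius d z := by
  have hk := testRadius_pos hd hz
  have hβ := energyConst_pos hs hd
  have hβ_le : energyConst s d ≤ 1 := (energyConst_le_one_div_sq hs hd).trans
    ((div_le_one (by positivity)).2 (one_le_pow₀ hd.le))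
  calc localRadius s d z = z ^ 2 * testRadius d z * energyConst s d ^ 2 * testRadius d z := by
        unfold localRadius; ring
    _ ≤ 1 / 4 * 1 ^ 2 * testRadius d z := by
        gcongr
        exact sq_mul_testRadius_le hd hz
    _ ≤ testRadius d z := by linarith

lemma NoiseBound.localized (hN : NoiseBound Z w₁ w₂ γ) (h : TrueGraphs s s d z w₁ w₂)
    (hs : 1 ≤ s) (hd : 1 < d) (hz : 1 < z) (hv : Feasible v₁ v₂)
    (hB : BasicInequality Z ρ w₁ v₁ w₂ v₂) (hγ : 0 ≤ γ) (hρ : 0 ≤ ρ) (hσ : 0 ≤ σ)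
    (hρσ : ρ ≤ σ * √(p₁ + p₂)) (hsmall : d ^ 2 * (γ + 6 * d * σ) ≤ localRadius s d z) :
    Localized s d z w₁ v₁ w₂ v₂ := by
  have hd_sq : 1 ≤ d ^ 2 := one_le_pow₀ hd.le
  have he : 0 ≤ γ + 6 * d * σ := by positivity
  have he_le : γ + 6 * d * σ ≤ testRadius d z :=
    (le_mul_of_one_le_left he hd_sq).trans (hsmall.trans (localRadius_le_testRadius hs hd hz))
  refine ⟨h, hv, ?_⟩
  calc divergence w₁ v₁ w₂ v₂ ≤ 3 * (γ + 6 * d * σ) * ((∑ e, w₁ e) * ∑ e, w₂ e) :=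
        hN.divergence_le h hd hz hv hB hγ hρ hσ hρσ he_le
    _ ≤ 3 * (γ + 6 * d * σ) * (d ^ 2 / 4 * (p₁ * p₂)) := by
        exact mul_le_mul_of_nonneg_left (h.sum_mul_sum_le (by linarith)) (by linarith)
    _ = 3 / 4 * (d ^ 2 * (γ + 6 * d * σ)) * (p₁ * p₂) := by ring
    _ ≤ localRadius s d z * (p₁ * p₂) := by
        gcongr
        linarith [mul_nonneg (zero_le_one.trans hd_sq) he]

lemma sqrt_sub_sqrt_le {x y : ℝ} (hx : 0 < x) (hy : 0 ≤ y) : √x - √y ≤ |y - x| / √x := by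
  rw [le_div_iff₀ (Real.sqrt_pos.2 hx)]
  calc (√x - √y) * √x ≤ |√x - √y| * (√x + √y) :=
        mul_le_mul (le_abs_self _) (le_add_of_nonneg_right (Real.sqrt_nonneg y))
          (Real.sqrt_nonneg x) (abs_nonneg _)
    _ = |(√x - √y) * (√x + √y)| := by
        rw [abs_mul, abs_of_nonneg (a := √x + √y) (by positivity)]
    _ = |y - x| := by
        rw [← abs_neg (y - x), neg_sub, mul_comm, ← sq_sub_sq, Real.sq_sqrt hx.le, Real.sq_sqrt hy]

lemma Localized.penalty_sub_le (h : Localized s d z w₁ v₁ w₂ v₂) (hs : 1 ≤ s) (hd : 1 < d)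
    (hz : 1 < z) : √((∑ e, w₁ e) * ∑ e, w₂ e) - √((∑ e, v₁ e) * ∑ e, v₂ e) ≤
      z * d * √(divergence w₁ v₁ w₂ v₂) := by
  obtain ⟨hq₁, hq₂⟩ := h.truth.sum_pos (by linarith)
  have hQ := mul_pos hq₁ hq₂
  have h_sqrt : √p₁ * √p₂ ≤ 2 * d * √((∑ e, w₁ e) * ∑ e, w₂ e) := by
    rw [← Real.sqrt_mul p₁.cast_nonneg]
    refine Real.sqrt_le_iff.2 ⟨by positivity, ?_⟩
    rw [mul_pow, Real.sq_sqrt hQ.le]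
    linarith [h.truth.card_le_sum_mul_sum (by linarith)]
  refine (sqrt_sub_sqrt_le hQ (mul_nonneg (Finset.sum_nonneg fun e _ => h.feasible.1 e)
    (Finset.sum_nonneg fun e _ => h.feasible.2.1 e))).trans ?_
  rw [div_le_iff₀ (Real.sqrt_pos.2 hQ)]
  calc _ ≤ z / 2 * (√p₁ * √p₂) * √(divergence w₁ v₁ w₂ v₂) := h.abs_sum_mul_sum_sub_le hs hd hz
    _ ≤ z / 2 * (2 * d * √((∑ e, w₁ e) * ∑ e, w₂ e)) * √(divergence w₁ v₁ w₂ v₂) := by gcongr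
    _ = _ := by ring

lemma Localized.sqrt_divergence_le_of_normalized (h : Localized s d z w₁ v₁ w₂ v₂) (hs : 1 ≤ s)
    (hd : 1 < d) (hz : 1 < z) (hN : NoiseBound Z w₁ w₂ γ) (hB : BasicInequality Z ρ w₁ v₁ w₂ v₂)
    (hγ : 0 ≤ γ) (hρ : 0 ≤ ρ) (hσ : 0 ≤ σ) (hρσ : ρ ≤ σ * √(p₁ + p₂))
    (hsmall : γ * deviationConst s d z ^ 2 ≤ 1 / 2) (hnorm : w₂ ⬝ᵥ v₂ = w₂ ⬝ᵥ w₂) :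
    √(divergence w₁ v₁ w₂ v₂) ≤
      4 * (γ * deviationConst s d z + z * d * σ) * √(p₁ + p₂) := by
  obtain ⟨hp₁, hp₂⟩ := h.truth.one_lt (by linarith)
  have hc := deviationConst_pos hs hd hz
  have h_noise := hN.trace_sub_le hγ (by linarith) (by linarith)
    (h.sum_abs_sub_left_le hs hd hz hnorm) (h.sum_abs_sub_right_le hs hd hz hnorm)
  have h_penalty := h.penalty_sub_le hs hd hz
  have h_sq : √(divergence w₁ v₁ w₂ v₂) ^ 2 = divergence w₁ v₁ w₂ v₂ :=
    Real.sq_sqrt (h.truth.divergence_nonneg hz h.feasible)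
  unfold BasicInequality at hB
  rw [← h_sq] at hB
  have hT := Real.sqrt_nonneg (divergence w₁ v₁ w₂ v₂)
  set T := √(divergence w₁ v₁ w₂ v₂)
  set c := deviationConst s d z
  have h_sqrt₁ : √(p₁ : ℝ) ≤ √(p₁ + p₂) := Real.sqrt_le_sqrt (by simp)
  have h_sqrt₂ : √(p₂ : ℝ) ≤ √(p₁ + p₂) := Real.sqrt_le_sqrt (by simp)
  have h_quad : 1 / 2 * T ^ 2 ≤
      γ * c * (√(p₁ + p₂) + √(p₁ + p₂)) * T + 2 * (σ * √(p₁ + p₂)) * (z * d * T) := by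
    calc 1 / 2 * T ^ 2 ≤ T ^ 2 - γ * c ^ 2 * T ^ 2 := by
          linarith [mul_le_mul_of_nonneg_right hsmall (sq_nonneg T)]
      _ ≤ γ * c * (√p₁ + √p₂) * T + 2 * ρ * (z * d * T) := by
          linarith [mul_le_mul_of_nonneg_left h_penalty hρ]
      _ ≤ _ := by gcongr
  rcases hT.eq_or_lt with h_zero | h_pos
  · rw [← h_zero]; positivity
  · refine le_of_mul_le_mul_right ?_ h_pos
    linarith

lemma Localized.exists_normalization (h : Localized s d z w₁ v₁ w₂ v₂) (hs : 1 ≤ s) (hd : 1 < d)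
    (hz : 1 < z) : ∃ t : ℝ, 0 < t ∧ w₂ ⬝ᵥ (t⁻¹ • v₂) = w₂ ⬝ᵥ w₂ := by
  obtain ⟨h₁, h₂⟩ := h.truth.energyConst_mul_pos hs hd
  have hW₁ := h₁.trans_le (h.truth.le_dotProduct_self₁ hs hd)
  have hW₂ := h₂.trans_le (h.truth.le_dotProduct_self₂ hs hd)
  have h_inner : 0 < w₂ ⬝ᵥ v₂ :=
    pos_of_mul_pos_right ((half_pos (mul_pos hW₁ hW₂)).trans_le (h.half_le_inner hs hd hz))
      (Finset.sum_nonneg fun e _ => mul_nonneg (h.truth.nonneg₁ e) (h.feasible.1 e))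
  refine ⟨(w₂ ⬝ᵥ v₂) / (w₂ ⬝ᵥ w₂), div_pos h_inner hW₂, ?_⟩
  rw [dotProduct_smul, smul_eq_mul, inv_div, div_mul_cancel₀ _ h_inner.ne']

lemma Localized.sqrt_divergence_le (h : Localized s d z w₁ v₁ w₂ v₂) (hs : 1 ≤ s)
    (hd : 1 < d) (hz : 1 < z) (hN : NoiseBound Z w₁ w₂ γ) (hB : BasicInequality Z ρ w₁ v₁ w₂ v₂)
    (hγ : 0 ≤ γ) (hρ : 0 ≤ ρ) (hσ : 0 ≤ σ) (hρσ : ρ ≤ σ * √(p₁ + p₂))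
    (hsmall : γ * deviationConst s d z ^ 2 ≤ 1 / 2) :
    √(divergence w₁ v₁ w₂ v₂) ≤
      4 * (γ * deviationConst s d z + z * d * σ) * √(p₁ + p₂) := by
  obtain ⟨t, ht, hnorm⟩ := h.exists_normalization hs hd hz
  rw [← divergence_smul_smul_inv ht.ne']
  exact (h.smul_smul_inv ht).sqrt_divergence_le_of_normalized hs hd hz hN
    (hB.smul_smul_inv ht.ne') hγ hρ hσ hρσ hsmall hnorm

/-- The constant relating the squared Frobenius error to the divergence. -/
noncomputable def frobeniusConst (s d z : ℝ) : ℝ :=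
  10 * ((24 + 16 * (energyConst s d)⁻¹) / testRadius d z)

lemma frobeniusConst_pos (hs : 1 ≤ s) (hd : 1 < d) (hz : 1 < z) : 0 < frobeniusConst s d z := by
  have hk := testRadius_pos hd hz
  have hβ := energyConst_pos hs hd
  unfold frobeniusConst
  positivity

lemma Localized.frobNorm_sq_le (h : Localized s d z w₁ v₁ w₂ v₂) (hs : 1 ≤ s) (hd : 1 < d)
    (hz : 1 < z)
    (hD₁ : divergence w₁ v₁ w₂ v₂ < testRadius d z / 4 * (energyConst s d * p₁))
    (hD₂ : divergence w₁ v₁ w₂ v₂ < testRadius d z / 4 * (energyConst s d * p₂)) :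
    frobNorm (kronLaplacian v₁ v₂ - kronLaplacian w₁ w₂) ^ 2 ≤
      frobeniusConst s d z * divergence w₁ v₁ w₂ v₂ := by
  have hk := testRadius_pos hd hz
  have hβ := energyConst_pos hs hd
  have hp₁ : (1 : ℝ) ≤ p₁ := by exact_mod_cast (h.truth.one_lt (by linarith)).1.le
  have h_sum_sq : ∀ {ι₁ ι₂ : Type} [Fintype ι₁] [Fintype ι₂] {u₀ u : ι₁ → ℝ} {x₀ x : ι₂ → ℝ},
      RankOneTests (divergence w₁ v₁ w₂ v₂) (z ^ 2) (testRadius d z) u₀ u x₀ x →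
      energyConst s d * p₁ ≤ u₀ ⬝ᵥ u₀ → energyConst s d * p₂ ≤ x₀ ⬝ᵥ x₀ → 0 ≤ x₀ ⬝ᵥ x →
      ∑ i, ∑ j, (u i * x j - u₀ i * x₀ j) ^ 2 ≤
        (24 + 16 * (energyConst s d)⁻¹) / testRadius d z * divergence w₁ v₁ w₂ v₂ := by
    intro ι₁ ι₂ _ _ u₀ u x₀ x h_tests hU hV h_inner
    have hU_one : energyConst s d ≤ u₀ ⬝ᵥ u₀ := (le_mul_of_one_le_right hβ.le hp₁).trans hU
    refine h_tests.sum_sq_le hk (by positivity) (sq_mul_testRadius_le hd hz) (by positivity) ?_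
      ((h.truth.energyConst_mul_pos hs hd).2.trans_le hV) h_inner (h.divergence_le hs hd hU hV)
      (hD₁.trans_le (by gcongr)) (hD₂.trans_le (by gcongr))
    rwa [inv_mul_eq_div, one_le_div hβ]
  have h_degree := h_sum_sq (h.truth.rankOneTests_degree hd hz h.feasible)
    (h.truth.factor₁.le_degree_dotProduct_self hs hd)
    (h.truth.factor₂.le_degree_dotProduct_self hs hd)
    (Finset.sum_nonneg fun j _ => mul_nonneg (degree_nonneg h.truth.nonneg₂ j)
      (degree_nonneg h.feasible.2.1 j))
  have h_weight := h_sum_sq (h.truth.rankOneTests_weight hd hz h.feasible)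
    (h.truth.le_dotProduct_self₁ hs hd) (h.truth.le_dotProduct_self₂ hs hd)
    (Finset.sum_nonneg fun e _ => mul_nonneg (h.truth.nonneg₂ e) (h.feasible.2.1 e))
  have h_split := frobNorm_kronLaplacian_sub_sq_le w₁ v₁ w₂ v₂
  unfold frobeniusConst
  linarith

lemma sqrt_mul_le_mul_sqrt_add {α₁ α₂ x₁ x₂ : ℝ} (hx₁ : 0 ≤ x₁) (hx₂ : 0 ≤ x₂) (hσ : 0 ≤ σ)
    (hα₁ : α₁ ≤ σ * √x₂) (hα₂_nonneg : 0 ≤ α₂) (hα₂ : α₂ ≤ σ * √x₁) :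
    √(α₁ * α₂) ≤ σ * √(x₁ + x₂) := by
  refine Real.sqrt_le_iff.2 ⟨by positivity, ?_⟩
  rw [sq]
  refine mul_le_mul (hα₁.trans ?_) (hα₂.trans ?_) hα₂_nonneg (by positivity)
  · gcongr; exact le_add_of_nonneg_left hx₁
  · gcongr; exact le_add_of_nonneg_right hx₂

lemma exists_pos_forall_mul_lt (x : ℝ) {y : ℝ} (hy : 0 < y) :
    ∃ g₀ > 0, ∀ g, 0 ≤ g → g ≤ g₀ → x * g < y := by
  refine ⟨y / (|x| + 1), by positivity, fun g hg hle => ?_⟩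
  calc x * g ≤ |x| * (y / (|x| + 1)) := by
        gcongr
        exact le_abs_self x
    _ = y * (|x| / (|x| + 1)) := by ring
    _ < y * 1 := by
        gcongr
        rw [div_lt_one (by positivity)]
        exact lt_add_one _
    _ = y := mul_one y

/-- The factor by which noise of size `b` and penalties of size `a` enter the bound on the square
root of the divergence. -/
noncomputable def rateConst (s d z a b : ℝ) : ℝ := 4 * (b * deviationConst s d z + z * d * a)

lemma IsPenalizedMLE.localized_and_divergence_le {α₁ α₂ a b g : ℝ}
    {S C : Matrix (Fin p₁ × Fin p₂) (Fin p₁ × Fin p₂) ℝ} (hv : IsPenalizedMLE α₁ α₂ S v₁ v₂)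
    (h : TrueGraphs s s d z w₁ w₂) (hs : 1 ≤ s) (hd : 1 < d) (hz : 1 < z)
    (hC : IsMoorePenroseInverse (kronLaplacian w₁ w₂) C)
    (hα₁_pos : 0 < α₁) (hα₂_pos : 0 < α₂) (ha : 0 ≤ a) (hb : 0 ≤ b) (hg : 0 ≤ g)
    (hα₁ : α₁ ≤ a * g * √p₂) (hα₂ : α₂ ≤ a * g * √p₁) (hN : NoiseBound (S - C) w₁ w₂ (b * g))
    (hlocal : d ^ 2 * (b * g + 6 * d * (a * g)) ≤ localRadius s d z)
    (hnoise : b * g * deviationConst s d z ^ 2 ≤ 1 / 2) :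
    Localized s d z w₁ v₁ w₂ v₂ ∧
      divergence w₁ v₁ w₂ v₂ ≤ rateConst s d z a b ^ 2 * (g ^ 2 * (p₁ + p₂)) := by
  have hB := hv.basicInequality hα₁_pos hα₂_pos h (by linarith) hz hC
  have hσ : 0 ≤ a * g := by positivity
  have hρ := sqrt_mul_le_mul_sqrt_add p₁.cast_nonneg p₂.cast_nonneg hσ hα₁ hα₂_pos.le hα₂
  have h_local := hN.localized h hs hd hz hv.1 hB (by positivity) (Real.sqrt_nonneg _) hσ hρ hlocal
  refine ⟨h_local, ?_⟩
  have hT := h_local.sqrt_divergence_le hs hd hz hN hB (by positivity) (Real.sqrt_nonneg _) hσ hρ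
    hnoise
  calc divergence w₁ v₁ w₂ v₂ = √(divergence w₁ v₁ w₂ v₂) ^ 2 :=
        (Real.sq_sqrt (h.divergence_nonneg hz hv.1)).symm
    _ ≤ (4 * (b * g * deviationConst s d z + z * d * (a * g)) * √(p₁ + p₂)) ^ 2 := by gcongr
    _ = rateConst s d z a b ^ 2 * (g ^ 2 * √(p₁ + p₂) ^ 2) := by unfold rateConst; ring
    _ = rateConst s d z a b ^ 2 * (g ^ 2 * (p₁ + p₂)) := by rw [Real.sq_sqrt (by positivity)]

lemma exists_forall_frobNorm_le {a b : ℝ} (hs : 1 ≤ s) (hd : 1 < d) (hz : 1 < z) (ha : 0 < a)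
    (hb : 0 ≤ b) :
    ∃ g₀ > 0, ∃ θ > 0, ∃ c > 0, ∀ {p₁ p₂ : ℕ} {w₁ : Edge p₁ → ℝ} {w₂ : Edge p₂ → ℝ}
      {S C : Matrix (Fin p₁ × Fin p₂) (Fin p₁ × Fin p₂) ℝ} {α₁ α₂ g : ℝ},
      TrueGraphs s s d z w₁ w₂ → IsMoorePenroseInverse (kronLaplacian w₁ w₂) C → 0 ≤ g → g ≤ g₀ →
      g ^ 2 * (p₁ + p₂) ≤ θ * p₁ → g ^ 2 * (p₁ + p₂) ≤ θ * p₂ →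
      0 < α₁ → α₁ ≤ a * g * √p₂ → 0 < α₂ → α₂ ≤ a * g * √p₁ →
      NoiseBound (S - C) w₁ w₂ (b * g) → ∀ {v₁ v₂}, IsPenalizedMLE α₁ α₂ S v₁ v₂ →
        frobNorm (kronLaplacian v₁ v₂ - kronLaplacian w₁ w₂) ≤ c * (g * √(p₁ + p₂)) := by
  have hk := testRadius_pos hd hz
  have hβ := energyConst_pos hs hd
  have hK := frobeniusConst_pos hs hd hz
  have hr : 0 < rateConst s d z a b := by
    have hc := deviationConst_pos hs hd hz
    unfold rateConst
    positivity
  obtain ⟨g₁, hg₁, h_local⟩ :=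
    exists_pos_forall_mul_lt (d ^ 2 * (b + 6 * d * a)) (localRadius_pos hs hd hz)
  obtain ⟨g₂, hg₂, h_noise⟩ :=
    exists_pos_forall_mul_lt (b * deviationConst s d z ^ 2) one_half_pos
  obtain ⟨θ, hθ, h_rate⟩ := exists_pos_forall_mul_lt (rateConst s d z a b ^ 2)
    (show 0 < testRadius d z / 4 * energyConst s d by positivity)
  refine ⟨min g₁ g₂, lt_min hg₁ hg₂, θ, hθ, √(frobeniusConst s d z) * rateConst s d z a b,
    by positivity, ?_⟩
  intro p₁ p₂ w₁ w₂ S C α₁ α₂ g h hC hg hg_le hθ₁ hθ₂ hα₁_pos hα₁ hα₂_pos hα₂ hN v₁ v₂ hv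
  obtain ⟨hp₁, hp₂⟩ := h.one_lt (by linarith)
  obtain ⟨hL, hD⟩ := hv.localized_and_divergence_le h hs hd hz hC hα₁_pos hα₂_pos ha.le hb hg
    hα₁ hα₂ hN (by linarith [h_local g hg (hg_le.trans (min_le_left _ _))])
    (by linarith [h_noise g hg (hg_le.trans (min_le_right _ _))])
  have h_small : ∀ p : ℝ, 0 < p → g ^ 2 * (p₁ + p₂) ≤ θ * p →
      divergence w₁ v₁ w₂ v₂ < testRadius d z / 4 * (energyConst s d * p) := fun p hp hle => by
    calc _ ≤ rateConst s d z a b ^ 2 * (θ * p) := hD.trans (by gcongr)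
      _ = rateConst s d z a b ^ 2 * θ * p := by ring
      _ < testRadius d z / 4 * energyConst s d * p :=
          mul_lt_mul_of_pos_right (h_rate θ hθ.le le_rfl) hp
      _ = _ := by ring
  refine abs_le_of_sq_le_sq' ?_ (by positivity) |>.2
  calc _ ≤ frobeniusConst s d z * divergence w₁ v₁ w₂ v₂ := hL.frobNorm_sq_le hs hd hz
        (h_small p₁ (by positivity) hθ₁) (h_small p₂ (by positivity) hθ₂)
    _ ≤ frobeniusConst s d z * (rateConst s d z a b ^ 2 * (g ^ 2 * (p₁ + p₂))) := by gcongr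
    _ = _ := by
      rw [mul_pow, mul_pow, mul_pow, Real.sq_sqrt hK.le, Real.sq_sqrt (by positivity)]
      ring

end Consistency

section NoiseProbability

variable {Ω : Type*} [MeasurableSpace Ω] {μ : Measure Ω}

lemma measureReal_abs_trace_sampleCov_sub_ge_le_rpow {ι : Type*} [Fintype ι] [DecidableEq ι] {n : ℕ}
    (hn : 0 < n) {X : Fin n → Ω → EuclideanSpace ℝ ι} {A C : Matrix ι ι ℝ} {z K κ g P p : ℝ}
    (hX : iIndepFun X μ) (hlaw : ∀ k, HasLaw (X k) (multivariateGaussian 0 C) μ) (hz : 0 ≤ z)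
    (hK : 0 ≤ K) (hA : A.PosSemidef) (hC : C.PosSemidef)
    (hAK : ∀ ξ : ι → ℝ, ξ ⬝ᵥ A *ᵥ ξ ≤ K * (ξ ⬝ᵥ ξ))
    (hCz : ∀ ξ : ι → ℝ, ξ ⬝ᵥ C *ᵥ ξ ≤ z * (ξ ⬝ᵥ ξ)) (htr : A.trace ≤ K / 2 * P) (hP : 1 ≤ P)
    (hp : 0 < p) (hg : 0 ≤ g) (hgn : n * g ^ 2 = Real.log p) (hgK : K * z * g ≤ 1 / 4) :
    μ.real {ω | ((K * z) ^ 2 + κ) * g * √P ≤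
      |(A * (sampleCov (fun k => X k ω) - C)).trace|} ≤ 2 * p ^ (-κ) := by
  have : IsProbabilityMeasure μ := hX.isProbabilityMeasure
  have hP_pos : 0 < P := by linarith
  have : (0 : ℝ) < n := by exact_mod_cast hn
  have h_mgf := hasSubexponentialMGF_trace_mul_sampleCov_sub hn hX hlaw hz hK hg hA hC hAK hCz hgK
  have ht : n * (g / √P) ≤ n * g := by
    gcongr
    exact div_le_self hg (Real.one_le_sqrt.2 hP)
  refine (h_mgf.measureReal_abs_ge_le (by positivity) ht _).trans ?_
  rw [Real.rpow_def_of_pos hp, ← hgn]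
  gcongr
  have h_linear : n * (g / √P) * (((K * z) ^ 2 + κ) * g * √P) =
      n * g ^ 2 * ((K * z) ^ 2 + κ) := by field_simp
  have h_quad : 2 * (K * z * (z * A.trace)) / n * (n * (g / √P)) ^ 2 ≤ n * g ^ 2 * (K * z) ^ 2 := by
    calc 2 * (K * z * (z * A.trace)) / n * (n * (g / √P)) ^ 2
        ≤ 2 * (K * z * (z * (K / 2 * P))) / n * (n * (g / √P)) ^ 2 := by gcongr
      _ = n * g ^ 2 * (K * z) ^ 2 := by
          rw [mul_pow, div_pow, Real.sq_sqrt hP_pos.le]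
          field_simp
  linarith

lemma single_one_nonneg {p : ℕ} (e f : Edge p) : 0 ≤ (Pi.single e 1 : Edge p → ℝ) f := by
  rw [Pi.single_apply]
  split_ifs <;> norm_num

lemma degree_single_le {p : ℕ} (e : Edge p) (i : Fin p) : degree (Pi.single e 1) i ≤ 2 := by
  calc degree (Pi.single e 1) i ≤ ∑ j, degree (Pi.single e 1) j :=
        Finset.single_le_sum (fun j _ => degree_nonneg (single_one_nonneg e) j)
          (Finset.mem_univ i)
    _ = 2 := by rw [sum_degree, Finset.sum_pi_single', if_pos (Finset.mem_univ e), mul_one]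

lemma card_edge_le (p : ℕ) : (Fintype.card (Edge p) : ℝ) ≤ p ^ 2 := by
  have h := Fintype.card_subtype_le fun e : Fin p × Fin p => e.2 < e.1
  rw [Fintype.card_prod, Fintype.card_fin, ← sq] at h
  exact_mod_cast h

lemma measureReal_iUnion_le_mul {ι : Type*} [Fintype ι] {A : ι → Set Ω} {q N : ℝ} (hq : 0 ≤ q)
    (hN : Fintype.card ι ≤ N) (hA : ∀ i, μ.real (A i) ≤ q) : μ.real (⋃ i, A i) ≤ N * q := by
  calc μ.real (⋃ i, A i) ≤ ∑ i, μ.real (A i) := measureReal_iUnion_fintype_le A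
    _ ≤ ∑ _i : ι, q := Finset.sum_le_sum fun i _ => hA i
    _ = Fintype.card ι * q := by simp
    _ ≤ N * q := by gcongr

lemma add_add_mul_two_rpow_neg_le {x y τ : ℝ} (hx : 2 ≤ x) (hy : 2 ≤ y) :
    (x ^ 2 + (y ^ 2 + x ^ 2 * y ^ 2)) * (2 * (x * y) ^ (-(τ + 5))) ≤ (x * y) ^ (-τ) := by
  have hxy : 4 ≤ x * y := by nlinarith
  have hxy_pos : 0 < x * y := by linarith
  have h_split : (x * y) ^ (-(τ + 5)) = (x * y) ^ (-τ) / (x * y) ^ 5 := by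
    rw [neg_add', Real.rpow_sub hxy_pos]
    norm_num
  have h_count : x ^ 2 + (y ^ 2 + x ^ 2 * y ^ 2) ≤ 3 * (x * y) ^ 2 := by
    have hx_sq : 1 ≤ x ^ 2 := one_le_pow₀ (by linarith)
    have hy_sq : 1 ≤ y ^ 2 := one_le_pow₀ (by linarith)
    rw [mul_pow]
    linarith [le_mul_of_one_le_right (sq_nonneg x) hy_sq,
      le_mul_of_one_le_left (sq_nonneg y) hx_sq]
  have h_pow : 6 ≤ (x * y) ^ 3 := by
    linarith [pow_le_pow_left₀ (by norm_num) hxy 3]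
  rw [h_split]
  calc (x ^ 2 + (y ^ 2 + x ^ 2 * y ^ 2)) * (2 * ((x * y) ^ (-τ) / (x * y) ^ 5))
      ≤ 3 * (x * y) ^ 2 * (2 * ((x * y) ^ (-τ) / (x * y) ^ 5)) := by gcongr
    _ = 6 * ((x * y) ^ 2 * ((x * y) ^ (-τ) / (x * y) ^ 5)) := by ring
    _ ≤ (x * y) ^ 3 * ((x * y) ^ 2 * ((x * y) ^ (-τ) / (x * y) ^ 5)) := by gcongr
    _ = (x * y) ^ (-τ) := by field_simp

variable {p₁ p₂ n : ℕ} {s₁ s₂ d z : ℝ} {w₁ : Edge p₁ → ℝ} {w₂ : Edge p₂ → ℝ}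

lemma measureReal_not_noiseBound_le_mul [IsFiniteMeasure μ]
    {Z : Ω → Matrix (Fin p₁ × Fin p₂) (Fin p₁ × Fin p₂) ℝ} {γ q : ℝ} (hq : 0 ≤ q)
    (hleft : ∀ e, μ.real {ω | γ * √p₂ ≤ |(kronLaplacian (Pi.single e 1) w₂ * Z ω).trace|} ≤ q)
    (hright : ∀ f, μ.real {ω | γ * √p₁ ≤ |(kronLaplacian w₁ (Pi.single f 1) * Z ω).trace|} ≤ q)
    (hboth : ∀ e f,
      μ.real {ω | γ ≤ |(kronLaplacian (Pi.single e 1) (Pi.single f 1) * Z ω).trace|} ≤ q) :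
    μ.real {ω | ¬ NoiseBound (Z ω) w₁ w₂ γ} ≤
      (p₁ ^ 2 + (p₂ ^ 2 + (p₁ : ℝ) ^ 2 * p₂ ^ 2)) * q := by
  have h_card : (Fintype.card (Edge p₁ × Edge p₂) : ℝ) ≤ (p₁ : ℝ) ^ 2 * p₂ ^ 2 := by
    rw [Fintype.card_prod, Nat.cast_mul]
    exact mul_le_mul (card_edge_le p₁) (card_edge_le p₂) (by positivity) (by positivity)
  rw [add_mul, add_mul]
  refine le_trans (measureReal_mono ?_) ((measureReal_union_le _ _).trans (add_le_add
    (measureReal_iUnion_le_mul hq (card_edge_le p₁) hleft) ((measureReal_union_le _ _).trans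
      (add_le_add (measureReal_iUnion_le_mul hq (card_edge_le p₂) hright)
        (measureReal_iUnion_le_mul hq h_card fun ef => hboth ef.1 ef.2)))))
  intro ω hω
  by_contra h_not_mem
  simp only [Set.mem_union, Set.mem_iUnion, Set.mem_ofPred_eq, not_or, not_exists, not_le,
    Prod.forall] at h_not_mem
  obtain ⟨h_left, h_right, h_both⟩ := h_not_mem
  exact hω ⟨fun e => (h_left e).le, fun f => (h_right f).le, fun e f => (h_both e f).le⟩

variable {X : Fin n → Ω → EuclideanSpace ℝ (Fin p₁ × Fin p₂)}
  {C : Matrix (Fin p₁ × Fin p₂) (Fin p₁ × Fin p₂) ℝ} {τ κ g : ℝ}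

lemma TrueGraphs.measureReal_abs_trace_ge_le_rpow (h : TrueGraphs s₁ s₂ d z w₁ w₂) (hd : 0 < d)
    (hz : 1 < z) (hC : IsMoorePenroseInverse (kronLaplacian w₁ w₂) C) (hn : 0 < n)
    (hX : iIndepFun X μ) (hlaw : ∀ k, HasLaw (X k) (multivariateGaussian 0 C) μ) (hg : 0 ≤ g)
    (hgn : n * g ^ 2 = Real.log (p₁ * p₂)) (hgz : 8 * d * z * g ≤ 1 / 4) {x : Edge p₁ → ℝ}
    {y : Edge p₂ → ℝ} {P : ℝ} (hx : ∀ e, 0 ≤ x e) (hy : ∀ e, 0 ≤ y e)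
    (hdeg : ∀ i j, degree x i * degree y j ≤ 4 * d) (hsum : (∑ e, x e) * ∑ e, y e ≤ d * P)
    (hP : 1 ≤ P) :
    μ.real {ω | ((8 * d * z) ^ 2 + κ) * g * √P ≤
      |(kronLaplacian x y * (sampleCov (fun k => X k ω) - C)).trace|} ≤
        2 * ((p₁ : ℝ) * p₂) ^ (-κ) := by
  obtain ⟨hp₁, hp₂⟩ := h.one_lt hd
  refine measureReal_abs_trace_sampleCov_sub_ge_le_rpow hn hX hlaw (by linarith) (by positivity)
    (kronLaplacian_posSemidef hx hy) (h.moorePenrose_posSemidef hz hC) (fun ξ => ?_)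
    (h.dotProduct_moorePenrose_mulVec_le hz hC) ?_ hP (by positivity) hg hgn hgz
  · exact (dotProduct_kronLaplacian_mulVec_le hx hy hdeg ξ).trans_eq (by ring)
  · rw [trace_kronLaplacian]
    linarith

/-- The multiple of `√(log (p₁ p₂) / n)` that the noise exceeds with probability at most
`(p₁ p₂) ^ (-τ)`. -/
noncomputable def noiseConst (d z τ : ℝ) : ℝ := (8 * d * z) ^ 2 + (τ + 5)

lemma TrueGraphs.measureReal_not_noiseBound_le_rpow (h : TrueGraphs s₁ s₂ d z w₁ w₂) (hd : 1 < d)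
    (hz : 1 < z) (hC : IsMoorePenroseInverse (kronLaplacian w₁ w₂) C) (hn : 0 < n)
    (hX : iIndepFun X μ) (hlaw : ∀ k, HasLaw (X k) (multivariateGaussian 0 C) μ) (hg : 0 ≤ g)
    (hgn : n * g ^ 2 = Real.log (p₁ * p₂)) (hgz : 8 * d * z * g ≤ 1 / 4) :
    μ.real {ω | ¬ NoiseBound (sampleCov (fun k => X k ω) - C) w₁ w₂ (noiseConst d z τ * g)} ≤
      ((p₁ : ℝ) * p₂) ^ (-τ) := by
  have : IsProbabilityMeasure μ := hX.isProbabilityMeasure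
  have hd_pos : 0 < d := by linarith
  obtain ⟨hp₁, hp₂⟩ := h.one_lt hd_pos
  have hp₁_le : (2 : ℝ) ≤ p₁ := by exact_mod_cast hp₁
  have hp₂_le : (2 : ℝ) ≤ p₂ := by exact_mod_cast hp₂
  have h_one : ∀ {p : ℕ} (e : Edge p), ∑ f, (Pi.single e 1 : Edge p → ℝ) f = 1 := fun e => by simp
  refine (measureReal_not_noiseBound_le_mul (q := 2 * ((p₁ : ℝ) * p₂) ^ (-(τ + 5)))
    (by positivity) (fun e => ?left) (fun f => ?right) fun e f => ?both).trans
      (add_add_mul_two_rpow_neg_le hp₁_le hp₂_le)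
  case left =>
    refine h.measureReal_abs_trace_ge_le_rpow hd_pos hz hC hn hX hlaw hg hgn hgz
      (single_one_nonneg e) h.nonneg₂ (fun i j => ?_) ?_ (by linarith)
    · linarith [mul_le_mul (degree_single_le e i) (h.degree₂ j).2 (degree_nonneg h.nonneg₂ j)
        zero_le_two]
    · rw [h_one, one_mul]
      linarith [h.factor₂.sum_le, show 0 ≤ d * p₂ by positivity]
  case right =>
    refine h.measureReal_abs_trace_ge_le_rpow hd_pos hz hC hn hX hlaw hg hgn hgz
      h.nonneg₁ (single_one_nonneg f) (fun i j => ?_) ?_ (by linarith)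
    · linarith [mul_le_mul (h.degree₁ i).2 (degree_single_le f j)
        (degree_nonneg (single_one_nonneg f) j) hd_pos.le]
    · rw [h_one, mul_one]
      linarith [h.factor₁.sum_le, show 0 ≤ d * p₁ by positivity]
  case both =>
    simpa only [noiseConst, Real.sqrt_one, mul_one] using
      h.measureReal_abs_trace_ge_le_rpow hd_pos hz hC hn hX hlaw hg hgn hgz
        (single_one_nonneg e) (single_one_nonneg f) (fun i j => by
          linarith [mul_le_mul (degree_single_le e i) (degree_single_le f j)
            (degree_nonneg (single_one_nonneg f) j) zero_le_two])
        (by rw [h_one, h_one]; linarith) le_rfl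

end NoiseProbability

section FailureProbability

variable {p₁ p₂ n : ℕ} {s₁ s₂ d z a α₁ α₂ : ℝ} {w₁ : Edge p₁ → ℝ} {w₂ : Edge p₂ → ℝ}

lemma ProperPenalty.pos (h : ProperPenalty a p₁ p₂ n α₁ α₂) : 0 < n := by
  by_contra hn
  obtain rfl : n = 0 := by omega
  have h_upper := h.1.2
  rw [Nat.cast_zero, div_zero, Real.sqrt_zero, mul_zero] at h_upper
  exact h.1.1.not_ge h_upper

lemma one_le_div_add_div {x y : ℝ} (hx : 0 < x) (hy : 0 < y) : 1 ≤ x / y + y / x := by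
  rcases le_total x y with hle | hle
  · linarith [(one_le_div hx).2 hle, div_pos hx hy]
  · linarith [(one_le_div hy).2 hle, div_pos hy hx]

lemma le_of_mul_div_add_div_le {x y G η : ℝ} (hx : 0 < x) (hy : 0 < y) (hG : 0 ≤ G)
    (h : G * (x / y + y / x) ≤ η) : G ≤ η :=
  (le_mul_of_one_le_right hG (one_le_div_add_div hx hy)).trans h

lemma mul_add_le_of_mul_div_add_div_le {x y G η : ℝ} (hx : 0 < x) (hy : 0 < y) (hG : 0 ≤ G)
    (h : G * (x / y + y / x) ≤ η) : G * (x + y) ≤ 2 * η * x := by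
  have h_ratio : G * (y / x) ≤ η :=
    (mul_le_mul_of_nonneg_left (le_add_of_nonneg_left (div_pos hx hy).le) hG).trans h
  calc G * (x + y) = (G + G * (y / x)) * x := by field_simp
    _ ≤ (η + η) * x := by gcongr; exact le_of_mul_div_add_div_le hx hy hG h
    _ = 2 * η * x := by ring

lemma TrueGraphs.failureEvent_subset (h : TrueGraphs s₁ s₂ d z w₁ w₂) (hz : 1 < z)
    {Ω : Type*} {X : Fin n → Ω → EuclideanSpace ℝ (Fin p₁ × Fin p₂)}
    {C : Matrix (Fin p₁ × Fin p₂) (Fin p₁ × Fin p₂) ℝ} {γ r : ℝ} (hα₁ : 0 < α₁) (hα₂ : 0 < α₂)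
    (herror : ∀ ω, NoiseBound (sampleCov (fun k => X k ω) - C) w₁ w₂ γ → ∀ {v₁ v₂},
      IsPenalizedMLE α₁ α₂ (sampleCov (fun k => X k ω)) v₁ v₂ →
        frobNorm (kronLaplacian v₁ v₂ - kronLaplacian w₁ w₂) ≤ r) :
    failureEvent α₁ α₂ X w₁ w₂ r ⊆
      {ω | ¬ NoiseBound (sampleCov (fun k => X k ω) - C) w₁ w₂ γ} := fun ω hω hN =>
  have := h.nonempty
  hω ⟨exists_isPenalizedMLE hα₁ hα₂ (sampleCov_posSemidef _) (h.feasible hz),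
    fun _ _ hv => herror ω hN hv⟩

lemma exists_measure_failureEvent_le_of_rate {τ : ℝ} (hd : 1 < d) (hz : 1 < z) (ha : 0 < a)
    (hτ : 0 < τ) : ∃ c > 0, ∃ η > 0, ∀ {p₁ p₂ n : ℕ} {w₁ : Edge p₁ → ℝ} {w₂ : Edge p₂ → ℝ}
      {α₁ α₂ g : ℝ}, TrueGraphs s₁ s₂ d z w₁ w₂ → 0 < n → 0 ≤ g →
        n * g ^ 2 = Real.log (p₁ * p₂) → g ^ 2 * ((p₁ : ℝ) / p₂ + (p₂ : ℝ) / p₁) ≤ η →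
        0 < α₁ → α₁ ≤ a * g * √p₂ → 0 < α₂ → α₂ ≤ a * g * √p₁ →
        ∀ {Ω : Type u} [MeasurableSpace Ω] {μ : Measure Ω} [IsProbabilityMeasure μ]
          {X : Fin n → Ω → EuclideanSpace ℝ (Fin p₁ × Fin p₂)},
          IsIGMRFSample μ (kronLaplacian w₁ w₂) X →
          μ (failureEvent α₁ α₂ X w₁ w₂ (c * (g * √(p₁ + p₂)))) ≤
            ENNReal.ofReal (((p₁ : ℝ) * p₂) ^ (-τ)) := by
  have hb : 0 ≤ noiseConst d z τ := by unfold noiseConst; positivity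
  obtain ⟨g₀, hg₀, θ, hθ, c, hc, h_error⟩ :=
    exists_forall_frobNorm_le (s := max 1 (max s₁ s₂)) (le_max_left _ _) hd hz ha hb
  set r := min g₀ (1 / (32 * d * z))
  have hr : 0 < r := lt_min hg₀ (by positivity)
  refine ⟨c, hc, min (r ^ 2) (θ / 2), by positivity, ?_⟩
  intro p₁ p₂ n w₁ w₂ α₁ α₂ g h hn hg hgn h_ratio hα₁_pos hα₁ hα₂_pos hα₂ Ω _ μ _ X
    ⟨hX, C, hC, hlaw⟩
  obtain ⟨hp₁, hp₂⟩ := h.one_lt (by linarith)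
  have hp₁' : (0 : ℝ) < p₁ := by positivity
  have hp₂' : (0 : ℝ) < p₂ := by positivity
  have hg_le : g ≤ r := abs_le_of_sq_le_sq' (le_of_mul_div_add_div_le hp₁' hp₂' (sq_nonneg g)
    (h_ratio.trans (min_le_left _ _))) hr.le |>.2
  have hgz : 8 * d * z * g ≤ 1 / 4 := by
    have h_le := hg_le.trans (min_le_right _ _)
    rw [le_div_iff₀ (by positivity)] at h_le
    linarith
  have hθ_le := h_ratio.trans (min_le_right _ _)
  have hθ₁ := mul_add_le_of_mul_div_add_div_le hp₁' hp₂' (sq_nonneg g) hθ_le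
  have hθ₂ := mul_add_le_of_mul_div_add_div_le hp₂' hp₁' (sq_nonneg g)
    (add_comm ((p₁ : ℝ) / p₂) _ ▸ hθ_le)
  rw [mul_div_cancel₀ _ two_ne_zero] at hθ₁ hθ₂
  rw [add_comm] at hθ₂
  have h_prob := h.measureReal_not_noiseBound_le_rpow (τ := τ) hd hz hC hn hX hlaw hg hgn hgz
  refine (measure_mono (h.failureEvent_subset hz hα₁_pos hα₂_pos fun ω hN _ _ hv => ?_)).trans
    ((ofReal_measureReal (μ := μ)).symm.trans_le (ENNReal.ofReal_le_ofReal h_prob))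
  exact h_error (h.mono (by simp) (by simp)) hC hg (hg_le.trans (min_le_left _ _)) hθ₁ hθ₂
    hα₁_pos hα₁ hα₂_pos hα₂ hN hv

theorem exists_measure_failureEvent_le {τ : ℝ} (hd : 1 < d) (hz : 1 < z) (ha : 0 < a)
    (hτ : 0 < τ) : ∃ c : ℝ, 0 < c ∧ ∃ C : ℝ, 0 < C ∧
      ∀ (p₁ p₂ n : ℕ) (w₁ : Edge p₁ → ℝ) (w₂ : Edge p₂ → ℝ),
        TrueGraphs s₁ s₂ d z w₁ w₂ →
        C * ((p₁ : ℝ) / p₂ + (p₂ : ℝ) / p₁) * Real.log (p₁ * p₂) ≤ n →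
        ∀ α₁ α₂ : ℝ, ProperPenalty a p₁ p₂ n α₁ α₂ →
        ∀ (Ω : Type u) [MeasurableSpace Ω] (μ : Measure Ω) [IsProbabilityMeasure μ]
          (X : Fin n → Ω → EuclideanSpace ℝ (Fin p₁ × Fin p₂)),
          IsIGMRFSample μ (kronLaplacian w₁ w₂) X →
          μ (failureEvent α₁ α₂ X w₁ w₂
              (c * √(((p₁ : ℝ) + p₂) * Real.log (p₁ * p₂) / n)))
            ≤ ENNReal.ofReal (((p₁ : ℝ) * p₂) ^ (-τ)) := by
  obtain ⟨c, hc, η, hη, h_bound⟩ :=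
    exists_measure_failureEvent_le_of_rate (s₁ := s₁) (s₂ := s₂) hd hz ha hτ
  refine ⟨c, hc, 1 / η, by positivity, ?_⟩
  intro p₁ p₂ n w₁ w₂ h hn α₁ α₂ hα Ω _ μ _ X hX
  have hn_pos := hα.pos
  have hn_pos' : (0 : ℝ) < n := by exact_mod_cast hn_pos
  have h_log : 0 ≤ Real.log (p₁ * p₂) := by exact_mod_cast Real.log_natCast_nonneg (p₁ * p₂)
  have h_rate : ∀ P : ℝ, 0 ≤ P →
      √(P * Real.log (p₁ * p₂) / n) = √(Real.log (p₁ * p₂) / n) * √P := fun P hP => by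
    rw [mul_div_assoc, Real.sqrt_mul hP, mul_comm]
  have h_sq : √(Real.log (p₁ * p₂) / n) ^ 2 = Real.log (p₁ * p₂) / n :=
    Real.sq_sqrt (by positivity)
  obtain ⟨⟨hα₁_pos, hα₁⟩, hα₂_pos, hα₂⟩ := hα
  rw [h_rate _ (by positivity), ← mul_assoc] at hα₁ hα₂
  rw [h_rate _ (by positivity)]
  refine h_bound h hn_pos (Real.sqrt_nonneg _) (by rw [h_sq, mul_div_cancel₀ _ hn_pos'.ne']) ?_
    hα₁_pos hα₁ hα₂_pos hα₂ hX
  rw [mul_assoc, one_div_mul_eq_div, div_le_iff₀ hη] at hn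
  rw [h_sq, div_mul_eq_mul_div, div_le_iff₀ hn_pos']
  linarith

lemma failureEvent_anti {Ω : Type*} {r r' : ℝ}
    {X : Fin n → Ω → EuclideanSpace ℝ (Fin p₁ × Fin p₂)} (hr : r ≤ r') :
    failureEvent α₁ α₂ X w₁ w₂ r' ⊆ failureEvent α₁ α₂ X w₁ w₂ r :=
  fun _ hω hgood => hω ⟨hgood.1, fun v₁ v₂ hv => (hgood.2 v₁ v₂ hv).trans hr⟩

lemma exists_forall_rpow_neg_le {x δ : ℝ} (hx : 1 < x) (hδ : 0 < δ) :
    ∃ τ : ℝ, 0 < τ ∧ ∀ y, x ≤ y → y ^ (-τ) ≤ δ := by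
  have h_small : ∀ᶠ τ : ℝ in Filter.atTop, x ^ (-τ) < δ :=
    ((tendsto_rpow_atBot_of_base_gt_one x hx).comp
      Filter.tendsto_neg_atTop_atBot).eventually_lt_const hδ
  obtain ⟨τ, hτ, hτδ⟩ := ((Filter.eventually_gt_atTop 0).and h_small).exists
  exact ⟨τ, hτ, fun y hxy =>
    (Real.rpow_le_rpow_of_nonpos (by linarith) hxy (by linarith)).trans hτδ.le⟩

lemma mul_add_mul_log_le {x y C n : ℝ} (hx : 1 ≤ x) (hy : 1 ≤ y) (hC : 0 < C)
    (h : (x + y) * Real.log (x * y) ≤ 1 / C * n) :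
    C * (x / y + y / x) * Real.log (x * y) ≤ n := by
  have h_log : 0 ≤ Real.log (x * y) := Real.log_nonneg (one_le_mul_of_one_le_of_one_le hx hy)
  rw [one_div_mul_eq_div, le_div_iff₀ hC] at h
  calc C * (x / y + y / x) * Real.log (x * y) ≤ C * (x + y) * Real.log (x * y) := by
        gcongr
        · exact div_le_self (by linarith) hy
        · exact div_le_self (by linarith) hx
    _ = (x + y) * Real.log (x * y) * C := by ring
    _ ≤ n := h

lemma mul_sqrt_div_le {c ε A n : ℝ} (hc : 0 < c) (hε : 0 ≤ ε) (hn : 0 ≤ n)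
    (h : A ≤ (ε / c) ^ 2 * n) : c * √(A / n) ≤ ε := by
  rw [← le_div_iff₀' hc]
  exact Real.sqrt_le_iff.2 ⟨by positivity, div_le_of_le_mul₀ hn (by positivity) h⟩

end FailureProbability

end KSGL

theorem theorem3 (s₁ s₂ d z a : ℝ) (hs₁ : 0 < s₁) (hs₂ : 0 < s₂) (hd : 1 < d) (hz : 1 < z)
    (ha : 0 < a) :
    (∀ τ : ℝ, 0 < τ → ∃ c : ℝ, 0 < c ∧ ∃ C : ℝ, 0 < C ∧
      ∀ (p₁ p₂ n : ℕ) (w₁ : KSGL.Edge p₁ → ℝ) (w₂ : KSGL.Edge p₂ → ℝ),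
        KSGL.TrueGraphs s₁ s₂ d z w₁ w₂ →
        C * ((p₁ : ℝ) / p₂ + (p₂ : ℝ) / p₁) * Real.log (p₁ * p₂) ≤ n →
        ∀ α₁ α₂ : ℝ, KSGL.ProperPenalty a p₁ p₂ n α₁ α₂ →
        ∀ (Ω : Type u) [MeasurableSpace Ω] (μ : Measure Ω) [IsProbabilityMeasure μ]
          (X : Fin n → Ω → EuclideanSpace ℝ (Fin p₁ × Fin p₂)),
          KSGL.IsIGMRFSample μ (KSGL.kronLaplacian w₁ w₂) X →
          μ (KSGL.failureEvent α₁ α₂ X w₁ w₂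
              (c * Real.sqrt (((p₁ : ℝ) + p₂) * Real.log (p₁ * p₂) / n)))
            ≤ ENNReal.ofReal (((p₁ : ℝ) * p₂) ^ (-τ))) ∧
    (∀ ε δ : ℝ, 0 < ε → 0 < δ → ∃ ρ : ℝ, 0 < ρ ∧
      ∀ (p₁ p₂ n : ℕ) (w₁ : KSGL.Edge p₁ → ℝ) (w₂ : KSGL.Edge p₂ → ℝ),
        KSGL.TrueGraphs s₁ s₂ d z w₁ w₂ →
        ((p₁ : ℝ) + p₂) * Real.log (p₁ * p₂) ≤ ρ * n →
        ∀ α₁ α₂ : ℝ, KSGL.ProperPenalty a p₁ p₂ n α₁ α₂ →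
        ∀ (Ω : Type u) [MeasurableSpace Ω] (μ : Measure Ω) [IsProbabilityMeasure μ]
          (X : Fin n → Ω → EuclideanSpace ℝ (Fin p₁ × Fin p₂)),
          KSGL.IsIGMRFSample μ (KSGL.kronLaplacian w₁ w₂) X →
          μ (KSGL.failureEvent α₁ α₂ X w₁ w₂ ε) ≤ ENNReal.ofReal δ) := by
  refine ⟨fun τ hτ => KSGL.exists_measure_failureEvent_le hd hz ha hτ, fun ε δ hε hδ => ?_⟩
  obtain ⟨τ, hτ, hτδ⟩ := KSGL.exists_forall_rpow_neg_le one_lt_two hδ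
  obtain ⟨c, hc, C, hC, hbound⟩ :=
    KSGL.exists_measure_failureEvent_le (s₁ := s₁) (s₂ := s₂) hd hz ha hτ
  refine ⟨min (1 / C) ((ε / c) ^ 2), by positivity, ?_⟩
  intro p₁ p₂ n w₁ w₂ h hn α₁ α₂ hα Ω _ μ _ X hX
  obtain ⟨hp₁, hp₂⟩ := h.one_lt (by linarith)
  have hp : (2 : ℝ) ≤ p₁ * p₂ := mod_cast hp₁.trans_le (Nat.le_mul_of_pos_right p₁ (by omega))
  have h_sample : C * ((p₁ : ℝ) / p₂ + p₂ / p₁) * Real.log (p₁ * p₂) ≤ n :=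
    KSGL.mul_add_mul_log_le (mod_cast hp₁.le) (mod_cast hp₂.le) hC
      (hn.trans (by gcongr; exact min_le_left _ _))
  have h_rate : c * Real.sqrt (((p₁ : ℝ) + p₂) * Real.log (p₁ * p₂) / n) ≤ ε :=
    KSGL.mul_sqrt_div_le hc hε.le n.cast_nonneg (hn.trans (by gcongr; exact min_le_right _ _))
  calc μ (KSGL.failureEvent α₁ α₂ X w₁ w₂ ε)
      ≤ μ (KSGL.failureEvent α₁ α₂ X w₁ w₂ _) := measure_mono (KSGL.failureEvent_anti h_rate)
    _ ≤ ENNReal.ofReal (((p₁ : ℝ) * p₂) ^ (-τ)) := hbound p₁ p₂ n w₁ w₂ h h_sample α₁ α₂ hα Ω μ X hX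
    _ ≤ ENNReal.ofReal δ := ENNReal.ofReal_le_ofReal (hτδ _ hp)
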